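/- **Setting.** Let $(\Omega,\mathcal F,(\mathcal F_t)_{t\in\mathbb R},\mathbb P)$ be a filtered probability space and let $W$ be an $(\mathcal F_t)$-adapted white noise on $\mathbb R$: a zero-mean Gaussian random measure on the Borel sets of finite Lebesgue measure $m$ with $\mathbb E[W(A)W(B)]=m(A\cap B)$, such that $W(A)$ is $\mathcal F_t$-measurable if $A\subset(-\infty,t]$ and independent of $\mathcal F_t$ if $A\subset[t,\infty)$. Let $\sigma$ be an adapted càdlàg process on $\mathbb R$, let $g\in L^2((0,\infty))$ be real-valued and deterministic, and assume that $\int_{-\infty}^t g^2(t-s)\sigma_s^2\,ds<\infty$ a.s. for every $t\in\mathbb R$. Put $$X_t=\int_{-\infty}^t g(t-s)\sigma_s\,W(ds),\qquad G_t=\int_{-\infty}^t g(t-s)\,W(ds),\qquad R(t)=\mathbb E[(G_{t+s}-G_s)^2].$$ Let $\alpha\in(-\frac12,0)\cup(0,\frac12)$. Below, each $L_f$ denotes a continuous function $(0,\infty)\to\mathbb R$ that is slowly varying at $0$, i.e. $\lim_{x\downarrow0}L_f(tx)/L_f(x)=1$ for all $t>0$. Assume: (A1) $g(x)=x^\alpha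 L_g(x)$ and $g''(x)=x^{\alpha-2}L_{g''}(x)$ for $x>0$; $g''\in L^2((\varepsilon,\infty))$ for every $\varepsilon>0$; $|g''|$ is non-increasing on $(a,\infty)$ for some $a>0$; and $\int_1^\infty|g''(s)|^2\sigma_{t-s}^2\,ds<\infty$ a.s. for every $t>0$. (A2) $R(x)=x^{2\alpha+1}L_R(x)$ and $R^{(4)}(x)=x^{2\alpha-3}L_{R^{(4)}}(x)$ for $x>0$; and for some $b\in(0,1)$, $\limsup_{x\downarrow0}\sup_{y\in[x,x^b]}|L_{R^{(4)}}(y)/L_R(x)|<\infty$. Let $p>0$, and let $\Delta_n>0$ with $\Delta_n\to0$. For $v\in\{1,2\}$ and $t>0$ put $$V_v^n(t)=\sum_{i=2v}^{[t/\Delta_n]}\bigl|X_{i\Delta_n}-2X_{(i-v)\Delta_n}+X_{(i-2v)\Delta_n}\bigr|^p,\qquad \mathrm{COF}(p,\Delta_n)_t=\frac{V_2^n(t)}{V_1^n(t)}.$$ **Proposition.** Let $0<t_0\le T$ and suppose that, almost surely, $\sigma$ does not vanish identically on $[0,t_0)$. Then, as $n\to\infty$, $$\sup_{t\in[t_0,T]}\Bigl|\mathrm{COF}(p,\Delta_n)_t-2^{(2\alpha+1)p/2}\Bigr|\longrightarrow0\quad\text{in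 probability},$$ and, with $h_p(x)=\frac{\log_2x}{p}-\frac12$ for $x>0$, the estimator $\hat\alpha(p,\Delta_n,t)=h_p\bigl(\mathrm{COF}(p,\Delta_n)_t\bigr)$ satisfies $$\sup_{t\in[t_0,T]}\bigl|\hat\alpha(p,\Delta_n,t)-\alpha\bigr|\longrightarrow0\quad\text{in probability}.$$ (The values assigned to the ratio when $V_1^n(t)=0$, and to $h_p(x)$ when $x\le 0$, do not matter.) -/

import Mathlib

open MeasureTheory ProbabilityTheory Filter Topology Set
open scoped ENNReal

namespace BSS

variable {Ω : Type*} {mΩ : MeasurableSpace Ω}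

/-! ### White noise and stochastic integration on the real line -/

/-- `W` is an `ℱ`-adapted white noise on `ℝ`: a zero-mean Gaussian random measure, indexed by the
Borel sets of finite Lebesgue measure, with covariance `E[W(A) W(B)] = m(A ∩ B)`, such that `W(A)`
is `ℱ t`-measurable for `A ⊆ (-∞, t]` and independent of `ℱ t` for `A ⊆ [t, ∞)`. -/
structure IsWhiteNoise (μ : Measure Ω) (ℱ : Filtration ℝ mΩ) (W : Set ℝ → Ω → ℝ) : Prop where
  measurable : ∀ A : Set ℝ, MeasurableSet A → volume A < ∞ → Measurable (W A)
  gaussian : IsGaussianProcess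
    (fun A : {A : Set ℝ // MeasurableSet A ∧ volume A < ∞} => W A.1) μ
  mean_zero : ∀ A : Set ℝ, MeasurableSet A → volume A < ∞ → ∫ ω, W A ω ∂μ = 0
  cov : ∀ A B : Set ℝ, MeasurableSet A → volume A < ∞ → MeasurableSet B → volume B < ∞ →
    ∫ ω, W A ω * W B ω ∂μ = (volume (A ∩ B)).toReal
  adapted : ∀ (t : ℝ) (A : Set ℝ), MeasurableSet A → volume A < ∞ → A ⊆ Iic t →
    Measurable[ℱ t] (W A)
  indep : ∀ (t : ℝ) (A : Set ℝ), MeasurableSet A → volume A < ∞ → A ⊆ Ici t →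
    Indep (MeasurableSpace.comap (W A) inferInstance) (ℱ t) μ

/-- A simple (elementary predictable) integrand `∑ i, ξ i * 1_{(a i, b i]}`, where each `ξ i` is
bounded and `ℱ (a i)`-measurable. -/
structure SimpleIntegrand (ℱ : Filtration ℝ mΩ) where
  N : ℕ
  left : Fin N → ℝ
  right : Fin N → ℝ
  left_le_right : ∀ i, left i ≤ right i
  coef : Fin N → Ω → ℝ
  coef_measurable : ∀ i, Measurable[ℱ (left i)] (coef i)
  coef_bounded : ∃ C : ℝ, ∀ i ω, |coef i ω| ≤ C

/-- The value at `(s, ω)` of a simple integrand. -/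
noncomputable def SimpleIntegrand.eval {ℱ : Filtration ℝ mΩ} (S : SimpleIntegrand ℱ)
    (s : ℝ) (ω : Ω) : ℝ :=
  ∑ i, (Ioc (S.left i) (S.right i)).indicator (fun _ => S.coef i ω) s

/-- The stochastic integral `∑ i, ξ i * W((a i, b i])` of a simple integrand. -/
noncomputable def SimpleIntegrand.integral {ℱ : Filtration ℝ mΩ} (S : SimpleIntegrand ℱ)
    (W : Set ℝ → Ω → ℝ) (ω : Ω) : ℝ :=
  ∑ i, S.coef i ω * W (Ioc (S.left i) (S.right i)) ω

/-- `Y` is (a version of) the stochastic integral `∫ H_s W(ds)` over `ℝ`: there are simple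
integrands `S m` with `∫ |S m - H|² ds → 0` in probability, and their integrals converge to `Y` in
probability. -/
def IsItoIntegral (μ : Measure Ω) (ℱ : Filtration ℝ mΩ) (W : Set ℝ → Ω → ℝ)
    (H : ℝ → Ω → ℝ) (Y : Ω → ℝ) : Prop :=
  ∃ S : ℕ → SimpleIntegrand ℱ,
    (∀ ε : ℝ≥0∞, 0 < ε → Tendsto
      (fun m => μ {ω | ε ≤ ∫⁻ s, ENNReal.ofReal (((S m).eval s ω - H s ω) ^ 2)}) atTop (𝓝 0)) ∧
    TendstoInMeasure μ (fun m => (S m).integral W) atTop Y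

/-! ### The process -/

/-- Every path is right-continuous with (finite) left limits. -/
def IsCadlag (σ : ℝ → Ω → ℝ) : Prop :=
  ∀ ω t, ContinuousWithinAt (fun s => σ s ω) (Ici t) t ∧
    ∃ l : ℝ, Tendsto (fun s => σ s ω) (𝓝[<] t) (𝓝 l)

/-- `X` is the Brownian semistationary process `X_t = ∫_{-∞}^t g(t - s) σ_s W(ds)`, `t ∈ ℝ`. -/
def IsBSS (μ : Measure Ω) (ℱ : Filtration ℝ mΩ) (W : Set ℝ → Ω → ℝ) (g : ℝ → ℝ)
    (σ : ℝ → Ω → ℝ) (X : ℝ → Ω → ℝ) : Prop :=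
  ∀ t : ℝ, IsItoIntegral μ ℱ W
    (fun s ω => (Iio t).indicator (fun u => g (t - u) * σ u ω) s) (X t)

/-- `G` is the Gaussian core `G_t = ∫_{-∞}^t g(t - s) W(ds)`, `t ∈ ℝ`. -/
def IsGaussianCore (μ : Measure Ω) (ℱ : Filtration ℝ mΩ) (W : Set ℝ → Ω → ℝ) (g : ℝ → ℝ)
    (G : ℝ → Ω → ℝ) : Prop :=
  IsBSS μ ℱ W g (fun _ _ => 1) G

/-- The variogram `R(t) = E[(G_{t+s} - G_s)²]` of a stationary process, computed at `s = 0`. -/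
noncomputable def variogram (μ : Measure Ω) (G : ℝ → Ω → ℝ) (t : ℝ) : ℝ :=
  ∫ ω, (G t ω - G 0 ω) ^ 2 ∂μ

/-! ### Assumptions -/

/-- `L : (0, ∞) → ℝ` is continuous and slowly varying at `0`. -/
structure IsSlowlyVarying (L : ℝ → ℝ) : Prop where
  continuousOn : ContinuousOn L (Ioi 0)
  tendsto : ∀ t : ℝ, 0 < t → Tendsto (fun x => L (t * x) / L x) (𝓝[>] 0) (𝓝 1)

/-- Assumption (A1) for increments of order `k`: conditions on the weight function `g`, with
smoothness parameter `α`, and on the intermittency process `σ`. -/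
structure AssumptionA1 (μ : Measure Ω) (k : ℕ) (α : ℝ) (g : ℝ → ℝ) (σ : ℝ → Ω → ℝ) : Prop where
  g_eq : ∃ L : ℝ → ℝ, IsSlowlyVarying L ∧ ∀ x : ℝ, 0 < x → g x = x ^ α * L x
  g_smooth : ContDiffOn ℝ k g (Ioi 0)
  deriv_eq : ∃ L : ℝ → ℝ, IsSlowlyVarying L ∧
    ∀ x : ℝ, 0 < x → iteratedDeriv k g x = x ^ (α - k) * L x
  deriv_memLp : ∀ ε : ℝ, 0 < ε → MemLp (iteratedDeriv k g) 2 (volume.restrict (Ioi ε))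
  deriv_antitone : ∃ a : ℝ, 0 < a ∧ AntitoneOn (fun x => |iteratedDeriv k g x|) (Ioi a)
  tail_finite : ∀ t : ℝ, 0 < t → ∀ᵐ ω ∂μ,
    ∫⁻ s in Ioi 1, ENNReal.ofReal (|iteratedDeriv k g s| ^ 2 * σ (t - s) ω ^ 2) < ∞

/-- Assumption (A2) for increments of order `k`: conditions on the variogram `R`, with smoothness
parameter `α`. -/
def AssumptionA2 (k : ℕ) (α : ℝ) (R : ℝ → ℝ) : Prop :=
  ContDiffOn ℝ (2 * k : ℕ) R (Ioi 0) ∧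
  ∃ L L' : ℝ → ℝ, IsSlowlyVarying L ∧ IsSlowlyVarying L' ∧
    (∀ x : ℝ, 0 < x → R x = x ^ (2 * α + 1) * L x) ∧
    (∀ x : ℝ, 0 < x → iteratedDeriv (2 * k) R x = x ^ (2 * α - 2 * k + 1) * L' x) ∧
    ∃ b : ℝ, 0 < b ∧ b < 1 ∧
      limsup (fun x : ℝ => ⨆ y ∈ Icc x (x ^ b), ENNReal.ofReal |L' y / L x|) (𝓝[>] 0) < ∞

/-! ### The statistics -/

/-- The `k`-th order difference `∑_{j=0}^k (-1)^j (k choose j) X_{(i - v j) δ}` at frequency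
`v δ`. -/
noncomputable def increment (X : ℝ → Ω → ℝ) (k v : ℕ) (δ : ℝ) (i : ℕ) (ω : Ω) : ℝ :=
  ∑ j ∈ Finset.range (k + 1),
    (-1 : ℝ) ^ j * (k.choose j : ℝ) * X (((i : ℝ) - (v : ℝ) * (j : ℝ)) * δ) ω

/-- The power variation `V(X, p, k, v; δ)_t = ∑_{i = v k}^{[t/δ]} |Δ_{i,k}^{n,v} X|^p`. -/
noncomputable def powerVariation (X : ℝ → Ω → ℝ) (p : ℝ) (k v : ℕ) (δ t : ℝ) (ω : Ω) : ℝ :=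
  ∑ i ∈ Finset.Icc (v * k) ⌊t / δ⌋₊, |increment X k v δ i ω| ^ p

/-- The change-of-frequency statistic `COF(p, δ)_t = V(X, p, 2, 2; δ)_t / V(X, p, 2, 1; δ)_t`. -/
noncomputable def COF (X : ℝ → Ω → ℝ) (p δ t : ℝ) (ω : Ω) : ℝ :=
  powerVariation X p 2 2 δ t ω / powerVariation X p 2 1 δ t ω

/-- `h_p(x) = log₂(x) / p - 1 / 2`. -/
noncomputable def hFun (p x : ℝ) : ℝ := Real.logb 2 x / p - 1 / 2

/-- Convergence in probability of `Y n` to `Z`, uniformly on the time set `K`: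
`sup_{t ∈ K} |Y n t - Z t| → 0` in probability. -/
def TendstoUCP (μ : Measure Ω) (K : Set ℝ) (Y : ℕ → ℝ → Ω → ℝ) (Z : ℝ → Ω → ℝ) : Prop :=
  ∀ ε : ℝ≥0∞, 0 < ε →
    Tendsto (fun n => μ {ω | ε ≤ ⨆ t ∈ K, ENNReal.ofReal |Y n t ω - Z t ω|}) atTop (𝓝 0)

end BSS

set_option linter.unusedSectionVars false

namespace BSS

/-! ### White noise on intervals -/

section WhiteNoise

variable {Ω : Type*} {mΩ : MeasurableSpace Ω} {μ : Measure Ω} [IsProbabilityMeasure μ]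
  {ℱ : Filtration ℝ mΩ} {W : Set ℝ → Ω → ℝ}

/-! Let τ²(d) be the squared L² norm of `kern g d`, the kernel of the second difference of step d.
The parallelogram law gives τ²(d) = 4R(d) - R(2d) (`kern_parallelogram`), so slow variation of L_R
yields τ²(2d)/τ²(d) → 2^(2α+1). Since 2α+1 < 2, τ²(d) dominates d⁴ near zero (`tauSq_asymptotics`),
whereas at distance more than ε from the origin the kernel is a second difference of a smooth
function and has squared norm O(d⁴) (`exists_sqNorm_tail_le`). The normalized kernel therefore
concentrates at the origin. For a lag ε that tends to zero slowly enough, the i-th increment divided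
by τ is close to σ(iδ - ε) Z_i, where Z_i integrates the normalized kernel against the noise on (iδ
- ε, iδ] (`exists_gaussian_approximation`).

The Z_i are Gaussian with variance tending to one, and two of them are independent when their times
differ by at least ε. Chebyshev's inequality then gives a law of large numbers for |Z_i|^p, without
any estimate of correlations. Riemann sums of |σ|^p with the weights |Z_i|^p show that δ τ^(-p)
V_v(t) tends to a constant times the integral of |σ|^p over [0, t]. Monotonicity in t and continuity
of the limit make this uniform (`exists_subseq_tendsto_powerVariation`). In the quotient the
integral cancels and (τ(2δ)/τ(δ))^p remains (`tendsto_ratio`).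

The stochastic integral is characterized only as a limit in probability of integrals of simple
integrands. What is needed about it comes from exponential martingales of simple integrands: real
exponents give moment bounds on events where the quadratic variation is bounded
(`IsItoIntegral.lintegral_rpow_le`), imaginary exponents give the Gaussian law of integrals of
deterministic functions and their independence for disjoint supports. Convergence in probability is
proved by finding, in every subsequence, a further one with almost sure convergence. This lets ε be
adapted to the mesh, and lets the lower bound for the integral of |σ|^p be random. -/

theorem IsWhiteNoise.hasGaussianLaw (hW : IsWhiteNoise μ ℱ W) {A : Set ℝ} (hA : MeasurableSet A)
    (hA' : volume A < ∞) : HasGaussianLaw (W A) μ :=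
  hW.gaussian.hasGaussianLaw_eval ⟨A, hA, hA'⟩

theorem IsWhiteNoise.integrable_mul (hW : IsWhiteNoise μ ℱ W) {A B : Set ℝ} (hA : MeasurableSet A)
    (hA' : volume A < ∞) (hB : MeasurableSet B) (hB' : volume B < ∞) :
    Integrable (fun ω => W A ω * W B ω) μ :=
  (hW.hasGaussianLaw hA hA').memLp_two.integrable_mul (hW.hasGaussianLaw hB hB').memLp_two

theorem IsWhiteNoise.map_eq (hW : IsWhiteNoise μ ℱ W) {A : Set ℝ} (hA : MeasurableSet A)
    (hA' : volume A < ∞) : μ.map (W A) = gaussianReal 0 (volume A).toNNReal := by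
  have h := (hW.hasGaussianLaw hA hA').map_eq_gaussianReal
  rw [h, hW.mean_zero A hA hA', variance_of_integral_eq_zero
    (hW.measurable A hA hA').aemeasurable (hW.mean_zero A hA hA')]
  congr 1
  have h2 := hW.cov A A hA hA' hA hA'
  simp only [← pow_two, inter_self] at h2
  rw [h2]
  simp [ENNReal.toNNReal, ENNReal.toReal, Real.toNNReal_coe]

theorem volume_Ioc_lt_top (a b : ℝ) : volume (Ioc a b) < ∞ := by simp

theorem IsWhiteNoise.map_Ioc (hW : IsWhiteNoise μ ℱ W) (a b : ℝ) :
    μ.map (W (Ioc a b)) = gaussianReal 0 (b - a).toNNReal := by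
  rw [hW.map_eq measurableSet_Ioc (volume_Ioc_lt_top a b), Real.volume_Ioc]
  rfl

/-- Additivity is not part of the definition of `W`; it holds almost surely because the covariance
formula makes the second moment of the defect vanish. -/
theorem IsWhiteNoise.Ioc_add (hW : IsWhiteNoise μ ℱ W) {a b c : ℝ} (hab : a ≤ b) (hbc : b ≤ c) :
    W (Ioc a c) =ᵐ[μ] fun ω => W (Ioc a b) ω + W (Ioc b c) ω := by
  have m : ∀ a b : ℝ, MeasurableSet (Ioc a b) := fun _ _ => measurableSet_Ioc
  have v := volume_Ioc_lt_top
  have i := fun a b c d : ℝ => hW.integrable_mul (m a b) (v a b) (m c d) (v c d)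
  have e := fun a b c d : ℝ => hW.cov _ _ (m a b) (v a b) (m c d) (v c d)
  have hz : ∫ ω, (W (Ioc a c) ω - (W (Ioc a b) ω + W (Ioc b c) ω)) ^ 2 ∂μ = 0 := by
    have hexp : ∀ ω, (W (Ioc a c) ω - (W (Ioc a b) ω + W (Ioc b c) ω)) ^ 2 =
        W (Ioc a c) ω * W (Ioc a c) ω + W (Ioc a b) ω * W (Ioc a b) ω
        + W (Ioc b c) ω * W (Ioc b c) ω - 2 * (W (Ioc a c) ω * W (Ioc a b) ω)
        - 2 * (W (Ioc a c) ω * W (Ioc b c) ω) + 2 * (W (Ioc a b) ω * W (Ioc b c) ω) :=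
      fun ω => by ring
    simp_rw [hexp]
    rw [integral_add, integral_sub, integral_sub, integral_add, integral_add,
      integral_const_mul, integral_const_mul, integral_const_mul, e, e, e, e, e, e]
    · have h1 : Ioc a c ∩ Ioc a b = Ioc a b := inter_eq_right.2 (Ioc_subset_Ioc_right hbc)
      have h2 : Ioc a c ∩ Ioc b c = Ioc b c := inter_eq_right.2 (Ioc_subset_Ioc_left hab)
      have h3 : Ioc a b ∩ Ioc b c = ∅ := by
        ext x; simp only [mem_inter_iff, mem_Ioc, mem_empty_iff_false, iff_false]; grind
      simp only [inter_self, h1, h2, h3, Real.volume_Ioc, measure_empty]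
      rw [ENNReal.toReal_ofReal (by linarith), ENNReal.toReal_ofReal (by linarith),
        ENNReal.toReal_ofReal (by linarith)]
      simp; ring
    all_goals
      first
      | exact i _ _ _ _
      | exact (i _ _ _ _).const_mul _
      | skip
    · exact (i _ _ _ _).add (i _ _ _ _)
    · exact ((i _ _ _ _).add (i _ _ _ _)).add (i _ _ _ _)
    · exact (((i _ _ _ _).add (i _ _ _ _)).add (i _ _ _ _)).sub ((i _ _ _ _).const_mul _)
    · exact ((((i _ _ _ _).add (i _ _ _ _)).add (i _ _ _ _)).sub ((i _ _ _ _).const_mul _)).sub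
        ((i _ _ _ _).const_mul _)
  have hi : Integrable (fun ω => (W (Ioc a c) ω - (W (Ioc a b) ω + W (Ioc b c) ω)) ^ 2) μ :=
    ((hW.hasGaussianLaw (m a c) (v a c)).memLp_two.sub
      ((hW.hasGaussianLaw (m a b) (v a b)).memLp_two.add
        (hW.hasGaussianLaw (m b c) (v b c)).memLp_two)).integrable_sq
  have := (integral_eq_zero_iff_of_nonneg (fun ω => sq_nonneg _) hi).1 hz
  filter_upwards [this] with ω hω
  simp only [Pi.zero_apply, pow_eq_zero_iff, ne_eq, OfNat.ofNat_ne_zero, not_false_eq_true] at hω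
  linarith

theorem IsWhiteNoise.indepFun_Ioc (hW : IsWhiteNoise μ ℱ W) {E : Type*} [MeasurableSpace E]
    {a b : ℝ} {U : Ω → E} (hU : Measurable[ℱ a] U) : IndepFun U (W (Ioc a b)) μ := by
  have h := hW.indep a (Ioc a b) measurableSet_Ioc (volume_Ioc_lt_top a b)
    (Ioc_subset_Ioi_self.trans Ioi_subset_Ici_self)
  rw [IndepFun_iff_Indep]
  exact (indep_of_indep_of_le_right h hU.comap_le).symm

/-- Integrates out the fresh noise on `(a, b]` with the past frozen. This replaces conditional
expectations in the martingale computations. -/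
theorem IsWhiteNoise.lintegral_Ioc (hW : IsWhiteNoise μ ℱ W) {E : Type*} [MeasurableSpace E]
    {a b : ℝ} {U : Ω → E} (hU : Measurable[ℱ a] U) {f : E × ℝ → ℝ≥0∞} (hf : Measurable f) :
    ∫⁻ ω, f (U ω, W (Ioc a b) ω) ∂μ =
      ∫⁻ ω, ∫⁻ w, f (U ω, w) ∂(gaussianReal 0 (b - a).toNNReal) ∂μ := by
  have hU' : Measurable U := hU.mono (ℱ.le a) le_rfl
  have hWm := hW.measurable (Ioc a b) measurableSet_Ioc (volume_Ioc_lt_top a b)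
  have h := (hW.indepFun_Ioc (b := b) hU).map_prod_eq_prod_map_map hU'.aemeasurable
    hWm.aemeasurable
  rw [← lintegral_map hf (hU'.prodMk hWm), h, lintegral_prod _ hf.aemeasurable, hW.map_Ioc,
    lintegral_map hf.lintegral_prod_right' hU']

theorem IsWhiteNoise.integral_Ioc (hW : IsWhiteNoise μ ℱ W) {E : Type*} [MeasurableSpace E]
    {a b : ℝ} {U : Ω → E} (hU : Measurable[ℱ a] U) {f : E × ℝ → ℂ} (hf : Measurable f)
    (hi : Integrable (fun ω => f (U ω, W (Ioc a b) ω)) μ) :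
    ∫ ω, f (U ω, W (Ioc a b) ω) ∂μ =
      ∫ ω, ∫ w, f (U ω, w) ∂(gaussianReal 0 (b - a).toNNReal) ∂μ := by
  have hU' : Measurable U := hU.mono (ℱ.le a) le_rfl
  have hWm := hW.measurable (Ioc a b) measurableSet_Ioc (volume_Ioc_lt_top a b)
  have h := (hW.indepFun_Ioc (b := b) hU).map_prod_eq_prod_map_map hU'.aemeasurable
    hWm.aemeasurable
  have hp := hU'.prodMk hWm
  have hi' : Integrable f (μ.map fun ω => (U ω, W (Ioc a b) ω)) :=
    (integrable_map_measure hf.aestronglyMeasurable hp.aemeasurable).2 hi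
  rw [← integral_map (φ := fun ω => (U ω, W (Ioc a b) ω)) hp.aemeasurable
    hf.aestronglyMeasurable, h] 
  rw [h] at hi'
  rw [integral_prod _ hi', hW.map_Ioc, integral_map hU'.aemeasurable]
  exact (hf.stronglyMeasurable.integral_prod_right').aestronglyMeasurable

theorem IsWhiteNoise.measurable_Ioc (hW : IsWhiteNoise μ ℱ W) {a b : ℝ} :
    Measurable[ℱ b] (W (Ioc a b)) :=
  hW.adapted b _ measurableSet_Ioc (volume_Ioc_lt_top a b) Ioc_subset_Iic_self

end WhiteNoise

/-! ### Integrands on a grid -/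

/-- A simple integrand `∑ k < M, c k * 1_{(t k, t (k+1)]}` on a monotone grid. -/
structure GridIntegrand {Ω : Type*} {mΩ : MeasurableSpace Ω} (ℱ : Filtration ℝ mΩ) where
  M : ℕ
  t : ℕ → ℝ
  mono : Monotone t
  c : ℕ → Ω → ℝ
  measurable : ∀ k, Measurable[ℱ (t k)] (c k)
  bounded : ∃ C : ℝ, ∀ k ω, |c k ω| ≤ C

namespace GridIntegrand

variable {Ω : Type*} {mΩ : MeasurableSpace Ω} {μ : Measure Ω} [IsProbabilityMeasure μ]
  {ℱ : Filtration ℝ mΩ} {W : Set ℝ → Ω → ℝ} (D : GridIntegrand ℱ)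

/-- The value at `(s, ω)`. -/
noncomputable def eval (s : ℝ) (ω : Ω) : ℝ :=
  ∑ k ∈ Finset.range D.M, (Ioc (D.t k) (D.t (k + 1))).indicator (fun _ => D.c k ω) s

/-- The partial sums of the stochastic integral. -/
noncomputable def partialIntegral (W : Set ℝ → Ω → ℝ) (m : ℕ) (ω : Ω) : ℝ :=
  ∑ k ∈ Finset.range m, D.c k ω * W (Ioc (D.t k) (D.t (k + 1))) ω

/-- The partial sums of the quadratic variation. -/
noncomputable def partialEnergy (m : ℕ) (ω : Ω) : ℝ :=
  ∑ k ∈ Finset.range m, D.c k ω ^ 2 * (D.t (k + 1) - D.t k)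

/-- The stochastic integral. -/
noncomputable def integral (W : Set ℝ → Ω → ℝ) (ω : Ω) : ℝ := D.partialIntegral W D.M ω

/-- The quadratic variation. -/
noncomputable def energy (ω : Ω) : ℝ := D.partialEnergy D.M ω

theorem step_nonneg (k : ℕ) : 0 ≤ D.t (k + 1) - D.t k := sub_nonneg.2 (D.mono (Nat.le_succ k))

theorem partialEnergy_mono (ω : Ω) : Monotone fun m => D.partialEnergy m ω := by
  refine monotone_nat_of_le_succ fun m => ?_
  simp only [partialEnergy, Finset.sum_range_succ, le_add_iff_nonneg_right]
  exact mul_nonneg (sq_nonneg _) (D.step_nonneg m)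

theorem energy_nonneg (ω : Ω) : 0 ≤ D.energy ω := by
  unfold energy partialEnergy
  exact Finset.sum_nonneg fun k _ => mul_nonneg (sq_nonneg _) (D.step_nonneg k)

theorem measurable_of_le {k m : ℕ} (h : k ≤ m) : Measurable[ℱ (D.t m)] (D.c k) :=
  (D.measurable k).mono (ℱ.mono (D.mono h)) le_rfl

/-- The bound `n + 1` expresses predictability: the energy of cell `n` depends only on the
coefficient `c n`, already known at time `t n`. -/
theorem measurable_partialEnergy {m n : ℕ} (h : m ≤ n + 1) :
    Measurable[ℱ (D.t n)] (D.partialEnergy m) := by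
  refine Finset.measurable_sum _ fun k hk => ?_
  have hk' : k ≤ n := by have := Finset.mem_range.1 hk; omega
  exact ((D.measurable_of_le hk').pow_const 2).mul_const _

theorem measurable_partialIntegral (hW : IsWhiteNoise μ ℱ W) {m n : ℕ} (h : m ≤ n) :
    Measurable[ℱ (D.t n)] (D.partialIntegral W m) := by
  refine Finset.measurable_sum _ fun k hk => ?_
  have hk' : k + 1 ≤ n := by have := Finset.mem_range.1 hk; omega
  exact (D.measurable_of_le (by omega)).mul
    (hW.measurable_Ioc.mono (ℱ.mono (D.mono hk')) le_rfl)

/-- The cells of a monotone grid are disjoint, so at each point at most one term survives and the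
square of the sum is the sum of the squares. -/
theorem lintegral_eval_sq (ω : Ω) :
    ∫⁻ s, ENNReal.ofReal (D.eval s ω ^ 2) = ENNReal.ofReal (D.energy ω) := by
  have hdisj := D.mono.pairwise_disjoint_on_Ioc_succ
  have hpt : ∀ s, ENNReal.ofReal (D.eval s ω ^ 2) = ∑ k ∈ Finset.range D.M,
      (Ioc (D.t k) (D.t (k + 1))).indicator (fun _ => ENNReal.ofReal (D.c k ω ^ 2)) s := by
    intro s
    unfold eval
    by_cases h : ∃ k ∈ Finset.range D.M, s ∈ Ioc (D.t k) (D.t (k + 1))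
    · obtain ⟨k, hk, hs⟩ := h
      have hne : ∀ j, j ≠ k → s ∉ Ioc (D.t j) (D.t (j + 1)) := fun j hj hs' =>
        Set.disjoint_left.1 (hdisj hj) hs' hs
      rw [Finset.sum_eq_single_of_mem k hk (fun j _ hj => indicator_of_notMem (hne j hj) _),
        Finset.sum_eq_single_of_mem k hk (fun j _ hj => indicator_of_notMem (hne j hj) _),
        indicator_of_mem hs, indicator_of_mem hs]
    · push Not at h
      rw [Finset.sum_eq_zero fun k hk => indicator_of_notMem (h k hk) _,
        Finset.sum_eq_zero fun k hk => indicator_of_notMem (h k hk) _]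
      simp
  simp_rw [hpt]
  rw [lintegral_finsetSum _ fun k _ => measurable_const.indicator measurableSet_Ioc]
  unfold energy partialEnergy
  rw [ENNReal.ofReal_sum_of_nonneg fun k _ => mul_nonneg (sq_nonneg _) (D.step_nonneg k)]
  refine Finset.sum_congr rfl fun k _ => ?_
  rw [lintegral_indicator measurableSet_Ioc, setLIntegral_const, Real.volume_Ioc,
    ENNReal.ofReal_mul (sq_nonneg _)]

/-- The exponential martingale has constant expectation. -/
theorem lintegral_exp (hW : IsWhiteNoise μ ℱ W) (l : ℝ) (m : ℕ) :
    ∫⁻ ω, ENNReal.ofReal (Real.exp (l * D.partialIntegral W m ω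
      - l ^ 2 / 2 * D.partialEnergy m ω)) ∂μ = 1 := by
  induction m with
  | zero => simp [partialIntegral, partialEnergy]
  | succ m ih =>
    rw [← ih]
    set d := D.t (m + 1) - D.t m with hd
    have hd0 : 0 ≤ d := D.step_nonneg m
    let Φ : Ω → ℝ := fun ω => l * D.partialIntegral W m ω - l ^ 2 / 2 * D.partialEnergy m ω
    have hΦ : Measurable[ℱ (D.t m)] Φ :=
      ((D.measurable_partialIntegral hW le_rfl).const_mul l).sub
        ((D.measurable_partialEnergy (by omega)).const_mul _)
    let f : (ℝ × ℝ) × ℝ → ℝ≥0∞ := fun x =>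
      ENNReal.ofReal (Real.exp (x.1.1 + (l * x.1.2 * x.2 - l ^ 2 / 2 * (x.1.2 ^ 2 * d))))
    have hf : Measurable f := by fun_prop
    have h := hW.lintegral_Ioc (a := D.t m) (b := D.t (m + 1)) (hΦ.prodMk (D.measurable m)) hf
    have e1 : ∀ ω, ENNReal.ofReal (Real.exp (l * D.partialIntegral W (m + 1) ω
        - l ^ 2 / 2 * D.partialEnergy (m + 1) ω)) =
        f ((Φ ω, D.c m ω), W (Ioc (D.t m) (D.t (m + 1))) ω) := by
      intro ω
      simp only [f, Φ, partialIntegral, partialEnergy, Finset.sum_range_succ]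
      congr 2; ring
    simp_rw [e1]
    rw [h]
    refine lintegral_congr fun ω => ?_
    simp only [f]
    rw [← hd]
    have hg : ∀ w, ENNReal.ofReal (Real.exp (Φ ω + (l * D.c m ω * w
        - l ^ 2 / 2 * (D.c m ω ^ 2 * d)))) =
        ENNReal.ofReal (Real.exp (Φ ω - l ^ 2 / 2 * (D.c m ω ^ 2 * d))) *
        ENNReal.ofReal (Real.exp (l * D.c m ω * w)) := by
      intro w
      rw [← ENNReal.ofReal_mul (Real.exp_nonneg _), ← Real.exp_add]
      congr 2; ring
    simp_rw [hg]
    rw [lintegral_const_mul _ (by fun_prop), ← ofReal_integral_eq_lintegral_ofReal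
      (integrable_exp_mul_gaussianReal _) (ae_of_all _ fun _ => Real.exp_nonneg _)]
    -- The Gaussian moment generating function contributes exactly the term that the compensator of
    -- cell `m` subtracts.
    have hm := congrFun (mgf_fun_id_gaussianReal (μ := 0) (v := d.toNNReal)) (l * D.c m ω)
    simp only [mgf] at hm
    rw [hm, ← ENNReal.ofReal_mul (Real.exp_nonneg _), ← Real.exp_add, Real.coe_toNNReal _ hd0]
    congr 2; simp only [Φ]; ring

/-- The complex exponential martingale has constant expectation. -/
theorem integral_cexp (hW : IsWhiteNoise μ ℱ W) (θ : ℝ) (m : ℕ) :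
    ∫ ω, Complex.exp ((θ * D.partialIntegral W m ω : ℝ) * Complex.I
      + (θ ^ 2 / 2 * D.partialEnergy m ω : ℝ)) ∂μ = 1 := by
  induction m with
  | zero => simp [partialIntegral, partialEnergy]
  | succ m ih =>
    rw [← ih]
    set d := D.t (m + 1) - D.t m with hd
    have hd0 : 0 ≤ d := D.step_nonneg m
    let Φ : Ω → ℂ := fun ω => (θ * D.partialIntegral W m ω : ℝ) * Complex.I
      + (θ ^ 2 / 2 * D.partialEnergy m ω : ℝ)
    have hΦ : Measurable[ℱ (D.t m)] Φ :=
      ((Complex.measurable_ofReal.comp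
        ((D.measurable_partialIntegral hW le_rfl).const_mul θ)).mul_const _).add
        (Complex.measurable_ofReal.comp ((D.measurable_partialEnergy (by omega)).const_mul _))
    let f : (ℂ × ℝ) × ℝ → ℂ := fun x =>
      Complex.exp (x.1.1 + ((θ * x.1.2 * x.2 : ℝ) * Complex.I
        + (θ ^ 2 / 2 * (x.1.2 ^ 2 * d) : ℝ)))
    have hf : Measurable f := by fun_prop
    have e1 : ∀ ω, Complex.exp ((θ * D.partialIntegral W (m + 1) ω : ℝ) * Complex.I
        + (θ ^ 2 / 2 * D.partialEnergy (m + 1) ω : ℝ)) =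
        f ((Φ ω, D.c m ω), W (Ioc (D.t m) (D.t (m + 1))) ω) := by
      intro ω
      simp only [f, Φ, partialIntegral, partialEnergy, Finset.sum_range_succ]
      congr 1; rw [hd]; push_cast; ring
    have hi : Integrable (fun ω => f ((Φ ω, D.c m ω), W (Ioc (D.t m) (D.t (m + 1))) ω)) μ := by
      -- The modulus is the exponential of the energy term alone, and bounded coefficients on
      -- finitely many cells bound the energy uniformly in `ω`.
      obtain ⟨C, hC⟩ := D.bounded
      refine Integrable.of_bound (hf.comp (((hΦ.prodMk (D.measurable m)).mono (ℱ.le _) le_rfl).prodMk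
        (hW.measurable _ measurableSet_Ioc (volume_Ioc_lt_top _ _)))).aestronglyMeasurable
        (Real.exp (θ ^ 2 / 2 * ∑ k ∈ Finset.range (m + 1), C ^ 2 * (D.t (k + 1) - D.t k)))
        (ae_of_all _ fun ω => ?_)
      rw [← e1, Complex.norm_exp]
      simp only [Complex.add_re, Complex.mul_re, Complex.ofReal_re, Complex.I_re, mul_zero,
        Complex.ofReal_im, Complex.I_im, sub_zero, zero_add, mul_one]
      refine Real.exp_le_exp.2 (mul_le_mul_of_nonneg_left ?_ (by positivity))
      refine Finset.sum_le_sum fun k _ => mul_le_mul_of_nonneg_right ?_ (D.step_nonneg k)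
      rw [← sq_abs]
      exact pow_le_pow_left₀ (abs_nonneg _) (hC k ω) 2
    simp_rw [e1]
    rw [hW.integral_Ioc (a := D.t m) (b := D.t (m + 1)) (hΦ.prodMk (D.measurable m)) hf hi]
    refine integral_congr_ae (ae_of_all _ fun ω => ?_)
    simp only [f]
    rw [← hd]
    have hg : ∀ w : ℝ, Complex.exp (Φ ω + ((θ * D.c m ω * w : ℝ) * Complex.I
        + (θ ^ 2 / 2 * (D.c m ω ^ 2 * d) : ℝ))) =
        Complex.exp (Φ ω + (θ ^ 2 / 2 * (D.c m ω ^ 2 * d) : ℝ)) *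
        Complex.exp ((θ * D.c m ω : ℝ) * w * Complex.I) := by
      intro w
      rw [← Complex.exp_add]
      congr 1; push_cast; ring
    simp_rw [hg]
    rw [integral_const_mul, ← charFun_apply_real, charFun_gaussianReal, ← Complex.exp_add]
    congr 1
    rw [Real.coe_toNNReal _ hd0]
    simp only [Φ]; push_cast; ring

/-- Coefficients are switched off once the quadratic variation would exceed `C`. -/
noncomputable def truncate (C : ℝ) : GridIntegrand ℱ where
  M := D.M
  t := D.t
  mono := D.mono
  -- The test includes the energy of cell `k` itself. It is known at time `t k`, so adaptedness is
  -- kept and the cap `C` is never overshot.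
  c k ω := {ω | D.partialEnergy (k + 1) ω ≤ C}.indicator (D.c k) ω
  measurable k := (D.measurable k).indicator
    (measurableSet_le (D.measurable_partialEnergy le_rfl) measurable_const)
  bounded := by
    obtain ⟨C', hC⟩ := D.bounded
    exact ⟨C', fun k ω => by
      by_cases h : ω ∈ {ω | D.partialEnergy (k + 1) ω ≤ C}
      · rw [indicator_of_mem h]; exact hC k ω
      · rw [indicator_of_notMem h, abs_zero]; exact (abs_nonneg _).trans (hC k ω)⟩

/-- The comparison with the original energy is what closes the induction: on a kept cell the
truncated energy is at most the original one, which passes the test `≤ C`. -/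
theorem truncate_partialEnergy_le {C : ℝ} (hC : 0 ≤ C) (m : ℕ) (ω : Ω) :
    (D.truncate C).partialEnergy m ω ≤ min C (D.partialEnergy m ω) := by
  induction m with
  | zero => simp [partialEnergy, hC]
  | succ m ih =>
    have e : (D.truncate C).partialEnergy (m + 1) ω = (D.truncate C).partialEnergy m ω +
      (D.truncate C).c m ω ^ 2 * (D.t (m + 1) - D.t m) := Finset.sum_range_succ _ _
    have e' : D.partialEnergy (m + 1) ω = D.partialEnergy m ω +
      D.c m ω ^ 2 * (D.t (m + 1) - D.t m) := Finset.sum_range_succ _ _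
    have hmono := D.partialEnergy_mono ω (Nat.le_succ m)
    simp only [Nat.succ_eq_add_one] at hmono
    by_cases h : ω ∈ {ω | D.partialEnergy (m + 1) ω ≤ C}
    · have : (D.truncate C).c m ω = D.c m ω := indicator_of_mem h _
      rw [e, this, e'] 
      have h' : D.partialEnergy (m + 1) ω ≤ C := h
      have := ih.trans (min_le_right _ _)
      refine le_min ?_ ?_ <;> linarith
    · have : (D.truncate C).c m ω = 0 := indicator_of_notMem h _
      rw [e, this]
      have h1 := ih.trans (min_le_left _ _)
      have h2 := ih.trans (min_le_right _ _)
      refine le_min ?_ ?_ <;> linarith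

theorem truncate_eq {C : ℝ} {ω : Ω} (h : D.energy ω ≤ C) :
    (D.truncate C).energy ω = D.energy ω ∧ (D.truncate C).integral W ω = D.integral W ω := by
  have hc : ∀ k ∈ Finset.range D.M, (D.truncate C).c k ω = D.c k ω := fun k hk =>
    indicator_of_mem (s := {ω | D.partialEnergy (k + 1) ω ≤ C})
      ((D.partialEnergy_mono ω (Finset.mem_range.1 hk)).trans h) _
  constructor
  · exact Finset.sum_congr rfl fun k hk => congrArg (fun x : ℝ => x ^ 2 * _) (hc k hk)
  · exact Finset.sum_congr rfl fun k hk => congrArg (fun x : ℝ => x * _) (hc k hk)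

end GridIntegrand
end BSS

namespace BSS

/-! ### Simple integrands as grid integrands -/

theorem exists_monotone_grid (F : Finset ℝ) :
    ∃ (M : ℕ) (t : ℕ → ℝ), Monotone t ∧ ∀ x ∈ F, ∃ k ≤ M, t k = x := by
  induction F using Finset.induction_on_max with
  | empty => exact ⟨0, fun _ => 0, monotone_const, by simp⟩
  | insert x F hx ih =>
    obtain ⟨M, t, ht, hF⟩ := ih
    -- The new point `x` exceeds every point of `F`, but the old grid may contain superfluous points
    -- beyond `x`; capping by `x` restores monotonicity without moving points of `F`.
    refine ⟨M + 1, fun k => if k ≤ M then min (t k) x else x, ?_, ?_⟩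
    · intro k l hkl
      have := ht hkl
      by_cases h1 : k ≤ M <;> by_cases h2 : l ≤ M
      · simp only [h1, h2, if_true]; exact min_le_min_right _ this
      · simp [h1, h2]
      · omega
      · simp [h1, h2]
    · intro y hy
      rcases Finset.mem_insert.1 hy with rfl | hy
      · exact ⟨M + 1, le_rfl, by simp⟩
      · obtain ⟨k, hk, rfl⟩ := hF y hy
        exact ⟨k, by omega, by simp [hk, (hx _ hy).le]⟩

theorem indicator_Ioc_eq_sum {t : ℕ → ℝ} (ht : Monotone t) {a b : ℕ} (hab : a ≤ b) (x s : ℝ) :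
    (Ioc (t a) (t b)).indicator (fun _ => x) s =
      ∑ k ∈ Finset.Ico a b, (Ioc (t k) (t (k + 1))).indicator (fun _ => x) s := by
  induction b, hab using Nat.le_induction with
  | base => simp
  | succ b hab ih =>
    rw [Finset.sum_Ico_succ_top hab, ← ih]
    have h1 := ht hab
    have h2 := ht (Nat.le_succ b)
    simp only [Nat.succ_eq_add_one] at h2
    simp only [indicator, mem_Ioc]
    by_cases p1 : t a < s <;> by_cases p2 : s ≤ t b <;> by_cases p3 : s ≤ t (b + 1) <;>
      by_cases p4 : t b < s <;> simp [p1, p2, p3, p4] <;> grind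

section

variable {Ω : Type*} {mΩ : MeasurableSpace Ω} {μ : Measure Ω} [IsProbabilityMeasure μ]
  {ℱ : Filtration ℝ mΩ} {W : Set ℝ → Ω → ℝ}

theorem IsWhiteNoise.Ioc_eq_sum (hW : IsWhiteNoise μ ℱ W) {t : ℕ → ℝ} (ht : Monotone t) {a b : ℕ}
    (hab : a ≤ b) :
    W (Ioc (t a) (t b)) =ᵐ[μ] fun ω => ∑ k ∈ Finset.Ico a b, W (Ioc (t k) (t (k + 1))) ω := by
  induction b, hab using Nat.le_induction with
  | base =>
    -- Additivity for an empty interval reads `W ∅ = W ∅ + W ∅`, hence `W ∅ = 0` almost surely.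
    have := hW.Ioc_add (le_refl (t a)) (le_refl (t a))
    filter_upwards [this] with ω hω
    simp at hω ⊢
    exact hω
  | succ b hab ih =>
    filter_upwards [ih, hW.Ioc_add (ht hab) (ht (Nat.le_succ b))] with ω h1 h2
    rw [Finset.sum_Ico_succ_top hab, ← h1, h2]

namespace SimpleIntegrand

/-- A common refinement by all endpoints turns overlapping intervals into disjoint cells, where the
martingale computation applies. The integrals agree only almost surely because additivity of `W`
does. -/
theorem exists_grid (hW : IsWhiteNoise μ ℱ W) (S : SimpleIntegrand ℱ) :
    ∃ D : GridIntegrand ℱ, (∀ s ω, D.eval s ω = S.eval s ω) ∧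
      D.integral W =ᵐ[μ] S.integral W := by
  obtain ⟨M, t, ht, hF⟩ := exists_monotone_grid
    (Finset.univ.image S.left ∪ Finset.univ.image S.right)
  have hl : ∀ i, ∃ k ≤ M, t k = S.left i := fun i => hF _ (by simp)
  have hr : ∀ i, ∃ k ≤ M, t k = S.right i := fun i => hF _ (by simp)
  choose a haM ha using hl
  choose b₀ hb₀M hb₀ using hr
  -- If the two endpoints of an interval coincide, the indices found for them may come in the wrong
  -- order; the maximum repairs this without changing the grid value.
  let b : Fin S.N → ℕ := fun i => max (a i) (b₀ i)
  have hab : ∀ i, a i ≤ b i := fun i => le_max_left _ _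
  have hbM : ∀ i, b i ≤ M := fun i => max_le (haM i) (hb₀M i)
  have hb : ∀ i, t (b i) = S.right i := by
    intro i
    rcases le_total (a i) (b₀ i) with h | h
    · simp only [b, max_eq_right h, hb₀]
    · simp only [b, max_eq_left h, ha]
      refine le_antisymm (S.left_le_right i) ?_
      rw [← ha, ← hb₀]; exact ht h
  obtain ⟨C, hC⟩ := S.coef_bounded
  let c : ℕ → Ω → ℝ := fun k ω => ∑ i, if k ∈ Finset.Ico (a i) (b i) then S.coef i ω else 0
  have key : ∀ (ω : Ω) (x : ℕ → ℝ), ∑ k ∈ Finset.range M, c k ω * x k =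
      ∑ i, S.coef i ω * ∑ k ∈ Finset.Ico (a i) (b i), x k := by
    intro ω x
    simp only [c, Finset.sum_mul, Finset.mul_sum]
    rw [Finset.sum_comm]
    refine Finset.sum_congr rfl fun i _ => ?_
    simp only [ite_mul, zero_mul]
    rw [← Finset.sum_filter]
    refine Finset.sum_congr ?_ fun _ _ => rfl
    ext k
    simp only [Finset.mem_filter, Finset.mem_range, Finset.mem_Ico]
    have := hbM i
    omega
  refine ⟨⟨M, t, ht, c, fun k => ?_, ∑ _i : Fin S.N, |C|, fun k ω => ?_⟩, fun s ω => ?_, ?_⟩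
  · refine Finset.measurable_sum _ fun i _ => ?_
    by_cases h : k ∈ Finset.Ico (a i) (b i)
    · simp only [h, if_true]
      refine (S.coef_measurable i).mono (ℱ.mono ?_) le_rfl
      rw [← ha]; exact ht (Finset.mem_Ico.1 h).1
    · simp only [h, if_false]; exact measurable_const
  · refine (Finset.abs_sum_le_sum_abs _ _).trans (Finset.sum_le_sum fun i _ => ?_)
    split_ifs
    · exact (hC i ω).trans (le_abs_self C)
    · simp
  · have e : ∀ (A : Set ℝ) (x : ℝ), A.indicator (fun _ => x) s = x * A.indicator (fun _ => 1) s :=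
      fun A x => by by_cases h : s ∈ A <;> simp [h]
    simp only [GridIntegrand.eval, SimpleIntegrand.eval]
    rw [Finset.sum_congr rfl fun k _ => e _ _, key ω]
    refine Finset.sum_congr rfl fun i _ => ?_
    rw [← indicator_Ioc_eq_sum ht (hab i), ha, hb, e _ (S.coef i ω)]
  · have h : ∀ᵐ ω ∂μ, ∀ i, W (Ioc (t (a i)) (t (b i))) ω =
        ∑ k ∈ Finset.Ico (a i) (b i), W (Ioc (t k) (t (k + 1))) ω :=
      ae_all_iff.2 fun i => hW.Ioc_eq_sum ht (hab i)
    filter_upwards [h] with ω hω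
    simp only [GridIntegrand.integral, GridIntegrand.partialIntegral, SimpleIntegrand.integral]
    rw [key ω]
    refine Finset.sum_congr rfl fun i _ => ?_
    rw [← hω i, ha, hb]

theorem measurable_eval (S : SimpleIntegrand ℱ) (ω : Ω) : Measurable fun s => S.eval s ω :=
  Finset.measurable_sum _ fun _ _ => measurable_const.indicator measurableSet_Ioc

theorem measurable_integral (hW : IsWhiteNoise μ ℱ W) (S : SimpleIntegrand ℱ) :
    Measurable (S.integral W) :=
  Finset.measurable_sum _ fun i _ => ((S.coef_measurable i).mono (ℱ.le _) le_rfl).mul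
    (hW.measurable _ measurableSet_Ioc (volume_Ioc_lt_top _ _))

theorem measurable_uncurry_eval (S : SimpleIntegrand ℱ) :
    Measurable (Function.uncurry S.eval) := by
  change Measurable fun x : ℝ × Ω => S.eval x.1 x.2
  refine Finset.measurable_sum _ fun i _ => ?_
  have : (fun x : ℝ × Ω => (Ioc (S.left i) (S.right i)).indicator (fun _ => S.coef i x.2) x.1) =
      (Prod.fst ⁻¹' Ioc (S.left i) (S.right i)).indicator fun x => S.coef i x.2 := by
    ext x; simp [indicator]
  rw [this]
  exact (((S.coef_measurable i).mono (ℱ.le _) le_rfl).comp measurable_snd).indicator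
    (measurable_fst measurableSet_Ioc)

/-! ### Operations on simple integrands -/

/-- Sum of simple integrands. -/
noncomputable def add (S S' : SimpleIntegrand ℱ) : SimpleIntegrand ℱ where
  N := S.N + S'.N
  left := Fin.append S.left S'.left
  right := Fin.append S.right S'.right
  left_le_right i := by
    refine Fin.addCases (fun i => ?_) (fun i => ?_) i
    · simpa using S.left_le_right i
    · simpa using S'.left_le_right i
  coef := Fin.append S.coef S'.coef
  coef_measurable i := by
    refine Fin.addCases (fun i => ?_) (fun i => ?_) i
    · rw [Fin.append_left, Fin.append_left]; exact S.coef_measurable i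
    · rw [Fin.append_right, Fin.append_right]; exact S'.coef_measurable i
  coef_bounded := by
    obtain ⟨C, hC⟩ := S.coef_bounded
    obtain ⟨C', hC'⟩ := S'.coef_bounded
    refine ⟨max C C', fun i ω => ?_⟩
    refine Fin.addCases (fun i => ?_) (fun i => ?_) i
    · simpa using Or.inl (hC i ω)
    · simpa using Or.inr (hC' i ω)

theorem add_eval (S S' : SimpleIntegrand ℱ) (s : ℝ) (ω : Ω) :
    (S.add S').eval s ω = S.eval s ω + S'.eval s ω := by
  unfold eval
  refine (Fin.sum_univ_add (a := S.N) (b := S'.N) _).trans ?_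
  simp [add]

theorem add_integral (S S' : SimpleIntegrand ℱ) (ω : Ω) :
    (S.add S').integral W ω = S.integral W ω + S'.integral W ω := by
  unfold integral
  refine (Fin.sum_univ_add (a := S.N) (b := S'.N) _).trans ?_
  simp [add]

/-- The simple integrand `ξ * 1_{(a, ∞)} * S` for a bounded `ℱ a`-measurable `ξ`. -/
noncomputable def mulIoi (S : SimpleIntegrand ℱ) (a : ℝ) (ξ : Ω → ℝ) (hξ : Measurable[ℱ a] ξ)
    (hb : ∃ C, ∀ ω, |ξ ω| ≤ C) : SimpleIntegrand ℱ where
  N := S.N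
  -- Clipping at `a` empties the intervals to the left of `a`, and `ξ` is measurable at every
  -- clipped left endpoint.
  left i := max (S.left i) a
  right i := max (S.right i) a
  left_le_right i := max_le_max_right _ (S.left_le_right i)
  coef i ω := ξ ω * S.coef i ω
  coef_measurable i := (hξ.mono (ℱ.mono (le_max_right _ _)) le_rfl).mul
    ((S.coef_measurable i).mono (ℱ.mono (le_max_left _ _)) le_rfl)
  coef_bounded := by
    obtain ⟨C, hC⟩ := S.coef_bounded
    obtain ⟨C', hC'⟩ := hb
    refine ⟨C' * C, fun i ω => ?_⟩
    rw [abs_mul]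
    exact mul_le_mul (hC' ω) (hC i ω) (abs_nonneg _) ((abs_nonneg _).trans (hC' ω))

theorem mulIoi_eval (S : SimpleIntegrand ℱ) (a : ℝ) (ξ : Ω → ℝ) (hξ : Measurable[ℱ a] ξ)
    (hb : ∃ C, ∀ ω, |ξ ω| ≤ C) (s : ℝ) (ω : Ω) :
    (S.mulIoi a ξ hξ hb).eval s ω = ξ ω * (Ioi a).indicator (fun s => S.eval s ω) s := by
  by_cases h : a < s
  · rw [indicator_of_mem (mem_Ioi.2 h)]
    unfold eval
    rw [Finset.mul_sum]
    refine Finset.sum_congr rfl fun i _ => ?_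
    simp only [mulIoi, indicator, mem_Ioc, max_lt_iff, h, and_true, le_max_iff, not_le.2 h,
      or_false]
    split_ifs <;> simp
  · rw [indicator_of_notMem (by simpa using h), mul_zero]
    refine Finset.sum_eq_zero fun i _ => indicator_of_notMem ?_ _
    simp only [mulIoi, mem_Ioc, max_lt_iff]
    tauto

theorem mulIoi_integral (S : SimpleIntegrand ℱ) (a : ℝ) (ξ : Ω → ℝ) (hξ : Measurable[ℱ a] ξ)
    (hb : ∃ C, ∀ ω, |ξ ω| ≤ C) (ω : Ω) :
    (S.mulIoi a ξ hξ hb).integral W ω =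
      ξ ω * (S.mulIoi a (fun _ => 1) measurable_const ⟨1, by simp⟩).integral W ω := by
  simp only [integral, mulIoi, Finset.mul_sum]
  exact Finset.sum_congr rfl fun i _ => by ring

/-- A scalar multiple of a simple integrand. -/
noncomputable def constMul (S : SimpleIntegrand ℱ) (r : ℝ) : SimpleIntegrand ℱ where
  N := S.N
  left := S.left
  right := S.right
  left_le_right := S.left_le_right
  coef i ω := r * S.coef i ω
  coef_measurable i := (S.coef_measurable i).const_mul r
  coef_bounded := by
    obtain ⟨C, hC⟩ := S.coef_bounded
    exact ⟨|r| * C, fun i ω => by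
      rw [abs_mul]; exact mul_le_mul_of_nonneg_left (hC i ω) (abs_nonneg _)⟩

theorem constMul_eval (S : SimpleIntegrand ℱ) (r s : ℝ) (ω : Ω) :
    (S.constMul r).eval s ω = r * S.eval s ω := by
  simp only [eval, constMul, Finset.mul_sum]
  refine Finset.sum_congr rfl fun i _ => ?_
  by_cases h : s ∈ Ioc (S.left i) (S.right i) <;> simp [h]

theorem constMul_integral (S : SimpleIntegrand ℱ) (r : ℝ) (ω : Ω) :
    (S.constMul r).integral W ω = r * S.integral W ω := by
  simp only [integral, constMul, Finset.mul_sum]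
  exact Finset.sum_congr rfl fun i _ => by ring

end SimpleIntegrand
end

/-! ### Convergence in probability -/

/-- Countably many sequences converging to zero in measure converge almost everywhere along a
common subsequence. -/
theorem exists_subseq_ae_tendsto_zero {Ω : Type*} {mΩ : MeasurableSpace Ω} {μ : Measure Ω}
    {F : ℕ → ℕ → Ω → ℝ≥0∞}
    (h : ∀ j, ∀ ε : ℝ≥0∞, 0 < ε → Tendsto (fun n => μ {ω | ε ≤ F j n ω}) atTop (𝓝 0)) :
    ∃ φ : ℕ → ℕ, StrictMono φ ∧ ∀ᵐ ω ∂μ, ∀ j, Tendsto (fun k => F j (φ k) ω) atTop (𝓝 0) := by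
  have hpos : ∀ k : ℕ, (0 : ℝ≥0∞) < 2⁻¹ ^ k := fun k => ENNReal.pow_pos (by simp) k
  -- Diagonal choice: stage `k` controls the sequences `0, …, k` at level `2⁻ᵏ`, so Borel–Cantelli
  -- applies to sequence `j` from stage `j` on.
  have hev : ∀ k : ℕ, ∀ᶠ n in atTop, ∀ j ≤ k, μ {ω | 2⁻¹ ^ k ≤ F j n ω} ≤ 2⁻¹ ^ k := by
    intro k
    have : ∀ᶠ n in atTop, ∀ j ∈ Finset.range (k + 1), μ {ω | 2⁻¹ ^ k ≤ F j n ω} ≤ 2⁻¹ ^ k :=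
      (Finset.eventually_all _).2 fun j _ =>
        (h j _ (hpos k)).eventually (Iic_mem_nhds (hpos k))
    filter_upwards [this] with n hn j hj
    exact hn j (Finset.mem_range.2 (by omega))
  obtain ⟨φ, hφ, hP⟩ := extraction_forall_of_eventually hev
  refine ⟨φ, hφ, ae_all_iff.2 fun j => ?_⟩
  have hsum : ∑' k, μ {ω | 2⁻¹ ^ (k + j) ≤ F j (φ (k + j)) ω} ≠ ∞ := by
    have hle : ∀ k, μ {ω | 2⁻¹ ^ (k + j) ≤ F j (φ (k + j)) ω} ≤ 2⁻¹ ^ k := fun k =>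
      (hP (k + j) j (by omega)).trans (pow_le_pow_right_of_le_one' (by simp) (by omega))
    refine ne_top_of_le_ne_top ?_ (ENNReal.tsum_le_tsum hle)
    rw [ENNReal.tsum_geometric]
    simp
  filter_upwards [ae_eventually_notMem hsum] with ω hω
  rw [← tendsto_add_atTop_iff_nat j]
  have h0 : Tendsto (fun k : ℕ => (2⁻¹ : ℝ≥0∞) ^ (k + j)) atTop (𝓝 0) :=
    (tendsto_add_atTop_iff_nat j).2 (ENNReal.tendsto_pow_atTop_nhds_zero_of_lt_one (by simp))
  refine tendsto_of_tendsto_of_tendsto_of_le_of_le' tendsto_const_nhds h0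
    (Eventually.of_forall fun _ => zero_le) ?_
  filter_upwards [hω] with k hk
  simp only [not_le] at hk
  exact hk.le

/-! ### Square integrals -/

/-- The squared `L²` norm of a function on the line. -/
noncomputable def sqNorm (f : ℝ → ℝ) : ℝ≥0∞ := ∫⁻ s, ENNReal.ofReal (f s ^ 2)

theorem sqNorm_eq (f : ℝ → ℝ) : sqNorm f = eLpNorm f 2 volume ^ 2 := by
  have h := eLpNorm_nnreal_pow_eq_lintegral (f := f) (μ := volume) (p := 2) two_ne_zero
  simp only [ENNReal.coe_ofNat, NNReal.coe_ofNat, ENNReal.rpow_ofNat] at h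
  rw [h]
  refine lintegral_congr fun s => ?_
  rw [Real.enorm_eq_ofReal_abs, ← ENNReal.ofReal_pow (abs_nonneg _), sq_abs]

theorem sqNorm_add_le {f g : ℝ → ℝ} (hf : Measurable f) :
    sqNorm (fun s => f s + g s) ≤ 2 * sqNorm f + 2 * sqNorm g := by
  unfold sqNorm
  rw [← lintegral_const_mul' _ _ (by simp), ← lintegral_const_mul' _ _ (by simp),
    ← lintegral_add_left (by fun_prop)]
  refine lintegral_mono fun s => ?_
  rw [show (2 : ℝ≥0∞) = ENNReal.ofReal 2 by simp, ← ENNReal.ofReal_mul (by simp),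
    ← ENNReal.ofReal_mul (by simp), ← ENNReal.ofReal_add (by positivity) (by positivity)]
  exact ENNReal.ofReal_le_ofReal (by nlinarith [sq_nonneg (f s - g s)])

theorem sqNorm_mono {f g : ℝ → ℝ} (h : ∀ s, |f s| ≤ |g s|) : sqNorm f ≤ sqNorm g :=
  lintegral_mono fun s => ENNReal.ofReal_le_ofReal (sq_le_sq.2 (h s))

theorem sqNorm_const_mul (r : ℝ) (f : ℝ → ℝ) :
    sqNorm (fun s => r * f s) = ENNReal.ofReal (r ^ 2) * sqNorm f := by
  unfold sqNorm
  rw [← lintegral_const_mul' _ _ (by simp)]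
  refine lintegral_congr fun s => ?_
  rw [mul_pow, ENNReal.ofReal_mul (sq_nonneg _)]

/-- Both bounds come from the triangle inequality for the L² norm; finiteness of the limit norm is
needed to subtract in the extended reals. -/
theorem tendsto_sqNorm {f : ℕ → ℝ → ℝ} {g : ℝ → ℝ} (hf : ∀ n, Measurable (f n))
    (hg : Measurable g) (hg' : sqNorm g ≠ ∞)
    (h : Tendsto (fun n => sqNorm (fun s => f n s - g s)) atTop (𝓝 0)) :
    Tendsto (fun n => sqNorm (f n)) atTop (𝓝 (sqNorm g)) := by
  have hg2 : eLpNorm g 2 volume ≠ ∞ := by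
    rw [sqNorm_eq] at hg'; intro h; simp [h] at hg'
  have hd : Tendsto (fun n => eLpNorm (f n - g) 2 volume) atTop (𝓝 0) := by
    have h2 := (ENNReal.continuous_rpow_const (y := 1 / 2)).continuousAt.tendsto.comp h
    rw [ENNReal.zero_rpow_of_pos (by norm_num)] at h2
    refine h2.congr fun n => ?_
    simp only [Function.comp, sqNorm_eq]
    rw [← ENNReal.rpow_natCast, ← ENNReal.rpow_mul]
    norm_num
    rfl
  have hn : Tendsto (fun n => eLpNorm (f n) 2 volume) atTop (𝓝 (eLpNorm g 2 volume)) := by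
    have hlow : Tendsto (fun n => eLpNorm g 2 volume - eLpNorm (f n - g) 2 volume) atTop
        (𝓝 (eLpNorm g 2 volume - 0)) := ENNReal.Tendsto.sub tendsto_const_nhds hd (Or.inl hg2)
    have hup : Tendsto (fun n => eLpNorm g 2 volume + eLpNorm (f n - g) 2 volume) atTop
        (𝓝 (eLpNorm g 2 volume + 0)) := tendsto_const_nhds.add hd
    rw [tsub_zero] at hlow
    rw [add_zero] at hup
    refine tendsto_of_tendsto_of_tendsto_of_le_of_le hlow hup (fun n => ?_) (fun n => ?_)
    · simp only [tsub_le_iff_right]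
      have e : g = f n - (f n - g) := by simp
      conv_lhs => rw [e]
      exact eLpNorm_sub_le (hf n).aestronglyMeasurable
        ((hf n).sub hg).aestronglyMeasurable (by norm_num)
    · have e : f n = g + (f n - g) := by simp
      conv_lhs => rw [e]
      exact eLpNorm_add_le hg.aestronglyMeasurable
        ((hf n).sub hg).aestronglyMeasurable (by norm_num)
  simp only [sqNorm_eq]
  exact ENNReal.Tendsto.pow hn

end BSS

namespace BSS

/-! ### Properties of the stochastic integral -/

section

variable {Ω : Type*} {mΩ : MeasurableSpace Ω} {μ : Measure Ω} [IsProbabilityMeasure μ]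
  {ℱ : Filtration ℝ mΩ} {W : Set ℝ → Ω → ℝ}

theorem tendsto_measure_ge_of_ae_tendsto_zero {F : ℕ → Ω → ℝ≥0∞} (hF : ∀ n, AEMeasurable (F n) μ)
    (h : ∀ᵐ ω ∂μ, Tendsto (fun n => F n ω) atTop (𝓝 0)) (ε : ℝ≥0∞) (hε : 0 < ε) :
    Tendsto (fun n => μ {ω | ε ≤ F n ω}) atTop (𝓝 0) := by
  have e : ∀ n, μ {ω | ε ≤ F n ω} = μ {ω | ε ≤ (hF n).mk (F n) ω} := fun n =>
    measure_congr (by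
      filter_upwards [(hF n).ae_eq_mk] with ω hω
      exact congrArg (ε ≤ ·) hω)
  simp_rw [e]
  have h0 := tendsto_measure_of_ae_tendsto_indicator_of_isFiniteMeasure (μ := μ) (A := ∅)
    (As := fun n => {ω | ε ≤ (hF n).mk (F n) ω}) atTop MeasurableSet.empty
    (fun n => measurableSet_le measurable_const (hF n).measurable_mk) (by
      filter_upwards [h, ae_all_iff.2 fun n => (hF n).ae_eq_mk] with ω hω hm
      filter_upwards [hω.eventually (Iio_mem_nhds hε)] with n hn
      simp only [mem_empty_iff_false, iff_false]
      rw [← hm n]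
      exact not_le.2 hn)
  simpa using h0

theorem measurable_sqNorm {H : ℝ → Ω → ℝ} (hH : Measurable (Function.uncurry H)) :
    Measurable fun ω => sqNorm fun s => H s ω := by
  have : Measurable fun x : ℝ × Ω => ENNReal.ofReal (H x.1 x.2 ^ 2) :=
    (hH.pow_const 2).ennreal_ofReal
  exact this.lintegral_prod_left'

theorem measurable_section {H : ℝ → Ω → ℝ} (hH : Measurable (Function.uncurry H)) (ω : Ω) :
    Measurable fun s => H s ω := hH.comp measurable_prodMk_right

/-- Almost sure form of the definition of the stochastic integral. -/
theorem isItoIntegral_iff (hW : IsWhiteNoise μ ℱ W) {H : ℝ → Ω → ℝ}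
    (hH : Measurable (Function.uncurry H)) {Y : Ω → ℝ} :
    IsItoIntegral μ ℱ W H Y ↔ ∃ S : ℕ → SimpleIntegrand ℱ, ∀ᵐ ω ∂μ,
      Tendsto (fun k => sqNorm fun s => (S k).eval s ω - H s ω) atTop (𝓝 0) ∧
      Tendsto (fun k => (S k).integral W ω) atTop (𝓝 (Y ω)) := by
  constructor
  · rintro ⟨S, h1, h2⟩
    -- The L² error and the error of the integrals are packed into one family, so that a single
    -- subsequence serves both.
    let F : ℕ → ℕ → Ω → ℝ≥0∞ := fun j n ω =>
      if j = 0 then sqNorm (fun s => (S n).eval s ω - H s ω) else edist ((S n).integral W ω) (Y ω)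
    obtain ⟨φ, -, h⟩ := exists_subseq_ae_tendsto_zero (F := F) (μ := μ) (by
      intro j ε hε
      by_cases hj : j = 0
      · simp only [F, hj, if_true]; exact h1 ε hε
      · simp only [F, hj, if_false]; exact h2 ε hε)
    refine ⟨fun k => S (φ k), ?_⟩
    filter_upwards [h] with ω hω
    have a0 := hω 0
    have a1 := hω 1
    simp only [F, if_true, one_ne_zero, if_false] at a0 a1
    exact ⟨a0, tendsto_iff_edist_tendsto_0.2 a1⟩
  · rintro ⟨S, h⟩
    refine ⟨S, fun ε hε => ?_, ?_⟩
    · refine tendsto_measure_ge_of_ae_tendsto_zero (F := fun k ω =>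
        sqNorm fun s => (S k).eval s ω - H s ω) (fun n => ?_) (h.mono fun ω hω => hω.1) ε hε
      exact (measurable_sqNorm ((S n).measurable_uncurry_eval.sub hH)).aemeasurable
    · exact tendstoInMeasure_of_tendsto_ae
        (fun n => ((S n).measurable_integral hW).aestronglyMeasurable) (h.mono fun ω hω => hω.2)

theorem SimpleIntegrand.isItoIntegral (hW : IsWhiteNoise μ ℱ W) (S : SimpleIntegrand ℱ) :
    IsItoIntegral μ ℱ W S.eval (S.integral W) :=
  (isItoIntegral_iff hW S.measurable_uncurry_eval).2
    ⟨fun _ => S, ae_of_all _ fun ω => ⟨by simp [sqNorm], tendsto_const_nhds⟩⟩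

theorem IsItoIntegral.aemeasurable (hW : IsWhiteNoise μ ℱ W) {H : ℝ → Ω → ℝ} {Y : Ω → ℝ}
    (h : IsItoIntegral μ ℱ W H Y) : AEMeasurable Y μ := by
  obtain ⟨S, -, h⟩ := h
  exact h.aemeasurable fun n => ((S n).measurable_integral hW).aemeasurable

theorem IsItoIntegral.add (hW : IsWhiteNoise μ ℱ W) {H H' : ℝ → Ω → ℝ} {Y Y' : Ω → ℝ}
    (hH : Measurable (Function.uncurry H)) (hH' : Measurable (Function.uncurry H'))
    (h : IsItoIntegral μ ℱ W H Y) (h' : IsItoIntegral μ ℱ W H' Y') :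
    IsItoIntegral μ ℱ W (fun s ω => H s ω + H' s ω) (fun ω => Y ω + Y' ω) := by
  rw [isItoIntegral_iff hW hH] at h
  rw [isItoIntegral_iff hW hH'] at h'
  rw [isItoIntegral_iff hW (H := fun s ω => H s ω + H' s ω) (hH.add hH')]
  obtain ⟨S, h⟩ := h
  obtain ⟨S', h'⟩ := h'
  refine ⟨fun k => (S k).add (S' k), ?_⟩
  filter_upwards [h, h'] with ω hω hω'
  refine ⟨?_, ?_⟩
  · have h0 : Tendsto (fun k => 2 * sqNorm (fun s => (S k).eval s ω - H s ω) +
        2 * sqNorm (fun s => (S' k).eval s ω - H' s ω)) atTop (𝓝 (2 * 0 + 2 * 0)) :=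
      (ENNReal.Tendsto.const_mul hω.1 (by simp)).add (ENNReal.Tendsto.const_mul hω'.1 (by simp))
    simp only [mul_zero, add_zero] at h0
    refine tendsto_of_tendsto_of_tendsto_of_le_of_le tendsto_const_nhds h0
      (fun _ => zero_le) fun k => ?_
    have := sqNorm_add_le (f := fun s => (S k).eval s ω - H s ω)
      (g := fun s => (S' k).eval s ω - H' s ω)
      (((S k).measurable_eval ω).sub (measurable_section hH ω))
    refine le_trans (le_of_eq ?_) this
    congr 1; ext s; rw [SimpleIntegrand.add_eval]; ring
  · simp_rw [SimpleIntegrand.add_integral]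
    exact hω.2.add hω'.2

theorem IsItoIntegral.const_mul (hW : IsWhiteNoise μ ℱ W) {H : ℝ → Ω → ℝ} {Y : Ω → ℝ}
    (hH : Measurable (Function.uncurry H)) (h : IsItoIntegral μ ℱ W H Y) (r : ℝ) :
    IsItoIntegral μ ℱ W (fun s ω => r * H s ω) (fun ω => r * Y ω) := by
  rw [isItoIntegral_iff hW hH] at h
  rw [isItoIntegral_iff hW (H := fun s ω => r * H s ω) (hH.const_mul r)]
  obtain ⟨S, h⟩ := h
  refine ⟨fun k => (S k).constMul r, ?_⟩
  filter_upwards [h] with ω hω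
  refine ⟨?_, ?_⟩
  · have h0 := ENNReal.Tendsto.const_mul (a := ENNReal.ofReal (r ^ 2)) hω.1 (by simp)
    rw [mul_zero] at h0
    refine h0.congr fun k => ?_
    rw [← sqNorm_const_mul]
    congr 1; ext s; rw [SimpleIntegrand.constMul_eval]; ring
  · simp_rw [SimpleIntegrand.constMul_integral]
    exact hω.2.const_mul r

/-! ### Exponential and moment bounds for stochastic integrals -/

theorem SimpleIntegrand.lintegral_exp (hW : IsWhiteNoise μ ℱ W) (S : SimpleIntegrand ℱ) (l : ℝ) :
    ∫⁻ ω, ENNReal.ofReal (Real.exp (l * S.integral W ω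
      - l ^ 2 / 2 * (sqNorm fun s => S.eval s ω).toReal)) ∂μ = 1 := by
  obtain ⟨D, hD, hI⟩ := S.exists_grid hW
  rw [← D.lintegral_exp hW l D.M]
  refine lintegral_congr_ae ?_
  filter_upwards [hI] with ω hω
  have he : (sqNorm fun s => S.eval s ω).toReal = D.energy ω := by
    simp_rw [← hD, sqNorm, D.lintegral_eval_sq]
    exact ENNReal.toReal_ofReal (D.energy_nonneg ω)
  rw [he, ← hω]
  rfl

/-- Sub-Gaussian bound for the stochastic integral where its quadratic variation is bounded. -/
theorem IsItoIntegral.lintegral_exp_le (hW : IsWhiteNoise μ ℱ W) {H : ℝ → Ω → ℝ} {Y : Ω → ℝ}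
    (hH : Measurable (Function.uncurry H)) (h : IsItoIntegral μ ℱ W H Y) {c : ℝ}
    (hc : 0 ≤ c) {A : Set Ω} (hA : MeasurableSet A)
    (hAc : ∀ ω ∈ A, (sqNorm fun s => H s ω) ≤ ENNReal.ofReal c) (l : ℝ) :
    ∫⁻ ω in A, ENNReal.ofReal (Real.exp (l * Y ω)) ∂μ ≤
      ENNReal.ofReal (Real.exp (l ^ 2 / 2 * c)) := by
  rw [isItoIntegral_iff hW hH] at h
  obtain ⟨S, h⟩ := h
  -- These exponential densities have expectation one. Fatou's lemma passes to the limit, and on `A`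
  -- removing the compensator costs at most the factor `exp(l² c / 2)`.
  let f : ℕ → Ω → ℝ≥0∞ := fun k ω => ENNReal.ofReal (Real.exp (l * (S k).integral W ω
      - l ^ 2 / 2 * (sqNorm fun s => (S k).eval s ω).toReal))
  have hf : ∀ k, Measurable (f k) := fun k =>
    (Real.measurable_exp.comp (((S k).measurable_integral hW).const_mul l |>.sub
      ((measurable_sqNorm (S k).measurable_uncurry_eval).ennreal_toReal.const_mul _))).ennreal_ofReal
  have hlim : ∀ᵐ ω ∂μ, ω ∈ A → ENNReal.ofReal (Real.exp (l * Y ω)) ≤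
      ENNReal.ofReal (Real.exp (l ^ 2 / 2 * c)) * liminf (fun k => f k ω) atTop := by
    filter_upwards [h] with ω hω hωA
    have hfin : (sqNorm fun s => H s ω) ≠ ∞ := ne_top_of_le_ne_top (by simp) (hAc ω hωA)
    have hq := tendsto_sqNorm (fun k => (S k).measurable_eval ω) (measurable_section hH ω) hfin hω.1
    have hq' := (ENNReal.tendsto_toReal hfin).comp hq
    have h1 : Tendsto (fun k => f k ω) atTop (𝓝 (ENNReal.ofReal (Real.exp (l * Y ω
        - l ^ 2 / 2 * (sqNorm fun s => H s ω).toReal)))) :=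
      ENNReal.tendsto_ofReal ((Real.continuous_exp.tendsto _).comp
        ((hω.2.const_mul l).sub (hq'.const_mul _)))
    rw [h1.liminf_eq, ← ENNReal.ofReal_mul (Real.exp_nonneg _), ← Real.exp_add]
    refine ENNReal.ofReal_le_ofReal (Real.exp_le_exp.2 ?_)
    have := ENNReal.toReal_le_of_le_ofReal hc (hAc ω hωA)
    nlinarith [sq_nonneg l]
  calc ∫⁻ ω in A, ENNReal.ofReal (Real.exp (l * Y ω)) ∂μ
      ≤ ∫⁻ ω in A, ENNReal.ofReal (Real.exp (l ^ 2 / 2 * c)) *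
          liminf (fun k => f k ω) atTop ∂μ := lintegral_mono_ae ((ae_restrict_iff' hA).2 hlim)
    _ ≤ ∫⁻ ω, ENNReal.ofReal (Real.exp (l ^ 2 / 2 * c)) *
          liminf (fun k => f k ω) atTop ∂μ := setLIntegral_le_lintegral _ _
    _ = ENNReal.ofReal (Real.exp (l ^ 2 / 2 * c)) * ∫⁻ ω, liminf (fun k => f k ω) atTop ∂μ :=
        lintegral_const_mul' _ _ (by simp)
    _ ≤ ENNReal.ofReal (Real.exp (l ^ 2 / 2 * c)) * liminf (fun k => ∫⁻ ω, f k ω ∂μ) atTop := by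
        gcongr; exact lintegral_liminf_le hf
    _ = _ := by
        have : (fun k => ∫⁻ ω, f k ω ∂μ) = fun _ => 1 := funext fun k => (S k).lintegral_exp hW l
        rw [this]; simp

/-- The constant in the moment bound for stochastic integrals. -/
noncomputable def momentConst (q : ℝ) : ℝ := (1 + (⌈q⌉₊.factorial : ℝ)) * (2 * Real.exp (1 / 2))

theorem momentConst_pos (q : ℝ) : 0 < momentConst q := by unfold momentConst; positivity

theorem rpow_le_exp {q x : ℝ} (hq : 0 ≤ q) (hx : 0 ≤ x) :
    x ^ q ≤ (1 + (⌈q⌉₊.factorial : ℝ)) * Real.exp x := by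
  have h1 : (1 : ℝ) ≤ Real.exp x := Real.one_le_exp hx
  have hf : (0 : ℝ) < (⌈q⌉₊.factorial : ℝ) := by positivity
  rcases le_total x 1 with h | h
  · have := Real.rpow_le_one hx h hq
    nlinarith
  · have h2 : x ^ q ≤ x ^ (⌈q⌉₊ : ℝ) := Real.rpow_le_rpow_of_exponent_le h (Nat.le_ceil q)
    rw [Real.rpow_natCast] at h2
    have h3 := Real.pow_div_factorial_le_exp x hx ⌈q⌉₊
    rw [div_le_iff₀ hf] at h3
    nlinarith

/-- A power of `|Y|/√c` is dominated by its exponential, hence by the sum of the exponentials of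
`±Y/√c`. The scale `l = 1/√c` makes the sub-Gaussian bound the constant `exp(1/2)` and leaves the
factor `c^(q/2)`. -/
theorem IsItoIntegral.lintegral_rpow_le (hW : IsWhiteNoise μ ℱ W) {H : ℝ → Ω → ℝ} {Y : Ω → ℝ}
    (hH : Measurable (Function.uncurry H)) (h : IsItoIntegral μ ℱ W H Y) {c q : ℝ}
    (hc : 0 < c) (hq : 0 ≤ q) {A : Set Ω} (hA : MeasurableSet A)
    (hAc : ∀ ω ∈ A, (sqNorm fun s => H s ω) ≤ ENNReal.ofReal c) :
    ∫⁻ ω in A, ENNReal.ofReal (|Y ω| ^ q) ∂μ ≤ ENNReal.ofReal (momentConst q * c ^ (q / 2)) := by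
  set l : ℝ := (√c)⁻¹ with hl
  have hs : 0 < √c := Real.sqrt_pos.2 hc
  have hl2 : l ^ 2 / 2 * c = 1 / 2 := by
    rw [hl, inv_pow, Real.sq_sqrt hc.le]; field_simp
  set K : ℝ := 1 + (⌈q⌉₊.factorial : ℝ) with hK
  have hK0 : 0 ≤ K := by positivity
  have hcq : c ^ (q / 2) = √c ^ q := by
    rw [Real.sqrt_eq_rpow, ← Real.rpow_mul hc.le]; congr 1; ring
  have hpt : ∀ ω, ENNReal.ofReal (|Y ω| ^ q) ≤ ENNReal.ofReal (c ^ (q / 2) * K) *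
      (ENNReal.ofReal (Real.exp (l * Y ω)) + ENNReal.ofReal (Real.exp (-l * Y ω))) := by
    intro ω
    rw [← ENNReal.ofReal_add (Real.exp_nonneg _) (Real.exp_nonneg _),
      ← ENNReal.ofReal_mul (by positivity)]
    refine ENNReal.ofReal_le_ofReal ?_
    have e : |Y ω| = √c * (l * |Y ω|) := by rw [hl]; field_simp
    have hl0 : 0 ≤ l * |Y ω| := by positivity
    rw [e, Real.mul_rpow hs.le hl0, hcq, mul_assoc]
    refine mul_le_mul_of_nonneg_left ?_ (by positivity)
    refine (rpow_le_exp hq hl0).trans (mul_le_mul_of_nonneg_left ?_ hK0)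
    rcases abs_cases (Y ω) with ⟨h1, _⟩ | ⟨h1, _⟩ <;> rw [h1]
    · linarith [Real.exp_nonneg (-l * Y ω)]
    · have : l * -Y ω = -l * Y ω := by ring
      rw [this]; linarith [Real.exp_nonneg (l * Y ω)]
  have hYm := h.aemeasurable hW
  have h1 := h.lintegral_exp_le hW hH hc.le hA hAc l
  have h2 := h.lintegral_exp_le hW hH hc.le hA hAc (-l)
  rw [neg_sq] at h2
  rw [hl2] at h1 h2
  calc ∫⁻ ω in A, ENNReal.ofReal (|Y ω| ^ q) ∂μ
      ≤ ∫⁻ ω in A, ENNReal.ofReal (c ^ (q / 2) * K) *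
      (ENNReal.ofReal (Real.exp (l * Y ω)) + ENNReal.ofReal (Real.exp (-l * Y ω))) ∂μ :=
        lintegral_mono hpt
    _ = ENNReal.ofReal (c ^ (q / 2) * K) * (∫⁻ ω in A, ENNReal.ofReal (Real.exp (l * Y ω)) ∂μ +
        ∫⁻ ω in A, ENNReal.ofReal (Real.exp (-l * Y ω)) ∂μ) := by
        rw [lintegral_const_mul' _ _ (by simp), lintegral_add_left']
        exact (Real.measurable_exp.comp_aemeasurable (hYm.const_mul l)).ennreal_ofReal.restrict
    _ ≤ ENNReal.ofReal (c ^ (q / 2) * K) *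
        (ENNReal.ofReal (Real.exp (1 / 2)) + ENNReal.ofReal (Real.exp (1 / 2))) := by gcongr
    _ = _ := by
        rw [← ENNReal.ofReal_add (Real.exp_nonneg _) (Real.exp_nonneg _),
          ← ENNReal.ofReal_mul (by positivity)]
        congr 1; unfold momentConst; ring

/-- Chebyshev's inequality for the stochastic integral. -/
theorem IsItoIntegral.measure_ge_le (hW : IsWhiteNoise μ ℱ W) {H : ℝ → Ω → ℝ} {Y : Ω → ℝ}
    (hH : Measurable (Function.uncurry H)) (h : IsItoIntegral μ ℱ W H Y) {c x : ℝ}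
    (hc : 0 < c) (hx : 0 < x) :
    μ {ω | x ≤ |Y ω|} ≤ μ {ω | ENNReal.ofReal c ≤ sqNorm fun s => H s ω} +
      ENNReal.ofReal (momentConst 2 * c / x ^ 2) := by
  set A : Set Ω := {ω | sqNorm (fun s => H s ω) ≤ ENNReal.ofReal c} with hA
  have hAm : MeasurableSet A := measurableSet_le (measurable_sqNorm hH) measurable_const
  have hsub : {ω | x ≤ |Y ω|} ⊆ {ω | ENNReal.ofReal c ≤ sqNorm fun s => H s ω} ∪
      ({ω | ENNReal.ofReal (x ^ 2) ≤ ENNReal.ofReal (|Y ω| ^ (2 : ℝ))} ∩ A) := by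
    intro ω hω
    rcases le_total (ENNReal.ofReal c) (sqNorm fun s => H s ω) with h1 | h1
    · exact Or.inl h1
    · refine Or.inr ⟨?_, h1⟩
      refine ENNReal.ofReal_le_ofReal ?_
      rw [Real.rpow_ofNat]
      exact pow_le_pow_left₀ hx.le hω 2
  refine (measure_mono hsub).trans ((measure_union_le _ _).trans ?_)
  gcongr
  have h2 := h.lintegral_rpow_le hW hH hc zero_le_two hAm fun ω hω => hω
  have hYm : AEMeasurable (fun ω => ENNReal.ofReal (|Y ω| ^ (2 : ℝ))) (μ.restrict A) := by
    have := h.aemeasurable hW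
    have := (this.abs.pow_const (2 : ℝ)).ennreal_ofReal.restrict (s := A)
    exact this
  have hx2 : 0 < x ^ 2 := by positivity
  have h3 := meas_ge_le_lintegral_div hYm (ε := ENNReal.ofReal (x ^ 2))
    (by simpa using hx.ne') (by simp)
  rw [Measure.restrict_apply' hAm] at h3
  refine h3.trans ((ENNReal.div_le_div_right h2 _).trans ?_)
  rw [← ENNReal.ofReal_div_of_pos hx2]
  norm_num

/-- Integrals of simple integrands that converge in `L²(ds)` converge along a subsequence. -/
theorem exists_isItoIntegral (hW : IsWhiteNoise μ ℱ W) {H : ℝ → Ω → ℝ}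
    (hH : Measurable (Function.uncurry H)) {S : ℕ → SimpleIntegrand ℱ}
    (hS : ∀ᵐ ω ∂μ, Tendsto (fun k => sqNorm fun s => (S k).eval s ω - H s ω) atTop (𝓝 0)) :
    ∃ (φ : ℕ → ℕ) (Y : Ω → ℝ), StrictMono φ ∧ Measurable Y ∧
      (∀ᵐ ω ∂μ, Tendsto (fun k => (S (φ k)).integral W ω) atTop (𝓝 (Y ω))) ∧
      IsItoIntegral μ ℱ W H Y := by
  have hE := tendsto_measure_ge_of_ae_tendsto_zero (F := fun k ω =>
      sqNorm fun s => (S k).eval s ω - H s ω)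
    (fun n => (measurable_sqNorm ((S n).measurable_uncurry_eval.sub hH)).aemeasurable) hS
  -- The difference of two simple integrands is simple, so Chebyshev's bound applies to it. The
  -- level `c / 4` comes from `‖x + y‖² ≤ 2‖x‖² + 2‖y‖²`.
  have hdiff : ∀ (m n : ℕ) (c x : ℝ), 0 < c → 0 < x →
      μ {ω | x ≤ |(S m).integral W ω - (S n).integral W ω|} ≤
        μ {ω | ENNReal.ofReal (c / 4) ≤ sqNorm fun s => (S m).eval s ω - H s ω} +
        μ {ω | ENNReal.ofReal (c / 4) ≤ sqNorm fun s => (S n).eval s ω - H s ω} +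
        ENNReal.ofReal (momentConst 2 * c / x ^ 2) := by
    intro m n c x hc hx
    have h1 := ((S m).add ((S n).constMul (-1))).isItoIntegral hW
    have h2 := h1.measure_ge_le hW (SimpleIntegrand.measurable_uncurry_eval _) hc hx
    simp only [SimpleIntegrand.add_integral, SimpleIntegrand.constMul_integral, neg_mul, one_mul,
      ← sub_eq_add_neg, SimpleIntegrand.add_eval, SimpleIntegrand.constMul_eval] at h2
    refine h2.trans ?_
    gcongr
    refine (measure_mono ?_).trans (measure_union_le _ _)
    intro ω hω
    by_contra hcon
    simp only [mem_union, not_or] at hcon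
    obtain ⟨a1, a2⟩ := hcon
    have a1' : (sqNorm fun s => (S m).eval s ω - H s ω) < ENNReal.ofReal (c / 4) := not_le.1 a1
    have a2' : (sqNorm fun s => (S n).eval s ω - H s ω) < ENNReal.ofReal (c / 4) := not_le.1 a2
    have h3 := sqNorm_add_le (f := fun s => (S m).eval s ω - H s ω)
      (g := fun s => (-1) * ((S n).eval s ω - H s ω))
      (((S m).measurable_eval ω).sub (measurable_section hH ω))
    rw [sqNorm_const_mul] at h3
    have e : (fun s => (S m).eval s ω - H s ω + -1 * ((S n).eval s ω - H s ω)) =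
      fun s => (S m).eval s ω - (S n).eval s ω := by ext s; ring
    rw [e] at h3
    simp only [even_two, Even.neg_pow, one_pow, ENNReal.ofReal_one, one_mul] at h3
    have h4 : (2 : ℝ≥0∞) * sqNorm (fun s => (S m).eval s ω - H s ω) +
        2 * sqNorm (fun s => (S n).eval s ω - H s ω) < ENNReal.ofReal c := by
      have e2 : ENNReal.ofReal c = 2 * ENNReal.ofReal (c / 4) + 2 * ENNReal.ofReal (c / 4) := by
        rw [show (2 : ℝ≥0∞) = ENNReal.ofReal 2 by simp, ← ENNReal.ofReal_mul (by simp),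
          ← ENNReal.ofReal_add (by positivity) (by positivity)]
        congr 1; ring
      rw [e2]
      exact ENNReal.add_lt_add ((ENNReal.mul_lt_mul_iff_right (by simp) (by simp)).2 a1')
        ((ENNReal.mul_lt_mul_iff_right (by simp) (by simp)).2 a2')
    exact absurd (lt_of_le_of_lt (le_trans hω h3) h4) (lt_irrefl _)
  have hev : ∀ k : ℕ, ∀ᶠ n in atTop, ∀ m ≥ n,
      μ {ω | (1 / 2 : ℝ) ^ k ≤ |(S m).integral W ω - (S n).integral W ω|} ≤
        ENNReal.ofReal (3 * (1 / 2) ^ k) := by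
    intro k
    set x : ℝ := (1 / 2) ^ k with hx
    have hx0 : 0 < x := by positivity
    have hM := momentConst_pos 2
    -- Chosen so that the Chebyshev term equals `x`; with the two L² terms this gives the summable
    -- bound `3 x = 3 · 2⁻ᵏ`.
    set c : ℝ := x ^ 3 / momentConst 2 with hc
    have hc0 : 0 < c := by positivity
    have hcx : momentConst 2 * c / x ^ 2 = x := by rw [hc]; field_simp
    have h1 := (hE (ENNReal.ofReal (c / 4)) (by simpa using hc0)).eventually
      (Iic_mem_nhds (show (0 : ℝ≥0∞) < ENNReal.ofReal x by simpa using hx0))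
    obtain ⟨N, hN⟩ := eventually_atTop.1 h1
    filter_upwards [eventually_ge_atTop N] with n hn m hm
    refine (hdiff m n c x hc0 hx0).trans ?_
    rw [hcx, show 3 * x = x + x + x by ring, ENNReal.ofReal_add (by positivity) (by positivity),
      ENNReal.ofReal_add (by positivity) (by positivity)]
    gcongr
    · exact hN m (hn.trans hm)
    · exact hN n hn
  obtain ⟨φ, hφ, hP⟩ := extraction_forall_of_eventually hev
  have hsum : ∑' k, μ {ω | (1 / 2 : ℝ) ^ k ≤
      |(S (φ (k + 1))).integral W ω - (S (φ k)).integral W ω|} ≠ ∞ := by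
    refine ne_top_of_le_ne_top ?_ (ENNReal.tsum_le_tsum fun k =>
      hP k (φ (k + 1)) (hφ.monotone (Nat.le_succ k)))
    rw [← ENNReal.ofReal_tsum_of_nonneg (fun _ => by positivity)]
    · simp
    · exact (summable_geometric_of_lt_one (by norm_num) (by norm_num)).mul_left 3
  have hcauchy : ∀ᵐ ω ∂μ, ∃ y, Tendsto (fun k => (S (φ k)).integral W ω) atTop (𝓝 y) := by
    filter_upwards [ae_eventually_notMem hsum] with ω hω
    obtain ⟨N, hN⟩ := eventually_atTop.1 hω
    have hc : CauchySeq fun k => (S (φ (k + N))).integral W ω := by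
      refine cauchySeq_of_le_geometric (1 / 2) ((1 / 2) ^ N) (by norm_num) fun k => ?_
      have h1 : ¬ ((1 / 2 : ℝ) ^ (k + N) ≤
        |(S (φ (k + N + 1))).integral W ω - (S (φ (k + N))).integral W ω|) := hN (k + N) (by omega)
      rw [dist_comm, Real.dist_eq, ← pow_add, add_comm N k]
      have e : k + 1 + N = k + N + 1 := by ring
      rw [e]
      exact (not_le.1 h1).le
    obtain ⟨y, hy⟩ := cauchySeq_tendsto_of_complete hc
    exact ⟨y, (tendsto_add_atTop_iff_nat N).1 hy⟩
  obtain ⟨Y, hYm, hY⟩ := measurable_limit_of_tendsto_metrizable_ae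
    (fun k => ((S (φ k)).measurable_integral hW).aemeasurable) hcauchy
  refine ⟨φ, Y, hφ, hYm, hY, (isItoIntegral_iff hW hH).2 ⟨fun k => S (φ k), ?_⟩⟩
  filter_upwards [hS, hY] with ω h1 h2
  exact ⟨h1.comp hφ.tendsto_atTop, h2⟩

/-! ### Restriction to half-lines, and integrals of deterministic functions -/

theorem measurable_uncurry_indicator_Ioi {H : ℝ → Ω → ℝ} (hH : Measurable (Function.uncurry H))
    (a : ℝ) : Measurable (Function.uncurry fun s ω => (Ioi a).indicator (fun s => H s ω) s) := by
  have : (Function.uncurry fun s ω => (Ioi a).indicator (fun s => H s ω) s) =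
      (Prod.fst ⁻¹' Ioi a).indicator (Function.uncurry H) := by
    ext x; simp [indicator, Function.uncurry]
  rw [this]
  exact hH.indicator (measurable_fst measurableSet_Ioi)

theorem sqNorm_indicator_le (A : Set ℝ) (f : ℝ → ℝ) : sqNorm (A.indicator f) ≤ sqNorm f :=
  sqNorm_mono fun s => by by_cases h : s ∈ A <;> simp [h]

/-- A stochastic integral can be restricted to `(a, ∞)`, and then multiplied by any
`ℱ a`-measurable random variable. -/
theorem IsItoIntegral.exists_restrict_Ioi (hW : IsWhiteNoise μ ℱ W) {H : ℝ → Ω → ℝ} {Y : Ω → ℝ}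
    (hH : Measurable (Function.uncurry H)) (h : IsItoIntegral μ ℱ W H Y) (a : ℝ) :
    ∃ Z : Ω → ℝ, Measurable Z ∧
      IsItoIntegral μ ℱ W (fun s ω => (Ioi a).indicator (fun s => H s ω) s) Z ∧
      ∀ ξ : Ω → ℝ, Measurable[ℱ a] ξ →
        IsItoIntegral μ ℱ W (fun s ω => ξ ω * (Ioi a).indicator (fun s => H s ω) s)
          (fun ω => ξ ω * Z ω) := by
  rw [isItoIntegral_iff hW hH] at h
  obtain ⟨S, h⟩ := h
  let S' : ℕ → SimpleIntegrand ℱ := fun k =>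
    (S k).mulIoi a (fun _ => 1) measurable_const ⟨1, by simp⟩
  have hHa := measurable_uncurry_indicator_Ioi hH a
  have e' : ∀ k s ω, (S' k).eval s ω - (Ioi a).indicator (fun s => H s ω) s =
      (Ioi a).indicator (fun s => (S k).eval s ω - H s ω) s := by
    intro k s ω
    simp only [S', SimpleIntegrand.mulIoi_eval]
    by_cases hs : s ∈ Ioi a <;> simp [hs]
  have hS' : ∀ᵐ ω ∂μ, Tendsto (fun k => sqNorm fun s => (S' k).eval s ω -
      (Ioi a).indicator (fun s => H s ω) s) atTop (𝓝 0) := by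
    filter_upwards [h] with ω hω
    refine tendsto_of_tendsto_of_tendsto_of_le_of_le tendsto_const_nhds hω.1
      (fun _ => zero_le) fun k => ?_
    simp_rw [e']
    exact sqNorm_indicator_le _ _
  obtain ⟨φ, Z, hφ, hZm, hZ, hIto⟩ := exists_isItoIntegral hW hHa hS'
  refine ⟨Z, hZm, hIto, fun ξ hξ => ?_⟩
  -- Simple integrands need bounded coefficients. Truncating `ξ` at level `k` at stage `k` suffices,
  -- since for each `ω` the truncation is eventually inactive.
  let ξ' : ℕ → Ω → ℝ := fun k ω => max (-(k : ℝ)) (min (ξ ω) k)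
  have hξ' : ∀ k, Measurable[ℱ a] (ξ' k) := fun k =>
    measurable_const.max (hξ.min measurable_const)
  have hb : ∀ k, ∃ C, ∀ ω, |ξ' k ω| ≤ C := fun k => ⟨k, fun ω => by
    have hk : (0 : ℝ) ≤ k := Nat.cast_nonneg k
    rw [abs_le]
    exact ⟨le_max_left _ _, max_le (by linarith) (min_le_right _ _)⟩⟩
  have hmeas : Measurable (Function.uncurry fun s ω =>
      ξ ω * (Ioi a).indicator (fun s => H s ω) s) :=
    ((hξ.mono (ℱ.le a) le_rfl).comp measurable_snd).mul hHa
  rw [isItoIntegral_iff hW hmeas]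
  refine ⟨fun k => (S (φ k)).mulIoi a (ξ' k) (hξ' k) (hb k), ?_⟩
  filter_upwards [hS', hZ] with ω h1 h2
  have hev : ∀ᶠ k : ℕ in atTop, ξ' k ω = ξ ω := by
    obtain ⟨N, hN⟩ := exists_nat_ge |ξ ω|
    filter_upwards [eventually_ge_atTop N] with k hk
    have hk' : |ξ ω| ≤ k := hN.trans (by exact_mod_cast hk)
    rw [abs_le] at hk'
    simp only [ξ']
    rw [min_eq_left hk'.2, max_eq_right hk'.1]
  constructor
  · have h3 := ENNReal.Tendsto.const_mul (a := ENNReal.ofReal (ξ ω ^ 2))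
      (h1.comp hφ.tendsto_atTop) (by simp)
    rw [mul_zero] at h3
    refine h3.congr' ?_
    filter_upwards [hev] with k hk
    simp only [Function.comp]
    rw [← sqNorm_const_mul]
    congr 1; ext s
    simp only [S', SimpleIntegrand.mulIoi_eval, hk]
    ring
  · refine (h2.const_mul (ξ ω)).congr' ?_
    filter_upwards [hev] with k hk
    simp only [S']
    rw [SimpleIntegrand.mulIoi_integral _ a (ξ' k), hk]

/-- The stochastic integral of a deterministic function is Gaussian. -/
theorem IsItoIntegral.map_eq_gaussianReal (hW : IsWhiteNoise μ ℱ W) {f : ℝ → ℝ} {Y : Ω → ℝ}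
    (hf : Measurable f) (h : IsItoIntegral μ ℱ W (fun s _ => f s) Y) (hfin : sqNorm f ≠ ∞) :
    μ.map Y = gaussianReal 0 (sqNorm f).toNNReal := by
  have hYm := h.aemeasurable hW
  rw [isItoIntegral_iff hW (H := fun s _ => f s) (hf.comp measurable_fst)] at h
  obtain ⟨S, h⟩ := h
  choose D hD hDI using fun k => (S k).exists_grid hW
  set V : ℝ := (sqNorm f).toReal with hV
  have hV0 : 0 ≤ V := ENNReal.toReal_nonneg
  have : IsProbabilityMeasure (μ.map Y) := Measure.isProbabilityMeasure_map hYm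
  refine Measure.ext_of_charFun (funext fun θ => ?_)
  rw [charFun_gaussianReal, charFun_apply_real, integral_map hYm (by fun_prop)]
  -- Capping the energy at `V + 1` bounds the complex exponential martingales uniformly, as
  -- dominated convergence requires. The energies tend to the deterministic `V`, so almost surely
  -- the cap is eventually inactive.
  let T : ℕ → GridIntegrand ℱ := fun k => (D k).truncate (V + 1)
  have hTE : ∀ k ω, (T k).energy ω ≤ V + 1 := fun k ω =>
    ((D k).truncate_partialEnergy_le (by linarith) _ ω).trans (min_le_left _ _)
  let F : ℕ → Ω → ℂ := fun k ω => Complex.exp ((θ * (T k).integral W ω : ℝ) * Complex.I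
      + (θ ^ 2 / 2 * (T k).energy ω : ℝ))
  have hFm : ∀ k, Measurable (F k) := by
    intro k
    refine Complex.measurable_exp.comp (Measurable.add ?_ ?_)
    · exact (Complex.measurable_ofReal.comp ((((T k).measurable_partialIntegral hW le_rfl).mono
        (ℱ.le _) le_rfl).const_mul θ)).mul_const _
    · exact Complex.measurable_ofReal.comp ((((T k).measurable_partialEnergy
        (Nat.le_succ _)).mono (ℱ.le _) le_rfl).const_mul _)
  have hlim : ∀ᵐ ω ∂μ, Tendsto (fun k => F k ω) atTop
      (𝓝 (Complex.exp ((θ * Y ω : ℝ) * Complex.I + (θ ^ 2 / 2 * V : ℝ)))) := by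
    filter_upwards [h, ae_all_iff.2 hDI] with ω hω hI
    have hq := tendsto_sqNorm (fun k => (S k).measurable_eval ω) hf hfin hω.1
    have hq' : Tendsto (fun k => (D k).energy ω) atTop (𝓝 V) := by
      refine ((ENNReal.tendsto_toReal hfin).comp hq).congr fun k => ?_
      simp only [Function.comp]
      simp_rw [← hD, sqNorm, (D k).lintegral_eval_sq]
      exact ENNReal.toReal_ofReal ((D k).energy_nonneg ω)
    have hev : ∀ᶠ k in atTop, (D k).energy ω ≤ V + 1 :=
      hq'.eventually (Iic_mem_nhds (by linarith))
    have hE : Tendsto (fun k => (T k).energy ω) atTop (𝓝 V) := by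
      refine hq'.congr' ?_
      filter_upwards [hev] with k hk
      exact ((D k).truncate_eq (W := W) hk).1.symm
    have hT : Tendsto (fun k => (T k).integral W ω) atTop (𝓝 (Y ω)) := by
      refine hω.2.congr' ?_
      filter_upwards [hev] with k hk
      rw [← hI k]
      exact ((D k).truncate_eq (W := W) hk).2.symm
    refine (Complex.continuous_exp.tendsto _).comp (Tendsto.add ?_ ?_)
    · exact ((Complex.continuous_ofReal.tendsto _).comp (hT.const_mul θ)).mul_const _
    · exact (Complex.continuous_ofReal.tendsto _).comp (hE.const_mul _)
  have hDCT := tendsto_integral_of_dominated_convergence (μ := μ) (F := F)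
    (fun _ => Real.exp (θ ^ 2 / 2 * (V + 1))) (fun k => (hFm k).aestronglyMeasurable)
    (integrable_const _) (fun k => ae_of_all _ fun ω => by
      simp only [F]
      rw [Complex.norm_exp]
      simp only [Complex.add_re, Complex.mul_re, Complex.ofReal_re, Complex.I_re, mul_zero,
        Complex.ofReal_im, Complex.I_im, sub_zero, zero_add, mul_one]
      exact Real.exp_le_exp.2 (mul_le_mul_of_nonneg_left (hTE k ω) (by positivity))) hlim
  have hone : ∀ k, ∫ ω, F k ω ∂μ = 1 := fun k => (T k).integral_cexp hW θ (T k).M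
  simp_rw [hone] at hDCT
  have h1 := tendsto_nhds_unique hDCT tendsto_const_nhds
  have e : ∀ ω, Complex.exp ((θ * Y ω : ℝ) * Complex.I + (θ ^ 2 / 2 * V : ℝ)) =
      Complex.exp (θ * Y ω * Complex.I) * Complex.exp ((θ ^ 2 / 2 * V : ℝ)) := by
    intro ω; rw [← Complex.exp_add]; push_cast; rfl
  simp_rw [e] at h1
  rw [integral_mul_const] at h1
  have hexp := Complex.exp_ne_zero ((θ ^ 2 / 2 * V : ℝ) : ℂ)
  have h2 : ∫ ω, Complex.exp (θ * Y ω * Complex.I) ∂μ =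
      (Complex.exp ((θ ^ 2 / 2 * V : ℝ)))⁻¹ := eq_inv_of_mul_eq_one_left h1
  rw [h2, ← Complex.exp_neg]
  congr 1
  have hVn : (((sqNorm f).toNNReal : ℝ) : ℂ) = (V : ℂ) := rfl
  rw [hVn]
  push_cast; ring

/-- Stochastic integrals of deterministic functions with disjoint supports are independent. -/
theorem IsItoIntegral.indepFun (hW : IsWhiteNoise μ ℱ W) {f f' : ℝ → ℝ} {Y Y' : Ω → ℝ}
    (hf : Measurable f) (hf' : Measurable f') (h : IsItoIntegral μ ℱ W (fun s _ => f s) Y)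
    (h' : IsItoIntegral μ ℱ W (fun s _ => f' s) Y') (hfin : sqNorm f ≠ ∞) (hfin' : sqNorm f' ≠ ∞)
    (hdisj : ∀ s, f s * f' s = 0) : IndepFun Y Y' μ := by
  have hYm := h.aemeasurable hW
  have hYm' := h'.aemeasurable hW
  rw [indepFun_iff_charFun_prod hYm hYm']
  intro t
  set a := t.ofLp.1
  set b := t.ofLp.2
  have hm : ∀ {f : ℝ → ℝ}, Measurable f → Measurable (Function.uncurry fun s (_ : Ω) => f s) :=
    fun hf => hf.comp measurable_fst
  -- The joint characteristic function at `(a, b)` is that of `aY + bY'` at one. This combination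
  -- integrates a deterministic function, hence is Gaussian, and disjoint supports make its variance
  -- split.
  have hsum := (h.const_mul hW (hm hf) a).add hW (hm (hf.const_mul a)) (hm (hf'.const_mul b))
    (h'.const_mul hW (hm hf') b)
  have hsq : sqNorm (fun s => a * f s + b * f' s) =
      ENNReal.ofReal (a ^ 2) * sqNorm f + ENNReal.ofReal (b ^ 2) * sqNorm f' := by
    rw [← sqNorm_const_mul, ← sqNorm_const_mul]
    unfold sqNorm
    rw [← lintegral_add_left (by fun_prop)]
    refine lintegral_congr fun s => ?_
    rw [← ENNReal.ofReal_add (sq_nonneg _) (sq_nonneg _)]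
    congr 1
    linear_combination (2 * a * b) * hdisj s
  have hfs : sqNorm (fun s => a * f s + b * f' s) ≠ ∞ := by
    rw [hsq]; finiteness
  have hg := hsum.map_eq_gaussianReal hW (f := fun s => a * f s + b * f' s) ((hf.const_mul a).add (hf'.const_mul b)) hfs
  have h1 : charFun (μ.map fun ω => WithLp.toLp 2 (Y ω, Y' ω)) t =
      charFun (μ.map fun ω => a * Y ω + b * Y' ω) 1 := by
    rw [charFun_apply, charFun_apply_real, integral_map (by fun_prop) (by fun_prop),
      integral_map (by fun_prop) (by fun_prop)]
    refine integral_congr_ae (ae_of_all _ fun ω => ?_)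
    simp only [WithLp.prod_inner_apply]
    congr 1
    simp [a, b]
  rw [h1, hg, h.map_eq_gaussianReal hW hf hfin, h'.map_eq_gaussianReal hW hf' hfin',
    charFun_gaussianReal, charFun_gaussianReal, charFun_gaussianReal, ← Complex.exp_add]
  congr 1
  have hr : ((sqNorm fun s => a * f s + b * f' s).toNNReal : ℝ) =
      a ^ 2 * (sqNorm f).toNNReal + b ^ 2 * (sqNorm f').toNNReal := by
    change (sqNorm fun s => a * f s + b * f' s).toReal =
      a ^ 2 * (sqNorm f).toReal + b ^ 2 * (sqNorm f').toReal
    rw [hsq, ENNReal.toReal_add (by finiteness) (by finiteness), ENNReal.toReal_mul,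
      ENNReal.toReal_mul, ENNReal.toReal_ofReal (sq_nonneg _), ENNReal.toReal_ofReal (sq_nonneg _)]
  rw [show (((sqNorm fun s => a * f s + b * f' s).toNNReal : ℝ) : ℂ) = _ from
    congrArg Complex.ofReal hr]
  push_cast; ring

end

end BSS

namespace BSS

/-! ### The kernel of second order increments -/

/-- The weight function extended by zero to the half-line `(-∞, 0]`. -/
noncomputable def weight (g : ℝ → ℝ) : ℝ → ℝ := (Ioi 0).indicator g

/-- The kernel of the second order difference with step `d`. -/
noncomputable def kern (g : ℝ → ℝ) (d u : ℝ) : ℝ :=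
  weight g u - 2 * weight g (u - d) + weight g (u - 2 * d)

theorem weight_of_pos {g : ℝ → ℝ} {x : ℝ} (hx : 0 < x) : weight g x = g x :=
  indicator_of_mem (mem_Ioi.2 hx) _

theorem measurable_weight {g : ℝ → ℝ} (hg : ContinuousOn g (Ioi 0)) : Measurable (weight g) := by
  classical
  have := (hg.measurable_piecewise (g := (0 : ℝ → ℝ)) continuousOn_const measurableSet_Ioi)
  rwa [piecewise_eq_indicator] at this

theorem measurable_kern {g : ℝ → ℝ} (hg : ContinuousOn g (Ioi 0)) (d : ℝ) :
    Measurable (kern g d) := by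
  have h := measurable_weight hg
  exact (h.sub ((h.comp (measurable_id.sub_const d)).const_mul 2)).add
    (h.comp (measurable_id.sub_const (2 * d)))

theorem sqNorm_sub_left (f : ℝ → ℝ) (t : ℝ) : sqNorm (fun s => f (t - s)) = sqNorm f :=
  lintegral_sub_left_eq_self (fun s => ENNReal.ofReal (f s ^ 2)) t

theorem sqNorm_sub_right (f : ℝ → ℝ) (t : ℝ) : sqNorm (fun s => f (s - t)) = sqNorm f :=
  lintegral_sub_right_eq_self (fun s => ENNReal.ofReal (f s ^ 2)) t

theorem sqNorm_weight_ne_top {g : ℝ → ℝ} (hg : MemLp g 2 (volume.restrict (Ioi 0))) :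
    sqNorm (weight g) ≠ ∞ := by
  rw [sqNorm_eq, weight, eLpNorm_indicator_eq_eLpNorm_restrict measurableSet_Ioi]
  exact ENNReal.pow_ne_top hg.eLpNorm_ne_top

theorem sqNorm_ne_top_add {f g : ℝ → ℝ} (hf : Measurable f) (hf' : sqNorm f ≠ ∞)
    (hg' : sqNorm g ≠ ∞) : sqNorm (fun s => f s + g s) ≠ ∞ :=
  ne_top_of_le_ne_top (by finiteness) (sqNorm_add_le hf)

theorem sqNorm_ne_top_const_mul {f : ℝ → ℝ} (hf' : sqNorm f ≠ ∞) (r : ℝ) :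
    sqNorm (fun s => r * f s) ≠ ∞ := by
  rw [sqNorm_const_mul]; finiteness

/-- The squared `L²` norm of the first order difference of the weight function. -/
noncomputable def diffSq (g : ℝ → ℝ) (d : ℝ) : ℝ≥0∞ := sqNorm fun u => weight g u - weight g (u - d)

section

variable {g : ℝ → ℝ} (hgc : ContinuousOn g (Ioi 0)) (hg2 : MemLp g 2 (volume.restrict (Ioi 0)))
include hgc hg2

theorem diffSq_ne_top (d : ℝ) : diffSq g d ≠ ∞ := by
  have h := sqNorm_ne_top_add (f := weight g) (g := fun u => (-1) * weight g (u - d))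
    (measurable_weight hgc) (sqNorm_weight_ne_top hg2)
    (sqNorm_ne_top_const_mul (by rw [sqNorm_sub_right]; exact sqNorm_weight_ne_top hg2) (-1))
  have e : diffSq g d = sqNorm fun s => weight g s + -1 * weight g (s - d) := by
    unfold diffSq; congr 1; ext s; ring
  rwa [e]

/-- With `A` the first difference of step `d`, the kernel is `A - A(· - d)` and the first difference
of step `2d` is `A + A(· - d)`. The parallelogram law and translation invariance expressing τ²
through the variogram follow; the sum form avoids subtraction of extended reals. -/
theorem kern_parallelogram (d : ℝ) :
    sqNorm (kern g d) + diffSq g (2 * d) = 4 * diffSq g d := by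
  have hm := measurable_weight hgc
  let A : ℝ → ℝ := fun u => weight g u - weight g (u - d)
  have hA : Measurable A := hm.sub (hm.comp (measurable_id.sub_const d))
  have hA' : sqNorm (fun u => A (u - d)) = sqNorm A := sqNorm_sub_right A d
  have e1 : kern g d = fun u => A u - A (u - d) := by
    ext u; simp only [kern, A]; ring_nf
  have e2 : diffSq g (2 * d) = sqNorm fun u => A u + A (u - d) := by
    unfold diffSq; congr 1; ext u; simp only [A]; ring_nf
  rw [e1, e2]
  have e3 : diffSq g d = sqNorm A := rfl
  have e4 : 4 * sqNorm A = 2 * sqNorm A + 2 * sqNorm (fun u => A (u - d)) := by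
    rw [hA']; ring
  rw [e3, e4]
  have hAd : Measurable fun u => A (u - d) := hA.comp (measurable_id.sub_const d)
  unfold sqNorm
  rw [← lintegral_const_mul' _ _ (by simp), ← lintegral_const_mul' _ _ (by simp),
    ← lintegral_add_left (by fun_prop), ← lintegral_add_left (by fun_prop)]
  refine lintegral_congr fun u => ?_
  rw [show (2 : ℝ≥0∞) = ENNReal.ofReal 2 by simp, ← ENNReal.ofReal_mul (by simp),
    ← ENNReal.ofReal_mul (by simp), ← ENNReal.ofReal_add (by positivity) (by positivity),
    ← ENNReal.ofReal_add (by positivity) (by positivity)]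
  congr 1; ring

theorem sqNorm_kern_ne_top (d : ℝ) : sqNorm (kern g d) ≠ ∞ := by
  have h := kern_parallelogram hgc hg2 d
  have h2 : 4 * diffSq g d ≠ ∞ := ENNReal.mul_ne_top (by simp) (diffSq_ne_top hgc hg2 d)
  exact ne_top_of_le_ne_top h2 (h ▸ le_self_add)

theorem sqNorm_kern_toReal (d : ℝ) : (sqNorm (kern g d)).toReal =
    4 * (diffSq g d).toReal - (diffSq g (2 * d)).toReal := by
  have h := congrArg ENNReal.toReal (kern_parallelogram hgc hg2 d)
  rw [ENNReal.toReal_add (sqNorm_kern_ne_top hgc hg2 d) (diffSq_ne_top hgc hg2 _),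
    ENNReal.toReal_mul] at h
  simp only [ENNReal.toReal_ofNat] at h
  linarith

end

section

variable {Ω : Type*} {mΩ : MeasurableSpace Ω} {μ : Measure Ω} [IsProbabilityMeasure μ]
  {ℱ : Filtration ℝ mΩ} {W : Set ℝ → Ω → ℝ}

/-- Extension by zero puts the integrals at all times on the whole line, so increments can be formed
by linearity. -/
theorem indicator_Iio_eq_weight (g : ℝ → ℝ) (f : ℝ → ℝ) (t s : ℝ) :
    (Iio t).indicator (fun u => g (t - u) * f u) s = weight g (t - s) * f s := by
  by_cases h : s < t
  · rw [indicator_of_mem (mem_Iio.2 h), weight_of_pos (sub_pos.2 h)]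
  · rw [indicator_of_notMem (by simpa using h), weight, indicator_of_notMem (by simpa using h),
      zero_mul]

theorem IsBSS.isItoIntegral {g : ℝ → ℝ} {σ X : ℝ → Ω → ℝ} (hX : IsBSS μ ℱ W g σ X) (t : ℝ) :
    IsItoIntegral μ ℱ W (fun s ω => weight g (t - s) * σ s ω) (X t) := by
  have h := hX t
  have e : (fun s ω => (Iio t).indicator (fun u => g (t - u) * σ u ω) s) =
      fun s ω => weight g (t - s) * σ s ω := by
    ext s ω; exact indicator_Iio_eq_weight g (fun u => σ u ω) t s
  rwa [e] at h

theorem measurable_weight_mul {f : ℝ → ℝ} (hf : Measurable f) {σ : ℝ → Ω → ℝ}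
    (hσ : Measurable (Function.uncurry σ)) (t : ℝ) :
    Measurable (Function.uncurry fun s ω => f (t - s) * σ s ω) :=
  (hf.comp (measurable_fst.const_sub t)).mul hσ

theorem measurable_uncurry_add {H H' : ℝ → Ω → ℝ} (hH : Measurable (Function.uncurry H))
    (hH' : Measurable (Function.uncurry H')) :
    Measurable (Function.uncurry fun s ω => H s ω + H' s ω) := hH.add hH'

theorem measurable_uncurry_const_mul {H : ℝ → Ω → ℝ} (hH : Measurable (Function.uncurry H))
    (r : ℝ) : Measurable (Function.uncurry fun s ω => r * H s ω) := hH.const_mul r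

theorem IsBSS.isItoIntegral_increment (hW : IsWhiteNoise μ ℱ W) {g : ℝ → ℝ} {σ X : ℝ → Ω → ℝ}
    (hX : IsBSS μ ℱ W g σ X) (hgc : ContinuousOn g (Ioi 0)) (hσ : Measurable (Function.uncurry σ))
    (v : ℕ) (δ : ℝ) (i : ℕ) :
    IsItoIntegral μ ℱ W (fun s ω => kern g (v * δ) (i * δ - s) * σ s ω)
      (increment X 2 v δ i) := by
  have hm := fun t => measurable_weight_mul (measurable_weight hgc) hσ t
  have h0 := hX.isItoIntegral (i * δ)
  have h1 := (hX.isItoIntegral ((i - v) * δ)).const_mul hW (hm _) (-2)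
  have h2 := hX.isItoIntegral ((i - v * 2) * δ)
  have h := (h0.add hW (hm _) (measurable_uncurry_const_mul (hm _) (-2)) h1).add hW
    (measurable_uncurry_add (hm _) (measurable_uncurry_const_mul (hm _) (-2))) (hm _) h2
  convert! h using 1
  · ext s ω
    simp only [kern]
    rw [show (i : ℝ) * δ - s - v * δ = (i - v) * δ - s by ring,
      show (i : ℝ) * δ - s - 2 * (v * δ) = (i - v * 2) * δ - s by ring]
    ring
  · ext ω
    simp [increment, Finset.sum_range_succ]

/-- The isometry for deterministic integrands is read off from the variance of their Gaussian law.
-/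
theorem IsGaussianCore.variogram_eq (hW : IsWhiteNoise μ ℱ W) {g : ℝ → ℝ} {G : ℝ → Ω → ℝ}
    (hG : IsGaussianCore μ ℱ W g G) (hgc : ContinuousOn g (Ioi 0))
    (hg2 : MemLp g 2 (volume.restrict (Ioi 0))) (t : ℝ) :
    variogram μ G t = (diffSq g t).toReal := by
  have hm := measurable_weight hgc
  have hone : Measurable (Function.uncurry fun (_ : ℝ) (_ : Ω) => (1 : ℝ)) := measurable_const
  have hmm := fun t => measurable_weight_mul (Ω := Ω) hm hone t
  have h := (IsBSS.isItoIntegral hG t).add hW (hmm t) (measurable_uncurry_const_mul (hmm 0) (-1))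
    ((IsBSS.isItoIntegral hG 0).const_mul hW (hmm 0) (-1))
  let f : ℝ → ℝ := fun u => weight g u - weight g (u - t)
  have hf : Measurable f := hm.sub (hm.comp (measurable_id.sub_const t))
  have e : (fun s (_ : Ω) => weight g (t - s) * 1 + -1 * (weight g (0 - s) * 1)) =
      fun s _ => f (t - s) := by
    ext s ω; simp only [f]; ring_nf
  rw [e] at h
  have hs : sqNorm (fun s => f (t - s)) = diffSq g t := sqNorm_sub_left f t
  have hfin := diffSq_ne_top hgc hg2 t
  have hlaw := h.map_eq_gaussianReal hW (f := fun s => f (t - s))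
    (hf.comp (measurable_id.const_sub t)) (hs ▸ hfin)
  have hY := h.aemeasurable hW
  rw [hs] at hlaw
  have hv := variance_id_gaussianReal (μ := 0) (v := (diffSq g t).toNNReal)
  rw [← hlaw, variance_of_integral_eq_zero aemeasurable_id (by
    rw [hlaw]; simp),
    integral_map hY (by fun_prop)] at hv
  unfold variogram
  rw [show (diffSq g t).toReal = ((diffSq g t).toNNReal : ℝ) from rfl, ← hv]
  refine integral_congr_ae (ae_of_all _ fun ω => ?_)
  simp only [id]; ring

end

/-! ### Bounds for the kernel away from zero -/

section

variable {g : ℝ → ℝ} (hg : ContDiffOn ℝ 2 g (Ioi 0))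
include hg

theorem hasDerivAt_of_contDiffOn {x : ℝ} (hx : 0 < x) :
    HasDerivAt g (deriv g x) x ∧ HasDerivAt (deriv g) (iteratedDeriv 2 g x) x := by
  have hat : ContDiffAt ℝ 2 g x := hg.contDiffAt (Ioi_mem_nhds hx)
  refine ⟨(hat.differentiableAt (by norm_num)).hasDerivAt, ?_⟩
  rw [iteratedDeriv_succ, iteratedDeriv_one]
  have h1 : ContDiffAt ℝ 1 (deriv g) x := by
    have h3 : ContDiffOn ℝ 1 (deriv g) (Ioi 0) :=
      hg.deriv_of_isOpen isOpen_Ioi (by norm_num)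
    exact h3.contDiffAt (Ioi_mem_nhds hx)
  exact (h1.differentiableAt (by norm_num)).hasDerivAt

theorem continuousOn_iteratedDeriv_two : ContinuousOn (iteratedDeriv 2 g) (Ioi 0) := by
  rw [iteratedDeriv_succ, iteratedDeriv_one]
  have h3 : ContDiffOn ℝ 1 (deriv g) (Ioi 0) := hg.deriv_of_isOpen isOpen_Ioi (by norm_num)
  exact (h3.deriv_of_isOpen (m := 0) isOpen_Ioi (by norm_num)).continuousOn

/-- Two applications of the mean value theorem; `2d < u` keeps all evaluation points in the
half-line where `g` is smooth. -/
theorem exists_kern_eq {d u : ℝ} (hd : 0 < d) (hu : 2 * d < u) :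
    ∃ x ∈ Ioo (u - 2 * d) u, kern g d u = d ^ 2 * iteratedDeriv 2 g x := by
  let F : ℝ → ℝ := fun x => g x - g (x - d)
  have hF : ∀ x, d < x → HasDerivAt F (deriv g x - deriv g (x - d)) x := by
    intro x hx
    have h1 := (hasDerivAt_of_contDiffOn hg (by linarith : 0 < x)).1
    have h2 := (hasDerivAt_of_contDiffOn hg (by linarith : 0 < x - d)).1.comp_sub_const x d
    exact h1.sub h2
  obtain ⟨y, hy, hy'⟩ := exists_hasDerivAt_eq_slope F (fun x => deriv g x - deriv g (x - d))
    (a := u - d) (b := u) (by linarith)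
    (fun x hx => (hF x (by linarith [hx.1])).continuousAt.continuousWithinAt)
    (fun x hx => hF x (by linarith [hx.1]))
  obtain ⟨z, hz, hz'⟩ := exists_hasDerivAt_eq_slope (deriv g) (iteratedDeriv 2 g)
    (a := y - d) (b := y) (by linarith)
    (fun x hx => (hasDerivAt_of_contDiffOn hg
      (by linarith [hx.1, hy.1] : 0 < x)).2.continuousAt.continuousWithinAt)
    (fun x hx => (hasDerivAt_of_contDiffOn hg (by linarith [hx.1, hy.1] : 0 < x)).2)
  refine ⟨z, ⟨by linarith [hz.1, hy.1], by linarith [hz.2, hy.2]⟩, ?_⟩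
  have e1 : u - (u - d) = d := by ring
  have e2 : y - (y - d) = d := by ring
  simp only [F] at hy'
  rw [e1, eq_div_iff hd.ne'] at hy'
  rw [e2, eq_div_iff hd.ne'] at hz'
  unfold kern
  rw [weight_of_pos (by linarith), weight_of_pos (by linarith), weight_of_pos (by linarith)]
  rw [show u - d - d = u - 2 * d by ring] at hy'
  linear_combination -hy' - d * hz'

theorem abs_kern_le_of_antitone {a d u : ℝ} (ha : 0 < a)
    (hanti : AntitoneOn (fun x => |iteratedDeriv 2 g x|) (Ioi a)) (hd : 0 < d) {y : ℝ} (hy : a < y)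
    (hyu : y ≤ u - 2 * d) : |kern g d u| ≤ d ^ 2 * |iteratedDeriv 2 g y| := by
  obtain ⟨x, hx, h⟩ := exists_kern_eq hg hd (u := u) (by linarith)
  rw [h, abs_mul, abs_of_nonneg (sq_nonneg d)]
  exact mul_le_mul_of_nonneg_left (hanti hy (mem_Ioi.2 (by linarith [hx.1])) (by linarith [hx.1]))
    (sq_nonneg d)

/-- The unit-step kernel equals `g''` at an earlier point, where `|g''|` is larger. Thus
integrability of `σ²` against squares of `g` in the remote past controls `σ²` against `(g'')²`
there. -/
theorem abs_iteratedDeriv_le_kern {a u : ℝ} (ha : 0 < a)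
    (hanti : AntitoneOn (fun x => |iteratedDeriv 2 g x|) (Ioi a)) (hu : a + 2 < u) :
    |iteratedDeriv 2 g u| ≤ |kern g 1 u| := by
  obtain ⟨x, hx, h⟩ := exists_kern_eq hg one_pos (u := u) (by linarith)
  rw [h, one_pow, one_mul]
  exact hanti (mem_Ioi.2 (by linarith [hx.1])) (mem_Ioi.2 (by linarith)) hx.2.le

/-- Far from zero the kernel of step `d` is dominated by the kernel of step one. -/
theorem abs_kern_le_kern_one {a d t s : ℝ} (ha : 0 < a)
    (hanti : AntitoneOn (fun x => |iteratedDeriv 2 g x|) (Ioi a)) (hd : 0 < d) (ht : 2 * d ≤ t)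
    (hs : s < -(a + 2)) : |kern g d (t - s)| ≤ d ^ 2 * |kern g 1 (0 - s)| := by
  refine (abs_kern_le_of_antitone hg ha hanti hd (y := 0 - s) (by linarith) (by linarith)).trans ?_
  exact mul_le_mul_of_nonneg_left (abs_iteratedDeriv_le_kern hg ha hanti (by linarith))
    (sq_nonneg d)

/-- On `(ε, ∞)` the kernel is at most `d²` times one fixed L² function: a constant up to `a + 2`, by
compactness, and `|g''(u - 1)|` beyond, by monotonicity. -/
theorem exists_sqNorm_tail_le {a : ℝ} (ha : 0 < a)
    (hanti : AntitoneOn (fun x => |iteratedDeriv 2 g x|) (Ioi a))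
    (hL : ∀ ε : ℝ, 0 < ε → MemLp (iteratedDeriv 2 g) 2 (volume.restrict (Ioi ε)))
    {ε : ℝ} (hε : 0 < ε) : ∃ C : ℝ, ∃ d₀ > 0, ∀ d, 0 < d → d < d₀ →
      sqNorm ((Ioi ε).indicator (kern g d)) ≤ ENNReal.ofReal (d ^ 4 * C) := by
  obtain ⟨M, hM⟩ := (isCompact_Icc (a := ε / 2) (b := a + 2)).exists_bound_of_continuousOn
    ((continuousOn_iteratedDeriv_two hg).mono fun x hx => mem_Ioi.2 (by linarith [hx.1]))
  let B₁ : ℝ → ℝ := (Ioc ε (a + 2)).indicator fun _ => |M|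
  let B₂ : ℝ → ℝ := (Ioi (a + 1)).indicator (iteratedDeriv 2 g)
  have hB₁m : Measurable B₁ := measurable_const.indicator measurableSet_Ioc
  have hB₁ : sqNorm B₁ ≠ ∞ := by
    have e : sqNorm B₁ = ∫⁻ s in Ioc ε (a + 2), ENNReal.ofReal (|M| ^ 2) := by
      rw [← lintegral_indicator measurableSet_Ioc]
      refine lintegral_congr fun s => ?_
      by_cases h : s ∈ Ioc ε (a + 2) <;> simp [B₁, h]
    rw [e, setLIntegral_const]
    exact ENNReal.mul_ne_top (by simp) (by simp)
  have hB₂ : sqNorm (fun u => B₂ (u - 1)) ≠ ∞ := by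
    rw [sqNorm_sub_right, sqNorm_eq, eLpNorm_indicator_eq_eLpNorm_restrict measurableSet_Ioi]
    exact ENNReal.pow_ne_top (hL _ (by linarith)).eLpNorm_ne_top
  have hB := sqNorm_ne_top_add (g := fun u => |B₂ (u - 1)|) hB₁m hB₁ (by
    have : sqNorm (fun u => |B₂ (u - 1)|) = sqNorm (fun u => B₂ (u - 1)) := by
      unfold sqNorm; simp_rw [sq_abs]
    rwa [this])
  set B : ℝ → ℝ := fun u => B₁ u + |B₂ (u - 1)|
  have hB0 : ∀ u, 0 ≤ B₁ u := fun u => indicator_nonneg (fun _ _ => abs_nonneg _) u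
  -- `d < ε/4` keeps the mean value point above `ε/2`; `d < 1/2` keeps `u - 1` to the left of `u -
  -- 2d`.
  refine ⟨(sqNorm B).toReal, min (ε / 4) (1 / 2), by positivity, fun d hd hd' => ?_⟩
  have hd1 : d < ε / 4 := hd'.trans_le (min_le_left _ _)
  have hd2 : d < 1 / 2 := hd'.trans_le (min_le_right _ _)
  rw [ENNReal.ofReal_mul (by positivity), ENNReal.ofReal_toReal hB,
    show d ^ 4 = (d ^ 2) ^ 2 by ring, ← sqNorm_const_mul]
  refine sqNorm_mono fun u => ?_
  rw [abs_mul, abs_of_nonneg (sq_nonneg d)]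
  by_cases h : ε < u
  · rw [indicator_of_mem (mem_Ioi.2 h)]
    by_cases h2 : u ≤ a + 2
    · obtain ⟨x, hx, hk⟩ := exists_kern_eq hg hd (u := u) (by linarith)
      have hMx := hM x ⟨by linarith [hx.1], by linarith [hx.2]⟩
      have hBu : |M| ≤ |B u| := by
        have : B₁ u = |M| := indicator_of_mem (show u ∈ Ioc ε (a + 2) from ⟨h, h2⟩) _
        refine le_trans ?_ (le_abs_self _)
        simp only [B, this]
        linarith [abs_nonneg (B₂ (u - 1))]
      rw [hk, abs_mul, abs_of_nonneg (sq_nonneg d)]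
      refine mul_le_mul_of_nonneg_left ?_ (sq_nonneg d)
      exact (hMx.trans (le_abs_self M)).trans hBu
    · have h3 := abs_kern_le_of_antitone hg ha hanti hd (u := u) (y := u - 1) (by linarith)
        (by linarith)
      refine h3.trans (mul_le_mul_of_nonneg_left ?_ (sq_nonneg d))
      have : B₂ (u - 1) = iteratedDeriv 2 g (u - 1) :=
        indicator_of_mem (mem_Ioi.2 (by linarith)) _
      refine le_trans ?_ (le_abs_self _)
      simp only [B, this]
      linarith [hB0 u]
  · rw [indicator_of_notMem (by simpa using h), abs_zero]
    positivity

end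

/-! ### Small-scale asymptotics of the variogram -/

theorem tendsto_ratio_of_isSlowlyVarying {L R : ℝ → ℝ} (hL : IsSlowlyVarying L) {β : ℝ}
    (hR : ∀ x, 0 < x → R x = x ^ β * L x) :
    Tendsto (fun x => R (2 * x) / R x) (𝓝[>] 0) (𝓝 (2 ^ β)) := by
  have h := (hL.tendsto 2 two_pos).const_mul ((2 : ℝ) ^ β)
  rw [mul_one] at h
  refine h.congr' ?_
  filter_upwards [self_mem_nhdsWithin] with x hx
  have hx' : 0 < x := hx
  rw [hR _ (by positivity), hR x hx', Real.mul_rpow two_pos.le hx'.le]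
  have : x ^ β ≠ 0 := (Real.rpow_pos_of_pos hx' β).ne'
  field_simp

/-- For `t = 1` the ratio `L x / L x` tends to one, whereas at a zero of `L` division by zero makes
it zero. -/
theorem eventually_ne_zero_of_isSlowlyVarying {L : ℝ → ℝ} (hL : IsSlowlyVarying L) :
    ∀ᶠ x in 𝓝[>] 0, L x ≠ 0 := by
  filter_upwards [(hL.tendsto 1 one_pos).eventually (lt_mem_nhds one_half_lt_one)] with x hx h0
  rw [h0] at hx; norm_num at hx

/-- A positive function whose dyadic growth is at most quadratic is at least quadratic at zero. -/
theorem exists_quadratic_lower_bound {R : ℝ → ℝ} (hc : ContinuousOn R (Ioi 0))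
    (hpos : ∀ᶠ x in 𝓝[>] 0, 0 < R x) (hgrow : ∀ᶠ x in 𝓝[>] 0, R (2 * x) ≤ 4 * R x) :
    ∃ c > 0, ∀ᶠ x in 𝓝[>] 0, c * x ^ 2 ≤ R x := by
  obtain ⟨x₀, hx₀, h⟩ := mem_nhdsGT_iff_exists_Ioc_subset.1 (hpos.and hgrow)
  have hx₀' : 0 < x₀ := hx₀
  obtain ⟨y, hy, hmin⟩ := (isCompact_Icc (a := x₀ / 2) (b := x₀)).exists_isMinOn
    ⟨x₀, by constructor <;> linarith⟩ (hc.mono fun x hx => mem_Ioi.2 (by linarith [hx.1]))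
  have hm : 0 < R y := (h ⟨by linarith [hy.1], hy.2⟩).1
  refine ⟨R y / x₀ ^ 2, by positivity, ?_⟩
  -- Induction over dyadic shells: the base shell uses the minimum of `R`, and halving `x` divides
  -- `x²` by 4 while it divides `R` by at most 4.
  have key : ∀ j : ℕ, ∀ x, x₀ / 2 ^ (j + 1) ≤ x → x ≤ x₀ / 2 ^ j → R y / x₀ ^ 2 * x ^ 2 ≤ R x := by
    intro j
    induction j with
    | zero =>
      intro x h1 h2
      norm_num at h1 h2
      have hx0 : 0 < x := by linarith
      have h3 : R y ≤ R x := hmin ⟨h1, h2⟩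
      have h4 : x ^ 2 / x₀ ^ 2 ≤ 1 := by
        rw [div_le_one (by positivity)]; exact pow_le_pow_left₀ hx0.le h2 2
      calc R y / x₀ ^ 2 * x ^ 2 = R y * (x ^ 2 / x₀ ^ 2) := by ring
        _ ≤ R y * 1 := by gcongr
        _ ≤ R x := by linarith
    | succ j ih =>
      intro x h1 h2
      have hx0 : 0 < x := lt_of_lt_of_le (by positivity) h1
      have h3 := ih (2 * x) (by
        have : x₀ / 2 ^ (j + 1) = 2 * (x₀ / 2 ^ (j + 1 + 1)) := by field_simp; ring
        linarith) (by
        have : x₀ / 2 ^ j = 2 * (x₀ / 2 ^ (j + 1)) := by field_simp; ring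
        linarith)
      have hx1 : x ≤ x₀ := h2.trans (div_le_self hx₀'.le (one_le_pow₀ (by norm_num)))
      have h4 := (h ⟨hx0, hx1⟩).2
      nlinarith
  filter_upwards [Ioc_mem_nhdsGT hx₀'] with x hx
  obtain ⟨j, hj1, hj2⟩ := exists_nat_pow_near (x := x₀ / x) (y := 2)
    ((one_le_div hx.1).2 hx.2) (by norm_num)
  refine key j x ?_ ?_
  · rw [div_le_iff₀ (by positivity)]
    rw [div_lt_iff₀ hx.1] at hj2; linarith
  · rw [le_div_iff₀ (by positivity)]
    rw [le_div_iff₀ hx.1] at hj1; linarith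

/-- Small-scale behaviour of `τ²(d) = 4 R(d) - R(2 d)`. -/
theorem tauSq_asymptotics {L R T : ℝ → ℝ} (hL : IsSlowlyVarying L) {α : ℝ} (hα : α < 1 / 2)
    (hR : ∀ x, 0 < x → R x = x ^ (2 * α + 1) * L x) (hR0 : ∀ x, 0 ≤ R x)
    (hT : ∀ d, T d = 4 * R d - R (2 * d)) :
    (∀ᶠ d in 𝓝[>] 0, 0 < T d) ∧ Tendsto (fun d => d ^ 4 / T d) (𝓝[>] 0) (𝓝 0) ∧
      Tendsto (fun d => T (2 * d) / T d) (𝓝[>] 0) (𝓝 (2 ^ (2 * α + 1))) := by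
  have hratio := tendsto_ratio_of_isSlowlyVarying hL hR
  set β := 2 * α + 1 with hβ
  set r : ℝ := 2 ^ β with hr
  -- Here `α < 1/2` enters: it makes τ² comparable to `R`, and makes the dyadic growth of `R` less
  -- than quadratic.
  have hr4 : r < 4 := by
    have : (4 : ℝ) = 2 ^ (2 : ℝ) := by norm_num
    rw [this]; exact Real.rpow_lt_rpow_of_exponent_lt (by norm_num) (by linarith)
  have hpos : ∀ᶠ x in 𝓝[>] 0, 0 < R x := by
    filter_upwards [eventually_ne_zero_of_isSlowlyVarying hL, self_mem_nhdsWithin] with x h1 h2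
    refine lt_of_le_of_ne (hR0 x) ?_
    rw [hR x h2]
    exact (mul_ne_zero (Real.rpow_pos_of_pos h2 _).ne' h1).symm
  have hgrow : ∀ᶠ x in 𝓝[>] 0, R (2 * x) ≤ 4 * R x := by
    filter_upwards [hpos, hratio.eventually (gt_mem_nhds hr4)] with x h1 h2
    rw [div_lt_iff₀ h1] at h2; exact h2.le
  have hcont : ContinuousOn R (Ioi 0) := by
    refine ContinuousOn.congr (f := fun x => x ^ β * L x) ?_ fun x hx => hR x hx
    exact (continuousOn_id.rpow_const fun x hx => Or.inl (ne_of_gt hx)).mul hL.continuousOn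
  obtain ⟨c, hc, hlow⟩ := exists_quadratic_lower_bound hcont hpos hgrow
  have hTR : Tendsto (fun d => T d / R d) (𝓝[>] 0) (𝓝 (4 - r)) := by
    refine (tendsto_const_nhds.sub hratio).congr' ?_
    filter_upwards [hpos] with d hd
    rw [hT]; field_simp
  have h2 : Tendsto (fun d : ℝ => 2 * d) (𝓝[>] 0) (𝓝[>] 0) := by
    refine tendsto_nhdsWithin_iff.2 ⟨?_, ?_⟩
    · have : Tendsto (fun d : ℝ => 2 * d) (𝓝 0) (𝓝 (2 * 0)) := (continuous_const_mul 2).tendsto 0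
      rw [mul_zero] at this
      exact this.mono_left nhdsWithin_le_nhds
    · filter_upwards [self_mem_nhdsWithin] with d hd
      exact mem_Ioi.2 (mul_pos two_pos (mem_Ioi.1 hd))
  have hr0 : 0 < 4 - r := by linarith
  have hTlow : ∀ᶠ d in 𝓝[>] 0, (4 - r) / 2 * R d ≤ T d := by
    filter_upwards [hpos, hTR.eventually (lt_mem_nhds (half_lt_self hr0))] with d h1 h3
    rw [lt_div_iff₀ h1] at h3; exact h3.le
  have hTpos : ∀ᶠ d in 𝓝[>] 0, 0 < T d := by
    filter_upwards [hpos, hTlow] with d h1 h3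
    exact lt_of_lt_of_le (by positivity) h3
  refine ⟨hTpos, ?_, ?_⟩
  · have hz : Tendsto (fun d : ℝ => d ^ 2 * (2 / ((4 - r) * c))) (𝓝[>] 0) (𝓝 0) := by
      have : Tendsto (fun d : ℝ => d ^ 2 * (2 / ((4 - r) * c))) (𝓝 0)
        (𝓝 (0 ^ 2 * (2 / ((4 - r) * c)))) := Continuous.tendsto (by fun_prop) 0
      simp only [ne_eq, OfNat.ofNat_ne_zero, not_false_eq_true, zero_pow, zero_mul] at this
      exact this.mono_left nhdsWithin_le_nhds
    refine tendsto_of_tendsto_of_tendsto_of_le_of_le' tendsto_const_nhds hz ?_ ?_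
    · filter_upwards [hTpos] with d hd
      positivity
    · filter_upwards [hTpos, hTlow, hlow, self_mem_nhdsWithin] with d h1 h3 h4 h5
      have h5' : 0 < d := h5
      rw [div_le_iff₀ h1]
      have h6 : (4 - r) / 2 * (c * d ^ 2) ≤ T d :=
        (mul_le_mul_of_nonneg_left h4 (by linarith)).trans h3
      have h7 : d ^ 4 = d ^ 2 * (2 / ((4 - r) * c)) * ((4 - r) / 2 * (c * d ^ 2)) := by
        field_simp
      rw [h7]
      exact mul_le_mul_of_nonneg_left h6 (by positivity)
  -- `T(2d)/T(d)` is the product of `T(2d)/R(2d)`, `R(2d)/R(d)` and `R(d)/T(d)`; the outer two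
  -- limits are inverse to each other.
  · have h3 := ((hTR.comp h2).mul hratio).mul (hTR.inv₀ hr0.ne')
    rw [mul_comm (4 - r) r, mul_assoc, mul_inv_cancel₀ hr0.ne', mul_one] at h3
    refine h3.congr' ?_
    filter_upwards [hpos, hTpos, h2.eventually hpos] with d h4 h5 h6
    simp only [Function.comp]
    field_simp

end BSS

namespace BSS

/-! ### Càdlàg functions -/

/-- A right-continuous function with left limits. -/
def IsCadlagFun (f : ℝ → ℝ) : Prop :=
  ∀ t, ContinuousWithinAt f (Ici t) t ∧ ∃ l : ℝ, Tendsto f (𝓝[<] t) (𝓝 l)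

namespace IsCadlagFun

theorem comp_continuous {f h : ℝ → ℝ} (hf : IsCadlagFun f) (hh : Continuous h) :
    IsCadlagFun fun t => h (f t) := fun t =>
  ⟨hh.continuousAt.comp_continuousWithinAt (hf t).1, by
    obtain ⟨l, hl⟩ := (hf t).2
    exact ⟨h l, (hh.tendsto l).comp hl⟩⟩

theorem exists_oscillation_lt {f : ℝ → ℝ} (hf : IsCadlagFun f) (t : ℝ) {η : ℝ} (hη : 0 < η) :
    ∃ ρ > 0, (∀ x ∈ Ioo (t - ρ) t, ∀ y ∈ Ioo (t - ρ) t, |f x - f y| < η) ∧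
      ∀ x ∈ Ico t (t + ρ), ∀ y ∈ Ico t (t + ρ), |f x - f y| < η := by
  obtain ⟨l, hl⟩ := (hf t).2
  have h1 : ∀ᶠ x in 𝓝[<] t, |f x - l| < η / 2 := by
    have := (Metric.tendsto_nhds.1 hl) (η / 2) (by positivity)
    simpa [Real.dist_eq] using this
  have h2 : ∀ᶠ x in 𝓝[≥] t, |f x - f t| < η / 2 := by
    have := (Metric.tendsto_nhds.1 (hf t).1) (η / 2) (by positivity)
    simpa [Real.dist_eq] using this
  obtain ⟨a, ha, h1⟩ := mem_nhdsLT_iff_exists_Ioo_subset.1 h1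
  obtain ⟨b, hb, h2⟩ := mem_nhdsGE_iff_exists_Ico_subset.1 h2
  have ha' : a < t := ha
  have hb' : t < b := hb
  refine ⟨min (t - a) (b - t), lt_min (by linarith) (by linarith), fun x hx y hy => ?_,
    fun x hx y hy => ?_⟩
  · have m := min_le_left (t - a) (b - t)
    have hx' : |f x - l| < η / 2 := h1 ⟨by linarith [hx.1], hx.2⟩
    have hy' : |f y - l| < η / 2 := h1 ⟨by linarith [hy.1], hy.2⟩
    rw [abs_lt] at *
    constructor <;> linarith
  · have m := min_le_right (t - a) (b - t)
    have hx' : |f x - f t| < η / 2 := h2 ⟨hx.1, by linarith [hx.2]⟩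
    have hy' : |f y - f t| < η / 2 := h2 ⟨hy.1, by linarith [hy.2]⟩
    rw [abs_lt] at *
    constructor <;> linarith

theorem exists_bound {f : ℝ → ℝ} (hf : IsCadlagFun f) (a b : ℝ) :
    ∃ K, 0 ≤ K ∧ ∀ x ∈ Icc a b, |f x| ≤ K := by
  have h : ∃ K, ∀ x ∈ Icc a b, |f x| ≤ K := by
    refine isCompact_Icc.induction_on (p := fun s => ∃ K, ∀ x ∈ s, |f x| ≤ K) ⟨0, by simp⟩
      (fun s s' hs ⟨K, hK⟩ => ⟨K, fun x hx => hK x (hs hx)⟩) ?_ fun t _ => ?_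
    · rintro s s' ⟨K, hK⟩ ⟨K', hK'⟩
      exact ⟨max K K', fun x hx => hx.elim (fun h => (hK x h).trans (le_max_left _ _))
        fun h => (hK' x h).trans (le_max_right _ _)⟩
    · obtain ⟨ρ, hρ, h1, h2⟩ := hf.exists_oscillation_lt t one_pos
      refine ⟨Ioo (t - ρ) (t + ρ), mem_nhdsWithin_of_mem_nhds (Ioo_mem_nhds (by linarith)
        (by linarith)), max (|f (t - ρ / 2)| + 1) (|f t| + 1), fun x hx => ?_⟩
      rcases lt_or_ge x t with h | h
      · refine le_trans ?_ (le_max_left _ _)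
        have h3 := h1 x ⟨hx.1, h⟩ (t - ρ / 2) ⟨by linarith, by linarith⟩
        have := abs_sub_abs_le_abs_sub (f x) (f (t - ρ / 2))
        linarith
      · refine le_trans ?_ (le_max_right _ _)
        have h3 := h2 x ⟨h, hx.2⟩ t ⟨le_rfl, by linarith⟩
        have := abs_sub_abs_le_abs_sub (f x) (f t)
        linarith
  obtain ⟨K, hK⟩ := h
  exact ⟨|K|, abs_nonneg K, fun x hx => (hK x hx).trans (le_abs_self K)⟩

/-- On a compact interval, the jumps of a càdlàg function exceeding `η` form a finite set. -/
theorem exists_finset_oscillation {f : ℝ → ℝ} (hf : IsCadlagFun f) (a b : ℝ) {η : ℝ}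
    (hη : 0 < η) : ∃ (B : Finset ℝ) (ρ : ℝ), 0 < ρ ∧ ∀ s ∈ Icc a b, ∀ s' ∈ Icc a b, s ≤ s' →
      s' - s < ρ → (∀ x ∈ B, ¬ (s < x ∧ x ≤ s')) → |f s - f s'| < η := by
  choose r hr h1 h2 using fun t => hf.exists_oscillation_lt t hη
  -- Around each centre the function oscillates by less than `η` on either side, so only the
  -- finitely many centres of a subcover can carry larger jumps.
  obtain ⟨B, -, hB⟩ := (isCompact_Icc (a := a) (b := b)).elim_nhds_subcover
    (fun t => Ioo (t - r t) (t + r t))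
    fun t _ => Ioo_mem_nhds (by linarith [hr t]) (by linarith [hr t])
  obtain ⟨ρ, hρ, hL⟩ := lebesgue_number_lemma_of_metric (isCompact_Icc (a := a) (b := b))
    (c := fun t : B => Ioo (t.1 - r t) (t.1 + r t)) (fun _ => isOpen_Ioo) (by
      intro x hx
      obtain ⟨t, ht, hxt⟩ := mem_iUnion₂.1 (hB hx)
      exact mem_iUnion.2 ⟨⟨t, ht⟩, hxt⟩)
  refine ⟨B, ρ, hρ, fun s hs s' hs' hss hlt hno => ?_⟩
  obtain ⟨⟨t, ht⟩, hsub⟩ := hL s hs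
  have m1 := hsub (Metric.mem_ball_self hρ)
  have m2 : s' ∈ Ioo (t - r t) (t + r t) := hsub (by
    rw [Metric.mem_ball, Real.dist_eq, abs_of_nonneg (by linarith)]; exact hlt)
  rcases lt_or_ge s t with h | h
  · have h' : s' < t := by
      by_contra hc
      exact hno t ht ⟨h, not_lt.1 hc⟩
    exact h1 t s ⟨m1.1, h⟩ s' ⟨m2.1, h'⟩
  · exact h2 t s ⟨h, m1.2⟩ s' ⟨h.trans hss, m2.2⟩

/-- Darboux sums of the oscillation of a càdlàg function tend to zero. -/
theorem exists_darboux {f : ℝ → ℝ} (hf : IsCadlagFun f) {t : ℝ} (ht : 0 < t) {η : ℝ}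
    (hη : 0 < η) : ∃ (M : ℕ) (D : ℕ → ℝ), 0 < M ∧ (∀ j, 0 ≤ D j) ∧
      t / M * ∑ j ∈ Finset.range M, D j ≤ η ∧
      ∀ j < M, ∀ r ∈ Icc (t * j / M - t / M) (t * (j + 1) / M),
        ∀ r' ∈ Icc (t * j / M - t / M) (t * (j + 1) / M), |f r - f r'| ≤ D j := by
  obtain ⟨K, hK0, hK⟩ := hf.exists_bound (-t) t
  set η₁ := η / (2 * t) with hη₁
  obtain ⟨B, ρ, hρ, hB⟩ := hf.exists_finset_oscillation (-t) t (η := η₁) (by positivity)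
  obtain ⟨M, hM⟩ := exists_nat_gt (max (max 1 (2 * t / ρ)) (t * (B.card * (4 * K)) / (η / 2)))
  have hM1 : (1 : ℝ) < M := (le_max_left _ _).trans_lt ((le_max_left _ _).trans_lt hM)
  have hM2 : 2 * t / ρ < M := (le_max_right _ _).trans_lt ((le_max_left _ _).trans_lt hM)
  have hM3 : t * (B.card * (4 * K)) / (η / 2) < M := (le_max_right _ _).trans_lt hM
  have hM0 : (0 : ℝ) < M := by linarith
  -- Blocks are enlarged by one step to the left to make room for delayed evaluation points. Each
  -- exceptional point `x` then affects only the blocks `c x` and `c x + 1`, where the crude bound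
  -- `2K` is used; `M` is so large that these contribute at most `η/2`.
  let c : ℝ → ℕ := fun x => ⌈x * M / t - 1⌉₊
  let D : ℕ → ℝ := fun j => η₁ + ∑ x ∈ B, if j ∈ Finset.Ico (c x) (c x + 2) then 2 * K else 0
  have hsum0 : ∀ j, 0 ≤ ∑ x ∈ B, if j ∈ Finset.Ico (c x) (c x + 2) then 2 * K else 0 := fun j =>
    Finset.sum_nonneg fun x _ => by split_ifs <;> positivity
  refine ⟨M, D, by exact_mod_cast hM0, fun j => add_nonneg (by positivity) (hsum0 j), ?_, ?_⟩
  · have h1 : ∑ j ∈ Finset.range M, D j ≤ M * η₁ + B.card * (4 * K) := by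
      simp only [D, Finset.sum_add_distrib, Finset.sum_const, Finset.card_range, nsmul_eq_mul]
      gcongr
      rw [Finset.sum_comm]
      refine (Finset.sum_le_card_nsmul B _ (4 * K) fun x _ => ?_).trans (by simp)
      rw [← Finset.sum_filter, Finset.sum_const, nsmul_eq_mul]
      have h2 : ((Finset.range M).filter fun j => j ∈ Finset.Ico (c x) (c x + 2)).card ≤ 2 := by
        refine (Finset.card_le_card (t := Finset.Ico (c x) (c x + 2)) fun j hj =>
          (Finset.mem_filter.1 hj).2).trans (by simp)
      have h3 : (((Finset.range M).filter fun j => j ∈ Finset.Ico (c x) (c x + 2)).card : ℝ) ≤ 2 :=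
        by exact_mod_cast h2
      nlinarith
    have h4 : t * (B.card * (4 * K)) / M ≤ η / 2 := by
      rw [div_lt_iff₀ (by positivity)] at hM3
      rw [div_le_iff₀ hM0]; linarith
    calc t / M * ∑ j ∈ Finset.range M, D j ≤ t / M * (M * η₁ + B.card * (4 * K)) := by gcongr
      _ = t * η₁ + t * (B.card * (4 * K)) / M := by field_simp
      _ ≤ η / 2 + η / 2 := by
        gcongr
        rw [hη₁]; apply le_of_eq; field_simp
      _ = η := by ring
  · have main : ∀ j < M, ∀ r ∈ Icc (t * j / M - t / M) (t * (j + 1) / M),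
        ∀ r' ∈ Icc (t * j / M - t / M) (t * (j + 1) / M), r ≤ r' → |f r - f r'| ≤ D j := by
      intro j hj r hr r' hr' hrr
      have hjM : (j : ℝ) + 1 ≤ M := by exact_mod_cast hj
      have hlow : -t ≤ t * j / M - t / M := by
        have h5 : t / M ≤ t := div_le_self ht.le hM1.le
        have : 0 ≤ t * j / M := by positivity
        linarith
      have hup : t * (j + 1) / M ≤ t := by
        rw [div_le_iff₀ hM0]; exact mul_le_mul_of_nonneg_left hjM ht.le
      have mr : r ∈ Icc (-t) t := ⟨hlow.trans hr.1, hr.2.trans hup⟩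
      have mr' : r' ∈ Icc (-t) t := ⟨hlow.trans hr'.1, hr'.2.trans hup⟩
      by_cases hno : ∀ x ∈ B, ¬ (r < x ∧ x ≤ r')
      · have hlen : r' - r < ρ := by
          have h6 : 2 * t / M < ρ := by
            rw [div_lt_iff₀ hM0]; rw [div_lt_iff₀ hρ] at hM2; linarith
          have h7 : t * (j + 1) / M - (t * j / M - t / M) = 2 * t / M := by ring
          linarith [hr.1, hr'.2]
        have := hB r mr r' mr' hrr hlen hno
        simp only [D]; linarith [hsum0 j]
      · push Not at hno
        obtain ⟨x, hx, hx1, hx2⟩ := hno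
        have h8 : 2 * K ≤ ∑ x ∈ B, if j ∈ Finset.Ico (c x) (c x + 2) then 2 * K else 0 := by
          refine le_trans ?_ (Finset.single_le_sum (f := fun x =>
            if j ∈ Finset.Ico (c x) (c x + 2) then 2 * K else 0)
            (fun x _ => by split_ifs <;> positivity) hx)
          have a1 : x * M / t - 1 ≤ j := by
            have h9 : x ≤ t * (j + 1) / M := hx2.trans hr'.2
            rw [le_div_iff₀ hM0] at h9
            rw [sub_le_iff_le_add, div_le_iff₀ ht]; linarith
          have a2 : (j : ℝ) < x * M / t + 1 := by
            have h9 : t * j / M - t / M < x := hr.1.trans_lt hx1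
            rw [← sub_div, div_lt_iff₀ hM0] at h9
            rw [← sub_lt_iff_lt_add, lt_div_iff₀ ht]; linarith
          have a3 : j ∈ Finset.Ico (c x) (c x + 2) := by
            refine Finset.mem_Ico.2 ⟨Nat.ceil_le.2 a1, ?_⟩
            have := Nat.le_ceil (x * M / t - 1)
            have h10 : (j : ℝ) < c x + 2 := by simp only [c]; linarith
            exact_mod_cast h10
          simp only [a3, if_true]; exact le_rfl
        have h9 : |f r - f r'| ≤ 2 * K := by
          have e1 := hK r mr
          have e2 := hK r' mr'
          rw [abs_le] at *
          constructor <;> linarith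
        have : 0 < η₁ := by positivity
        simp only [D]; linarith
    intro j hj r hr r' hr'
    rcases le_total r r' with h | h
    · exact main j hj r hr r' hr' h
    · rw [abs_sub_comm]; exact main j hj r' hr' r hr h

end IsCadlagFun

/-! ### Riemann sums and measurability of càdlàg functions -/

/-- Block decomposition of a weighted sum over `1, …, N M`. -/
theorem abs_sum_sub_le_blocks {y z : ℕ → ℝ} (hz : ∀ i, 0 ≤ z i) (hz0 : z 0 = 0) {N : ℕ → ℕ}
    (hN : Monotone N) (hN0 : N 0 = 0) {M : ℕ} {φ D : ℕ → ℝ}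
    (h : ∀ j < M, ∀ i, N j < i → i ≤ N (j + 1) → |y i - φ j| ≤ D j) :
    |∑ i ∈ Finset.range (N M + 1), y i * z i - ∑ j ∈ Finset.range M, φ j *
      (∑ i ∈ Finset.range (N (j + 1) + 1), z i - ∑ i ∈ Finset.range (N j + 1), z i)| ≤
    ∑ j ∈ Finset.range M, D j *
      (∑ i ∈ Finset.range (N (j + 1) + 1), z i - ∑ i ∈ Finset.range (N j + 1), z i) := by
  have tel : ∀ a : ℕ → ℝ, a 0 = 0 → ∑ i ∈ Finset.range (N M + 1), a i =
      ∑ j ∈ Finset.range M, (∑ i ∈ Finset.range (N (j + 1) + 1), a i -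
        ∑ i ∈ Finset.range (N j + 1), a i) := by
    intro a ha
    rw [Finset.sum_range_sub (fun j => ∑ i ∈ Finset.range (N j + 1), a i), hN0]
    simp [ha]
  have blk : ∀ (a : ℕ → ℝ) (j : ℕ), ∑ i ∈ Finset.range (N (j + 1) + 1), a i -
        ∑ i ∈ Finset.range (N j + 1), a i = ∑ i ∈ Finset.Ico (N j + 1) (N (j + 1) + 1), a i := by
    intro a j
    rw [Finset.sum_Ico_eq_sub _ (by have := hN (Nat.le_succ j); simp at this; omega)]
  rw [tel (fun i => y i * z i) (by simp [hz0]), ← Finset.sum_sub_distrib]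
  refine (Finset.abs_sum_le_sum_abs _ _).trans (Finset.sum_le_sum fun j hj => ?_)
  rw [blk, blk, Finset.mul_sum, ← Finset.sum_sub_distrib, Finset.mul_sum]
  refine (Finset.abs_sum_le_sum_abs _ _).trans (Finset.sum_le_sum fun i hi => ?_)
  rw [← sub_mul, abs_mul, abs_of_nonneg (hz i)]
  have := Finset.mem_Ico.1 hi
  exact mul_le_mul_of_nonneg_right (h j (Finset.mem_range.1 hj) i (by omega) (by omega)) (hz i)

/-- Convergence of weighted Riemann sums from convergence of the weights on all grids. -/
theorem tendsto_weighted_sum {f : ℝ → ℝ} (hf : IsCadlagFun f) {t c : ℝ} (ht : 0 < t)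
    (hc : 0 ≤ c) {δ : ℕ → ℝ} (hδ : ∀ k, 0 < δ k) {y z : ℕ → ℕ → ℝ} (hz : ∀ k i, 0 ≤ z k i)
    (hz0 : ∀ k, z k 0 = 0)
    (hF : ∀ M : ℕ, 0 < M → ∀ j ≤ M, Tendsto (fun k => δ k *
      ∑ i ∈ Finset.range (⌊t * j / M / δ k⌋₊ + 1), z k i) atTop (𝓝 (c * (t * j / M))))
    {φ : ℕ → ℕ → ℝ} {l : ℝ}
    (h : ∀ M : ℕ, 0 < M → ∀ D : ℕ → ℝ,
      (∀ j < M, ∀ r ∈ Icc (t * j / M - t / M) (t * (j + 1) / M),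
        ∀ r' ∈ Icc (t * j / M - t / M) (t * (j + 1) / M), |f r - f r'| ≤ D j) →
      (∀ᶠ k in atTop, ∀ j < M, ∀ i : ℕ, t * j / M < i * δ k → i * δ k ≤ t * (j + 1) / M →
        |y k i - φ M j| ≤ D j) ∧
      |c * (t / M) * ∑ j ∈ Finset.range M, φ M j - l| ≤
        c * (t / M * ∑ j ∈ Finset.range M, D j)) :
    Tendsto (fun k => δ k * ∑ i ∈ Finset.range (⌊t / δ k⌋₊ + 1), y k i * z k i) atTop (𝓝 l) := by
  rw [Metric.tendsto_atTop']
  intro ε hε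
  -- The block error `cη + η`, the convergence error `η` and the discretization error `cη` add up to
  -- `ε/2`.
  set η := ε / (4 * (c + 1)) with hη
  have hη0 : 0 < η := by positivity
  obtain ⟨M, D, hM, hD0, hDη, hD⟩ := hf.exists_darboux ht hη0
  obtain ⟨hev, hl⟩ := h M hM D hD
  have hM0 : (0 : ℝ) < M := by exact_mod_cast hM
  let Fk : ℕ → ℕ → ℝ := fun k j => δ k * ∑ i ∈ Finset.range (⌊t * j / M / δ k⌋₊ + 1), z k i
  have hdF : ∀ j < M, Tendsto (fun k => Fk k (j + 1) - Fk k j) atTop (𝓝 (c * (t / M))) := by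
    intro j hj
    have h1 := (hF M hM (j + 1) hj).sub (hF M hM j hj.le)
    have e : c * (t * ((j + 1 : ℕ) : ℝ) / M) - c * (t * j / M) = c * (t / M) := by
      push_cast; field_simp; ring
    rwa [e] at h1
  have hsumlim : ∀ ψ : ℕ → ℝ, Tendsto (fun k => ∑ j ∈ Finset.range M,
      ψ j * (Fk k (j + 1) - Fk k j)) atTop (𝓝 (c * (t / M) * ∑ j ∈ Finset.range M, ψ j)) := by
    intro ψ
    rw [Finset.mul_sum]
    refine tendsto_finsetSum _ fun j hj => ?_
    rw [mul_comm]
    exact (hdF j (Finset.mem_range.1 hj)).const_mul (ψ j)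
  have hP := Metric.tendsto_nhds.1 (hsumlim (φ M)) η hη0
  have hQ : ∀ᶠ k in atTop, ∑ j ∈ Finset.range M, D j * (Fk k (j + 1) - Fk k j) < c * η + η := by
    refine (hsumlim D).eventually (gt_mem_nhds ?_)
    have : c * (t / M * ∑ j ∈ Finset.range M, D j) ≤ c * η := by gcongr
    rw [mul_assoc]; linarith
  obtain ⟨k₀, hk₀⟩ := eventually_atTop.1 ((hev.and hP).and hQ)
  refine ⟨k₀, fun k hk => ?_⟩
  obtain ⟨⟨a1, a2⟩, a3⟩ := hk₀ k hk.le
  have hblk := abs_sum_sub_le_blocks (y := y k) (z := z k) (hz k) (hz0 k)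
    (N := fun j => ⌊t * j / M / δ k⌋₊) (M := M) (φ := φ M) (D := D)
    (fun i j hij => Nat.floor_le_floor (by
      have : (i : ℝ) ≤ j := by exact_mod_cast hij
      have := hδ k
      gcongr)) (by simp) (by
      intro j hj i h1 h2
      refine a1 j hj i ?_ ?_
      · rw [← div_lt_iff₀ (hδ k)]; exact Nat.lt_of_floor_lt h1
      · have h3 : (i : ℝ) ≤ t * ((j + 1 : ℕ) : ℝ) / M / δ k :=
          (Nat.cast_le.2 h2).trans (Nat.floor_le (by have := hδ k; positivity))
        rw [le_div_iff₀ (hδ k)] at h3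
        push_cast at h3; exact h3)
  have eM : t * (M : ℝ) / M / δ k = t / δ k := by field_simp
  simp only [eM] at hblk
  have hmul := mul_le_mul_of_nonneg_left hblk (hδ k).le
  rw [← abs_of_pos (hδ k), ← abs_mul, abs_of_pos (hδ k), mul_sub, Finset.mul_sum, Finset.mul_sum,
    Finset.mul_sum] at hmul
  have e1 : ∀ ψ : ℕ → ℝ, ∑ j ∈ Finset.range M, δ k * (ψ j *
      (∑ i ∈ Finset.range (⌊t * ((j + 1 : ℕ) : ℝ) / M / δ k⌋₊ + 1), z k i -
        ∑ i ∈ Finset.range (⌊t * j / M / δ k⌋₊ + 1), z k i)) =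
      ∑ j ∈ Finset.range M, ψ j * (Fk k (j + 1) - Fk k j) := fun ψ =>
    Finset.sum_congr rfl fun j _ => by simp only [Fk]; ring
  rw [e1, e1, ← Finset.mul_sum] at hmul
  rw [Real.dist_eq] at a2 ⊢
  have hcη : c * (t / M * ∑ j ∈ Finset.range M, D j) ≤ c * η := by gcongr
  have hfin : 2 * (c * η) + 2 * η < ε := by
    have : (c + 1) * η = ε / 4 := by rw [hη]; field_simp
    nlinarith
  have t1 := abs_sub_le (δ k * ∑ i ∈ Finset.range (⌊t / δ k⌋₊ + 1), y k i * z k i)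
    (∑ j ∈ Finset.range M, φ M j * (Fk k (j + 1) - Fk k j)) l
  have t2 := abs_sub_le (∑ j ∈ Finset.range M, φ M j * (Fk k (j + 1) - Fk k j))
    (c * (t / M) * ∑ j ∈ Finset.range M, φ M j) l
  linarith

/-- Dyadic-type approximation of a real number from the right. -/
theorem tendsto_right_grid (s : ℝ) :
    Tendsto (fun n : ℕ => (⌊(n + 1 : ℝ) * s⌋ + 1 : ℝ) / (n + 1)) atTop (𝓝[≥] s) := by
  have hb : ∀ n : ℕ, s ≤ (⌊(n + 1 : ℝ) * s⌋ + 1 : ℝ) / (n + 1) ∧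
      (⌊(n + 1 : ℝ) * s⌋ + 1 : ℝ) / (n + 1) ≤ s + 1 / (n + 1) := by
    intro n
    have hn : (0 : ℝ) < n + 1 := by positivity
    constructor
    · rw [le_div_iff₀ hn]; linarith [Int.lt_floor_add_one ((n + 1 : ℝ) * s)]
    · rw [div_le_iff₀ hn, add_mul s, one_div_mul_cancel hn.ne']
      linarith [Int.floor_le ((n + 1 : ℝ) * s)]
  refine tendsto_nhdsWithin_iff.2 ⟨?_, Eventually.of_forall fun n => (hb n).1⟩
  have h2 : Tendsto (fun n : ℕ => s + 1 / ((n : ℝ) + 1)) atTop (𝓝 (s + 0)) :=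
    tendsto_const_nhds.add tendsto_one_div_add_atTop_nhds_zero_nat
  rw [add_zero] at h2
  exact tendsto_of_tendsto_of_tendsto_of_le_of_le tendsto_const_nhds h2 (fun n => (hb n).1)
    fun n => (hb n).2

theorem IsCadlag.isCadlagFun {Ω : Type*} {σ : ℝ → Ω → ℝ} (h : IsCadlag σ) (ω : Ω) :
    IsCadlagFun fun s => σ s ω := fun t => h ω t

/-- A càdlàg process is jointly measurable. -/
theorem IsCadlag.measurable_uncurry {Ω : Type*} {mΩ : MeasurableSpace Ω} {σ : ℝ → Ω → ℝ}
    (h : IsCadlag σ) (hm : ∀ s, Measurable (σ s)) : Measurable (Function.uncurry σ) := by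
  have hr : ∀ n : ℕ, Measurable fun x : ℝ × Ω =>
      σ ((⌊(n + 1 : ℝ) * x.1⌋ + 1 : ℝ) / (n + 1)) x.2 := by
    -- Rounding the time up to a grid leaves countably many times, so measurability in `ω` suffices;
    -- right-continuity then gives the limit.
    intro n
    have h1 : Measurable fun x : ℤ × Ω => σ ((x.1 + 1 : ℝ) / (n + 1)) x.2 :=
      measurable_from_prod_countable_right fun k => hm ((k + 1 : ℝ) / (n + 1))
    exact h1.comp ((Int.measurable_floor.comp (measurable_fst.const_mul _)).prodMk measurable_snd)
  refine measurable_of_tendsto_metrizable hr (tendsto_pi_nhds.2 fun x => ?_)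
  exact (h x.2 x.1).1.tendsto.comp (tendsto_right_grid x.1)

theorem IsCadlagFun.measurable {f : ℝ → ℝ} (hf : IsCadlagFun f) : Measurable f := by
  have h : Measurable (Function.uncurry fun s (_ : Unit) => f s) :=
    IsCadlag.measurable_uncurry (fun _ => hf) fun _ => measurable_const
  exact h.comp (measurable_id.prodMk (measurable_const (a := ())))

theorem IsCadlagFun.intervalIntegrable {f : ℝ → ℝ} (hf : IsCadlagFun f) (a b : ℝ) :
    IntervalIntegrable f volume a b := by
  obtain ⟨K, -, hK⟩ := hf.exists_bound (min a b) (max a b)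
  refine (intervalIntegrable_const (c := K)).mono_fun hf.measurable.aestronglyMeasurable ?_
  refine (ae_restrict_iff' measurableSet_uIoc).2 (ae_of_all _ fun x hx => ?_)
  exact (hK x (Ioc_subset_Icc_self hx)).trans (le_abs_self K)

/-- Weighted Riemann sums of a càdlàg function with slightly delayed evaluation points. -/
theorem IsCadlagFun.tendsto_riemann {f : ℝ → ℝ} (hf : IsCadlagFun f) {t c : ℝ} (ht : 0 < t)
    (hc : 0 ≤ c) {δ ε : ℕ → ℝ} (hδ : ∀ k, 0 < δ k) (hε : ∀ k, 0 ≤ ε k)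
    (hε0 : Tendsto ε atTop (𝓝 0)) {z : ℕ → ℕ → ℝ} (hz : ∀ k i, 0 ≤ z k i) (hz0 : ∀ k, z k 0 = 0)
    (hF : ∀ M : ℕ, 0 < M → ∀ j ≤ M, Tendsto (fun k => δ k *
      ∑ i ∈ Finset.range (⌊t * j / M / δ k⌋₊ + 1), z k i) atTop (𝓝 (c * (t * j / M)))) :
    Tendsto (fun k => δ k * ∑ i ∈ Finset.range (⌊t / δ k⌋₊ + 1), f (i * δ k - ε k) * z k i)
      atTop (𝓝 (c * ∫ s in (0 : ℝ)..t, f s)) := by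
  refine tendsto_weighted_sum hf ht hc hδ hz hz0 hF (φ := fun M j => f (t * j / M))
    fun M hM D hD => ⟨?_, ?_⟩
  · have hM0 : (0 : ℝ) < M := by exact_mod_cast hM
    filter_upwards [hε0.eventually (gt_mem_nhds (show 0 < t / M by positivity))] with k hk j hj i
      h1 h2
    have := hε k
    exact hD j hj _ ⟨by linarith, by linarith⟩ _ ⟨by linarith, by linarith⟩
  · have hM0 : (0 : ℝ) < M := by exact_mod_cast hM
    have hsplit := intervalIntegral.sum_integral_adjacent_intervals (f := f) (μ := volume)
      (a := fun j : ℕ => t * j / M) (n := M) fun j _ => hf.intervalIntegrable _ _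
    have e0 : t * ((0 : ℕ) : ℝ) / M = 0 := by simp
    have eM : t * (M : ℝ) / M = t := by field_simp
    rw [e0, eM] at hsplit
    rw [← hsplit, mul_assoc, ← mul_sub, abs_mul, abs_of_nonneg hc]
    refine mul_le_mul_of_nonneg_left ?_ hc
    rw [Finset.mul_sum, ← Finset.sum_sub_distrib, Finset.mul_sum]
    refine (Finset.abs_sum_le_sum_abs _ _).trans (Finset.sum_le_sum fun j hj => ?_)
    have hstep : t * ((j + 1 : ℕ) : ℝ) / M - t * j / M = t / M := by push_cast; ring
    have e1 : t / M * f (t * j / M) = ∫ _ in (t * j / M)..(t * ((j + 1 : ℕ) : ℝ) / M),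
        f (t * j / M) := by
      rw [intervalIntegral.integral_const, hstep, smul_eq_mul]
    rw [e1, ← intervalIntegral.integral_sub intervalIntegrable_const (hf.intervalIntegrable _ _)]
    have hle : t * j / M ≤ t * ((j + 1 : ℕ) : ℝ) / M := by
      have : 0 < t / M := by positivity
      linarith
    have := intervalIntegral.norm_integral_le_of_norm_le_const (a := t * j / M)
      (b := t * ((j + 1 : ℕ) : ℝ) / M) (f := fun x => f (t * j / M) - f x) (C := D j) (by
        intro x hx
        rw [uIoc_of_le hle] at hx
        have hx2 : x ≤ t * (j + 1) / M := by have := hx.2; push_cast at this; exact this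
        have : 0 < t / M := by positivity
        refine hD j (Finset.mem_range.1 hj) _ ⟨by linarith, ?_⟩ _ ⟨by linarith [hx.1], hx2⟩
        push_cast at hle; exact hle)
    rw [hstep, abs_of_pos (show 0 < t / M by positivity), mul_comm (D j)] at this
    exact this

theorem sum_range_ite (a : ℕ → ℝ) (m n : ℕ) :
    ∑ i ∈ Finset.range (n + 1), (if m ≤ i then a i else 0) = ∑ i ∈ Finset.Icc m n, a i := by
  rw [← Finset.sum_filter]
  refine Finset.sum_congr ?_ fun _ _ => rfl
  ext i
  simp only [Finset.mem_filter, Finset.mem_range, Finset.mem_Icc]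
  omega

theorem tendsto_mul_floor_div {δ : ℕ → ℝ} (hδ : ∀ k, 0 < δ k) (hδ0 : Tendsto δ atTop (𝓝 0))
    {s : ℝ} (hs : 0 ≤ s) : Tendsto (fun k => δ k * (⌊s / δ k⌋₊ : ℝ)) atTop (𝓝 s) := by
  have h1 : Tendsto (fun k => s - δ k) atTop (𝓝 (s - 0)) := tendsto_const_nhds.sub hδ0
  rw [sub_zero] at h1
  refine tendsto_of_tendsto_of_tendsto_of_le_of_le h1 tendsto_const_nhds (fun k => ?_) fun k => ?_
  · have := Nat.lt_floor_add_one (s / δ k)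
    rw [div_lt_iff₀ (hδ k)] at this
    simp only; linarith
  · have := Nat.floor_le (div_nonneg hs (hδ k).le)
    rw [le_div_iff₀ (hδ k)] at this
    simp only; linarith

/-- Averages of the oscillation of a càdlàg function over short intervals tend to zero. -/
theorem IsCadlagFun.tendsto_oscillation {f : ℝ → ℝ} (hf : IsCadlagFun f) {t : ℝ} (ht : 0 < t)
    {δ ε : ℕ → ℝ} (hδ : ∀ k, 0 < δ k) (hδ0 : Tendsto δ atTop (𝓝 0))
    (hε0 : Tendsto ε atTop (𝓝 0)) {w : ℕ → ℕ → ℝ} (hw : ∀ k i, 0 ≤ w k i)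
    (h : ∀ (k i : ℕ) (D : ℝ), 0 < i → i * δ k ≤ t → (∀ r ∈ Icc (i * δ k - ε k) (i * δ k),
      ∀ r' ∈ Icc (i * δ k - ε k) (i * δ k), |f r - f r'| ≤ D) → w k i ≤ D) :
    Tendsto (fun k => δ k * ∑ i ∈ Finset.Icc 1 ⌊t / δ k⌋₊, w k i) atTop (𝓝 0) := by
  -- Comparison with the value zero: the hypothesis bounds `w` itself by the block oscillation, so
  -- the Darboux estimate forces the average to vanish.
  have key := tendsto_weighted_sum hf ht zero_le_one hδ (y := w)
    (z := fun _ i => if 1 ≤ i then 1 else 0) (fun _ _ => by split_ifs <;> simp) (by simp)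
    (φ := fun _ _ => 0) (l := 0) (by
      intro M hM j _
      have hs : 0 ≤ t * j / M := by positivity
      rw [one_mul]
      refine (tendsto_mul_floor_div hδ hδ0 hs).congr fun k => ?_
      rw [sum_range_ite (fun _ => 1)]; simp) (by
      intro M hM D hD
      have hM0 : (0 : ℝ) < M := by exact_mod_cast hM
      have hD0 : ∀ j < M, 0 ≤ D j := fun j hj => by
        have m : t * j / M ∈ Icc (t * j / M - t / M) (t * (j + 1) / M) := by
          have : 0 < t / M := by positivity
          have e : t * (j + 1) / M = t * j / M + t / M := by ring
          constructor <;> linarith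
        exact (abs_nonneg _).trans (hD j hj _ m _ m)
      refine ⟨?_, ?_⟩
      · filter_upwards [hε0.eventually (gt_mem_nhds (show 0 < t / M by positivity))] with k hk j hj
          i h1 h2
        rw [sub_zero, abs_of_nonneg (hw k i)]
        have hi : 0 < i := by
          rcases Nat.eq_zero_or_pos i with rfl | hi
          · have : 0 ≤ t * j / M := by positivity
            simp at h1; linarith
          · exact hi
        have hjM : (j : ℝ) + 1 ≤ M := by exact_mod_cast hj
        refine h k i _ hi (h2.trans ?_) fun r hr r' hr' => hD j hj r ⟨?_, ?_⟩ r' ⟨?_, ?_⟩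
        · rw [div_le_iff₀ hM0]; exact mul_le_mul_of_nonneg_left hjM ht.le
        · linarith [hr.1]
        · linarith [hr.2]
        · linarith [hr'.1]
        · linarith [hr'.2]
      · simp only [Finset.sum_const_zero, mul_zero, sub_zero, abs_zero, one_mul]
        exact mul_nonneg (by positivity)
          (Finset.sum_nonneg fun j hj => hD0 j (Finset.mem_range.1 hj)))
  refine key.congr fun k => ?_
  rw [← sum_range_ite]
  simp

/-! ### Elementary inequalities and uniform convergence -/

/-- A perturbation inequality for powers. -/
theorem exists_abs_rpow_sub_le {p : ℝ} (hp : 0 < p) {κ : ℝ} (hκ : 0 < κ) :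
    ∃ C : ℝ, 0 ≤ C ∧ ∀ a b : ℝ, |(|a| ^ p - |b| ^ p)| ≤ κ * |b| ^ p + C * |a - b| ^ p := by
  have h1 : Tendsto (fun θ : ℝ => (1 + θ) ^ p - 1) (𝓝[>] 0) (𝓝 0) := by
    have : ContinuousAt (fun θ : ℝ => (1 + θ) ^ p - 1) 0 :=
      ((continuousAt_const.add continuousAt_id).rpow_const (Or.inr hp.le)).sub continuousAt_const
    have h := this.tendsto.mono_left (nhdsWithin_le_nhds (s := Ioi 0))
    simpa using h
  have h2 : Tendsto (fun θ : ℝ => 1 - (1 - θ) ^ p) (𝓝[>] 0) (𝓝 0) := by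
    have : ContinuousAt (fun θ : ℝ => 1 - (1 - θ) ^ p) 0 :=
      continuousAt_const.sub ((continuousAt_const.sub continuousAt_id).rpow_const (Or.inr hp.le))
    have h := this.tendsto.mono_left (nhdsWithin_le_nhds (s := Ioi 0))
    simpa using h
  -- If `|a - b| ≤ θ|b|`, the two powers differ by a factor within `κ` of one; otherwise both are at
  -- most a constant times `|a - b|^p`. No distinction between `p ≤ 1` and `p > 1` is needed.
  obtain ⟨θ, ⟨⟨e1, e2⟩, e3⟩⟩ := ((h1.eventually (gt_mem_nhds hκ)).and
    (h2.eventually (gt_mem_nhds hκ))).and (Ioo_mem_nhdsGT one_pos) |>.exists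
  have hθ0 : 0 < θ := e3.1
  have hθ1 : θ < 1 := e3.2
  refine ⟨(1 + 1 / θ) ^ p, by positivity, fun a b => ?_⟩
  have hab : |a| ≤ |b| + |a - b| := by
    have := abs_sub_abs_le_abs_sub a b; linarith
  have hba : |b| ≤ |a| + |a - b| := by
    have := abs_sub_abs_le_abs_sub b a; rw [abs_sub_comm] at this; linarith
  have hbp : 0 ≤ |b| ^ p := by positivity
  have hap : 0 ≤ |a| ^ p := by positivity
  by_cases hs : |a - b| ≤ θ * |b|
  · have u1 : |a| ^ p ≤ (1 + θ) ^ p * |b| ^ p := by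
      rw [← Real.mul_rpow (by linarith) (abs_nonneg b)]
      exact Real.rpow_le_rpow (abs_nonneg a) (by linarith) hp.le
    have u2 : (1 - θ) ^ p * |b| ^ p ≤ |a| ^ p := by
      rw [← Real.mul_rpow (by linarith) (abs_nonneg b)]
      exact Real.rpow_le_rpow (mul_nonneg (by linarith) (abs_nonneg b)) (by linarith) hp.le
    have u3 : 0 ≤ (1 + 1 / θ) ^ p * |a - b| ^ p := by positivity
    have u4 := mul_le_mul_of_nonneg_right e1.le hbp
    have u5 := mul_le_mul_of_nonneg_right e2.le hbp
    rw [abs_le]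
    constructor <;> linarith
  · push Not at hs
    have hb' : |b| ≤ 1 / θ * |a - b| := by
      rw [one_div, inv_mul_eq_div, le_div_iff₀ hθ0]; linarith
    have v1 : |a| ^ p ≤ (1 + 1 / θ) ^ p * |a - b| ^ p := by
      rw [← Real.mul_rpow (by positivity) (abs_nonneg _)]
      exact Real.rpow_le_rpow (abs_nonneg a) (by linarith) hp.le
    have v2 : |b| ^ p ≤ (1 + 1 / θ) ^ p * |a - b| ^ p := by
      rw [← Real.mul_rpow (by positivity) (abs_nonneg _)]
      exact Real.rpow_le_rpow (abs_nonneg b) (by linarith [abs_nonneg (a - b)]) hp.le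
    have v3 : 0 ≤ κ * |b| ^ p := by positivity
    rw [abs_le]
    constructor <;> linarith

/-- Pólya's theorem: monotone functions converging on all grids to a continuous function converge
uniformly. -/
theorem tendsto_uniform_of_monotone {T : ℝ} (hT : 0 < T) {F : ℕ → ℝ → ℝ} {I : ℝ → ℝ}
    (hF : ∀ᶠ k in atTop, Monotone (F k)) (hI : ContinuousOn I (Icc 0 T))
    (h : ∀ M : ℕ, 0 < M → ∀ j ≤ M, Tendsto (fun k => F k (T * j / M)) atTop
      (𝓝 (I (T * j / M)))) :
    Tendsto (fun x : ℕ × ℝ => F x.1 x.2 - I x.2) (atTop ×ˢ 𝓟 (Icc 0 T)) (𝓝 0) := by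
  rw [Metric.tendsto_nhds]
  intro ε hε
  have hu := isCompact_Icc.uniformContinuousOn_of_continuous hI
  obtain ⟨ρ, hρ, hu⟩ := Metric.uniformContinuousOn_iff.1 hu (ε / 2) (by positivity)
  obtain ⟨M, hM⟩ := exists_nat_gt (max 0 (T / ρ))
  have hM0 : (0 : ℝ) < M := (le_max_left _ _).trans_lt hM
  have hM1 : T / M < ρ := by
    have := (le_max_right _ _).trans_lt hM
    rw [div_lt_iff₀ hρ] at this
    rw [div_lt_iff₀ hM0]; linarith
  have hM' : 0 < M := by exact_mod_cast hM0
  have hgrid : ∀ᶠ k in atTop, ∀ j ∈ Finset.range (M + 1),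
      |F k (T * j / M) - I (T * j / M)| < ε / 2 := by
    refine (Finset.eventually_all _).2 fun j hj => ?_
    have := Metric.tendsto_nhds.1 (h M hM' j (by have := Finset.mem_range.1 hj; omega)) (ε / 2)
      (by positivity)
    simpa [Real.dist_eq] using this
  rw [eventually_prod_principal_iff]
  filter_upwards [hgrid, hF] with k hk hmono t ht
  simp only [Real.dist_eq, sub_zero]
  have hmem : ∀ j : ℕ, j ≤ M → T * j / M ∈ Icc (0 : ℝ) T := fun j hj => by
    have hj' : (j : ℝ) ≤ M := by exact_mod_cast hj
    refine ⟨by positivity, ?_⟩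
    rw [div_le_iff₀ hM0]; exact mul_le_mul_of_nonneg_left hj' hT.le
  set j := ⌊t * M / T⌋₊ with hj
  have hj1 : T * j / M ≤ t := by
    have := Nat.floor_le (show 0 ≤ t * M / T from div_nonneg (mul_nonneg ht.1 hM0.le) hT.le)
    rw [le_div_iff₀ hT] at this
    rw [div_le_iff₀ hM0]; linarith
  have hj2 : t < T * (j + 1 : ℕ) / M := by
    have := Nat.lt_floor_add_one (t * M / T)
    rw [div_lt_iff₀ hT] at this
    rw [lt_div_iff₀ hM0]; push_cast; linarith
  have hjM : j ≤ M := by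
    have h3 : (j : ℝ) ≤ M := by
      rw [div_le_iff₀ hM0] at hj1
      have := mul_le_mul_of_nonneg_right ht.2 hM0.le
      exact le_of_mul_le_mul_left (hj1.trans this) hT
    exact_mod_cast h3
  have hstep : T * (j + 1 : ℕ) / M = T * j / M + T / M := by push_cast; ring
  have a1 := abs_lt.1 (hk j (Finset.mem_range.2 (by omega)))
  have c1 := hu t ht (T * j / M) (hmem j hjM) (by
    rw [Real.dist_eq, abs_of_nonneg (by linarith)]; linarith)
  rw [Real.dist_eq, abs_lt] at c1
  have m1 := hmono hj1
  rcases Nat.lt_or_ge j M with hlt | hge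
  · have a2 := abs_lt.1 (hk (j + 1) (Finset.mem_range.2 (by omega)))
    have c2 := hu (T * (j + 1 : ℕ) / M) (hmem (j + 1) hlt) t ht (by
      rw [Real.dist_eq, abs_of_nonneg (by linarith)]; linarith)
    rw [Real.dist_eq, abs_lt] at c2
    have m2 := hmono hj2.le
    rw [abs_lt]; constructor <;> linarith
  -- There is no grid point to the right of `T`; in this case `t` is the grid point `T` itself.
  · have ejM : j = M := le_antisymm hjM hge
    have etT : T * (j : ℝ) / M = T := by rw [ejM]; field_simp
    have ett : t = T * j / M := le_antisymm (by rw [etT]; exact ht.2) hj1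
    rw [← ett] at a1
    rw [abs_lt]; constructor <;> linarith

end BSS

namespace BSS

/-! ### A law of large numbers for Gaussian arrays with a finite range of dependence -/

section

variable {Ω : Type*} {mΩ : MeasurableSpace Ω} {μ : Measure Ω} [IsProbabilityMeasure μ]

/-- Nonnegativity of the variance of `X - Y` bounds twice the covariance by the sum of the
variances. -/
theorem covariance_le_of_variance_le {X Y : Ω → ℝ} (hX : MemLp X 2 μ) (hY : MemLp Y 2 μ) {C : ℝ}
    (hXC : Var[X; μ] ≤ C) (hYC : Var[Y; μ] ≤ C) : cov[X, Y; μ] ≤ C := by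
  have h := variance_sub hX hY
  have h0 := variance_nonneg (X - Y) μ
  linarith

/-- Variance bound for sums of variables that are independent at distance at least `L`. -/
theorem variance_sum_le_of_indepFun {X : ℕ → Ω → ℝ} (s : Finset ℕ) (L : ℕ) {C : ℝ}
    (hX : ∀ i, MemLp (X i) 2 μ) (hC : ∀ i, Var[X i; μ] ≤ C)
    (hind : ∀ i j, i + L ≤ j → IndepFun (X i) (X j) μ) :
    Var[∑ i ∈ s, X i; μ] ≤ s.card * ((2 * L + 1) * C) := by
  have hC0 : 0 ≤ C := (variance_nonneg (X 0) μ).trans (hC 0)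
  rw [variance_sum' fun i _ => hX i, ← nsmul_eq_mul]
  refine Finset.sum_le_card_nsmul _ _ _ fun i _ => ?_
  calc ∑ j ∈ s, cov[X i, X j; μ]
      ≤ ∑ j ∈ s, if j ∈ Finset.Icc (i - L) (i + L) then C else 0 := by
        refine Finset.sum_le_sum fun j _ => ?_
        split_ifs with h
        · exact covariance_le_of_variance_le (hX i) (hX j) (hC i) (hC j)
        · rw [Finset.mem_Icc, not_and_or] at h
          rcases h with h | h
          · rw [covariance_comm, (hind j i (by omega)).covariance_eq_zero (hX j) (hX i)]
          · rw [(hind i j (by omega)).covariance_eq_zero (hX i) (hX j)]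
    _ = ∑ j ∈ s.filter (· ∈ Finset.Icc (i - L) (i + L)), C := by rw [Finset.sum_filter]
    _ ≤ ∑ j ∈ Finset.Icc (i - L) (i + L), C := by
        refine Finset.sum_le_sum_of_subset_of_nonneg (fun j hj => ?_) fun _ _ _ => hC0
        exact (Finset.mem_filter.1 hj).2
    _ ≤ (2 * L + 1) * C := by
        rw [Finset.sum_const, nsmul_eq_mul, Nat.card_Icc]
        refine mul_le_mul_of_nonneg_right ?_ hC0
        have : i + L + 1 - (i - L) ≤ 2 * L + 1 := by omega
        exact_mod_cast this

/-- The absolute moment of order `q` of the standard Gaussian distribution. -/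
noncomputable def absMoment (q : ℝ) : ℝ := ∫ x, |x| ^ q ∂(gaussianReal 0 1)

theorem memLp_abs_rpow_gaussianReal {p : ℝ} (hp : 0 < p) (v : NNReal) :
    MemLp (fun x : ℝ => |x| ^ p) 2 (gaussianReal 0 v) := by
  have h := memLp_id_gaussianReal (μ := 0) (v := v) (2 * p).toNNReal
  have h2 := h.norm_rpow_div (ENNReal.ofReal p)
  simp only [ENNReal.toReal_ofReal hp.le, id, Real.norm_eq_abs] at h2
  convert h2
  change (2 : ℝ≥0∞) = ENNReal.ofReal (2 * p) / ENNReal.ofReal p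
  rw [← ENNReal.ofReal_div_of_pos hp, mul_div_cancel_right₀ _ hp.ne']
  simp

theorem absMoment_pos {p : ℝ} (hp : 0 < p) : 0 < absMoment p := by
  have hint : Integrable (fun x : ℝ => |x| ^ p) (gaussianReal 0 1) :=
    (memLp_abs_rpow_gaussianReal hp 1).integrable (by norm_num)
  refine (integral_pos_iff_support_of_nonneg (fun x => by positivity) hint).2 ?_
  have hs : Function.support (fun x : ℝ => |x| ^ p) = {0}ᶜ := by
    ext x
    simp only [Function.mem_support, mem_compl_iff, mem_singleton_iff, ne_eq]
    rw [Real.rpow_eq_zero (abs_nonneg x) hp.ne', abs_eq_zero]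
  rw [hs, pos_iff_ne_zero]
  have := nullSingletonClass_gaussianReal (μ := 0) (v := 1) one_ne_zero
  rw [measure_compl (measurableSet_singleton _) (measure_ne_top _ _)]
  simp

theorem integral_abs_rpow_gaussianReal (p : ℝ) (v : NNReal) :
    ∫ x, |x| ^ p ∂(gaussianReal 0 v) = (Real.sqrt v) ^ p * absMoment p := by
  have h := gaussianReal_map_const_mul (μ := 0) (v := 1) (Real.sqrt v)
  have hv : NNReal.mk (Real.sqrt v ^ 2) (sq_nonneg _) * 1 = v := by
    ext; simp
  rw [mul_zero, hv] at h
  rw [← h, integral_map (by fun_prop)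
    (by fun_prop : Measurable fun x : ℝ => |x| ^ p).aestronglyMeasurable, absMoment, ← integral_const_mul]
  congr 1 with x
  rw [abs_mul, abs_of_nonneg (Real.sqrt_nonneg _), Real.mul_rpow (Real.sqrt_nonneg _) (abs_nonneg _)]

/-- About `t/δ` summands have a dependence range of about `ε/δ` indices, so the variance of `δ`
times their sum is O(ε + δ). Chebyshev's inequality and convergence of the means conclude. -/
theorem tendsto_gaussian_power_sum {Z : ℕ → ℕ → Ω → ℝ} {ρ : ℕ → NNReal}
    (hρ : Tendsto ρ atTop (𝓝 1)) (hZ : ∀ k i, AEMeasurable (Z k i) μ)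
    (hlaw : ∀ k i, μ.map (Z k i) = gaussianReal 0 (ρ k)) {δ ε : ℕ → ℝ} (hδ : ∀ k, 0 < δ k)
    (hδ0 : Tendsto δ atTop (𝓝 0)) (hε : ∀ k, 0 ≤ ε k) (hε0 : Tendsto ε atTop (𝓝 0))
    (hind : ∀ k i j : ℕ, i * δ k + ε k ≤ j * δ k → IndepFun (Z k i) (Z k j) μ)
    {p : ℝ} (hp : 0 < p) (m : ℕ) {t : ℝ} (ht : 0 ≤ t) (e : ℝ≥0∞) (he : 0 < e) :
    Tendsto (fun k => μ {ω | e ≤ ENNReal.ofReal |δ k *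
      ∑ i ∈ Finset.Icc m ⌊t / δ k⌋₊, |Z k i ω| ^ p - absMoment p * t|}) atTop (𝓝 0) := by
  set X : ℕ → ℕ → Ω → ℝ := fun k i ω => |Z k i ω| ^ p with hXdef
  set s : ℕ → Finset ℕ := fun k => Finset.Icc m ⌊t / δ k⌋₊ with hs
  have hXmem (k i) : MemLp (X k i) 2 μ := by
    have h := memLp_abs_rpow_gaussianReal hp (ρ k)
    rw [← hlaw k i] at h
    exact h.comp_of_map (hZ k i)
  have hmean (q : ℝ) (k i) : ∫ ω, |Z k i ω| ^ q ∂μ = (Real.sqrt (ρ k)) ^ q * absMoment q := by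
    rw [← integral_abs_rpow_gaussianReal, ← hlaw k i,
      integral_map (hZ k i) (by fun_prop : Measurable fun x : ℝ => |x| ^ q).aestronglyMeasurable]
  have hvar (k i) : Var[X k i; μ] ≤ (Real.sqrt (ρ k)) ^ (2 * p) * absMoment (2 * p) := by
    rw [← hmean (2 * p) k i]
    refine (variance_le_expectation_sq (hXmem k i).1).trans (le_of_eq ?_)
    congr 1 with ω
    rw [Pi.pow_apply, hXdef, ← Real.rpow_natCast, ← Real.rpow_mul (abs_nonneg _)]
    norm_num [mul_comm]
  have hsqrt : Tendsto (fun k => Real.sqrt (ρ k)) atTop (𝓝 1) := by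
    have h : Tendsto (fun k => (ρ k : ℝ)) atTop (𝓝 ((1 : NNReal) : ℝ)) :=
      (NNReal.continuous_coe.tendsto _).comp hρ
    simpa using h.sqrt
  have hpow (q : ℝ) : Tendsto (fun k => (Real.sqrt (ρ k)) ^ q) atTop (𝓝 1) := by
    simpa using hsqrt.rpow_const (Or.inl one_ne_zero) (p := q)
  have hcard : Tendsto (fun k => δ k * ((s k).card : ℝ)) atTop (𝓝 t) := by
    have h1 := tendsto_mul_floor_div hδ hδ0 ht
    have h2 : Tendsto (fun k => δ k * ((m : ℝ) + 1)) atTop (𝓝 0) := by simpa using hδ0.mul_const _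
    refine tendsto_of_tendsto_of_tendsto_of_le_of_le (g := fun k => δ k * (⌊t / δ k⌋₊ : ℝ) - δ k * (m + 1))
      (h := fun k => δ k * (⌊t / δ k⌋₊ : ℝ) + δ k * (m + 1)) (by simpa using h1.sub h2)
      (by simpa using h1.add h2) (fun k => ?_) fun k => ?_
    · simp only [hs, Nat.card_Icc, ← mul_sub]
      refine mul_le_mul_of_nonneg_left ?_ (hδ k).le
      have : ⌊t / δ k⌋₊ ≤ (⌊t / δ k⌋₊ + 1 - m) + (m + 1) := by omega
      have : (⌊t / δ k⌋₊ : ℝ) ≤ (⌊t / δ k⌋₊ + 1 - m : ℕ) + (m + 1) := by exact_mod_cast this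
      linarith
    · simp only [hs, Nat.card_Icc, ← mul_add]
      refine mul_le_mul_of_nonneg_left ?_ (hδ k).le
      have : ⌊t / δ k⌋₊ + 1 - m ≤ ⌊t / δ k⌋₊ + (m + 1) := by omega
      exact_mod_cast this
  set L : ℕ → ℕ := fun k => ⌈ε k / δ k⌉₊ with hL
  have hLle (k) : ε k ≤ L k * δ k := by
    rw [← div_le_iff₀ (hδ k)]; exact Nat.le_ceil _
  have hL0 : Tendsto (fun k => δ k * (2 * L k + 1)) atTop (𝓝 0) := by
    have hu : Tendsto (fun k => 2 * ε k + 3 * δ k) atTop (𝓝 0) := by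
      simpa using (hε0.const_mul 2).add (hδ0.const_mul 3)
    refine squeeze_zero (fun k => mul_nonneg (hδ k).le (by positivity)) (fun k => ?_) hu
    have h1 : (L k : ℝ) < ε k / δ k + 1 := Nat.ceil_lt_add_one (div_nonneg (hε k) (hδ k).le)
    have h2 := mul_lt_mul_of_pos_left h1 (hδ k)
    rw [mul_add, mul_div_cancel₀ _ (hδ k).ne'] at h2
    linarith
  have hV (k) : Var[fun ω => δ k * ∑ i ∈ s k, X k i ω; μ] ≤
      (δ k * (s k).card) * (δ k * (2 * L k + 1)) *
        ((Real.sqrt (ρ k)) ^ (2 * p) * absMoment (2 * p)) := by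
    have h := variance_sum_le_of_indepFun (s k) (L k) (hXmem k) (hvar k) fun i j hij => by
      refine (hind k i j ?_).comp (φ := fun x => |x| ^ p) (ψ := fun x => |x| ^ p)
        (by fun_prop) (by fun_prop)
      have : (i : ℝ) + L k ≤ j := by exact_mod_cast hij
      have := mul_le_mul_of_nonneg_right this (hδ k).le
      linarith [hLle k]
    rw [variance_const_mul]
    have e1 : (fun ω => ∑ i ∈ s k, X k i ω) = ∑ i ∈ s k, X k i := by
      ext ω; rw [Finset.sum_apply]
    rw [e1]
    refine (mul_le_mul_of_nonneg_left h (sq_nonneg _)).trans (le_of_eq ?_)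
    ring
  have hV0 : Tendsto (fun k => (δ k * (s k).card) * (δ k * (2 * L k + 1)) *
        ((Real.sqrt (ρ k)) ^ (2 * p) * absMoment (2 * p))) atTop (𝓝 0) := by
    simpa using (hcard.mul hL0).mul ((hpow (2 * p)).mul_const (absMoment (2 * p)))
  have hsum_mem (k) : MemLp (fun ω => δ k * ∑ i ∈ s k, X k i ω) 2 μ :=
    (memLp_finsetSum _ fun i _ => hXmem k i).const_mul _
  have hE (k) : ∫ ω, δ k * ∑ i ∈ s k, X k i ω ∂μ =
      (δ k * (s k).card) * ((Real.sqrt (ρ k)) ^ p * absMoment p) := by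
    rw [integral_const_mul, integral_finsetSum _ fun i _ => (hXmem k i).integrable (by norm_num)]
    simp only [hXdef, hmean p k, Finset.sum_const, nsmul_eq_mul]
    ring
  have hE0 : Tendsto (fun k => ∫ ω, δ k * ∑ i ∈ s k, X k i ω ∂μ) atTop (𝓝 (absMoment p * t)) := by
    simp_rw [hE]
    have := hcard.mul ((hpow p).mul_const (absMoment p))
    simpa [mul_comm] using this
  obtain ⟨r, hr, hre⟩ : ∃ r : ℝ, 0 < r ∧ ENNReal.ofReal r ≤ e := by
    rcases eq_or_ne e ∞ with rfl | he'
    · exact ⟨1, one_pos, le_top⟩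
    · exact ⟨e.toReal, ENNReal.toReal_pos he.ne' he', ENNReal.ofReal_toReal_le⟩
  have hlim : Tendsto (fun k => ENNReal.ofReal ((δ k * (s k).card) * (δ k * (2 * L k + 1)) *
      ((Real.sqrt (ρ k)) ^ (2 * p) * absMoment (2 * p)) / (r / 2) ^ 2)) atTop (𝓝 0) := by
    have := ENNReal.tendsto_ofReal (hV0.div_const ((r / 2) ^ 2))
    simpa using this
  refine tendsto_of_tendsto_of_tendsto_of_le_of_le' tendsto_const_nhds hlim
    (Eventually.of_forall fun _ => zero_le) ?_
  have hclose : ∀ᶠ k in atTop, |∫ ω, δ k * ∑ i ∈ s k, X k i ω ∂μ - absMoment p * t| < r / 2 := by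
    have := (Metric.tendsto_nhds.1 hE0) (r / 2) (by positivity)
    simpa [Real.dist_eq] using this
  filter_upwards [hclose] with k hk
  calc _ ≤ μ {ω | r / 2 ≤ |δ k * ∑ i ∈ s k, X k i ω - ∫ ω, δ k * ∑ i ∈ s k, X k i ω ∂μ|} := by
        refine measure_mono fun ω hω => ?_
        have h1 : r ≤ |δ k * ∑ i ∈ s k, X k i ω - absMoment p * t| :=
          (ENNReal.ofReal_le_ofReal_iff (abs_nonneg _)).1 (hre.trans hω)
        have h2 := abs_sub_le (δ k * ∑ i ∈ s k, X k i ω) (∫ ω, δ k * ∑ i ∈ s k, X k i ω ∂μ)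
          (absMoment p * t)
        show r / 2 ≤ _
        linarith
    _ ≤ ENNReal.ofReal (Var[fun ω => δ k * ∑ i ∈ s k, X k i ω; μ] / (r / 2) ^ 2) :=
        meas_ge_le_variance_div_sq (hsum_mem k) (by positivity)
    _ ≤ _ := by gcongr; exact hV k

end

/-! ### Negligibility of sums of small stochastic integrals -/

section

variable {Ω : Type*} {mΩ : MeasurableSpace Ω} {μ : Measure Ω} [IsProbabilityMeasure μ]

/-- Where `V ≤ κ` the moment bound is of order `κ^(p/2)`. Where `κ < V ≤ C`, use `x ≤ ηx² + 1/η`: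
the square is a `2p`-th moment multiplied by a small `η`, and `1/η` is multiplied by the proportion
of indices with `V > κ`, which vanishes in mean. The order of choice is `κ`, `η`, then `k`. -/
theorem tendsto_lintegral_truncated_sum {Y : ℕ → ℕ → Ω → ℝ} {V : ℕ → ℕ → Ω → ℝ≥0∞}
    (hY : ∀ k i, AEMeasurable (Y k i) μ) (hV : ∀ k i, Measurable (V k i))
    (hmom : ∀ (k i : ℕ) (c q : ℝ), 0 < c → 0 ≤ q → ∫⁻ ω in {ω | V k i ω ≤ ENNReal.ofReal c},
      ENNReal.ofReal (|Y k i ω| ^ q) ∂μ ≤ ENNReal.ofReal (momentConst q * c ^ (q / 2)))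
    {I : ℕ → Finset ℕ} {δ : ℕ → ℝ} {C₀ : ℝ} (hI : ∀ k, δ k * (I k).card ≤ C₀)
    (hsum : ∀ᵐ ω ∂μ, Tendsto (fun k => ∑ i ∈ I k, ENNReal.ofReal (δ k) * V k i ω) atTop (𝓝 0))
    {p : ℝ} (hp : 0 < p) {C : ℝ} (hC : 0 < C) :
    Tendsto (fun k => ∫⁻ ω, ∑ i ∈ I k, ENNReal.ofReal (δ k) *
      {ω | V k i ω ≤ ENNReal.ofReal C}.indicator (fun ω => ENNReal.ofReal (|Y k i ω| ^ p)) ω ∂μ)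
      atTop (𝓝 0) := by
  have hIe (k) : ∑ i ∈ I k, ENNReal.ofReal (δ k) ≤ ENNReal.ofReal C₀ := by
    rw [Finset.sum_const, nsmul_eq_mul, ← ENNReal.ofReal_natCast, mul_comm,
      ← ENNReal.ofReal_mul' (by positivity)]
    exact ENNReal.ofReal_le_ofReal (hI k)
  have hset (k i) (c : ℝ) : MeasurableSet {ω | V k i ω ≤ ENNReal.ofReal c} :=
    measurableSet_le (hV k i) measurable_const
  have hYm (k i) (q : ℝ) : AEMeasurable (fun ω => ENNReal.ofReal (|Y k i ω| ^ q)) μ :=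
    ((by fun_prop : Measurable fun x : ℝ => ENNReal.ofReal (|x| ^ q))).comp_aemeasurable (hY k i)
  have hpt (x : ℝ) (hx : 0 ≤ x) (η : ℝ) (hη : 0 < η) : x ≤ η * x ^ 2 + 1 / η := by
    have h : 0 ≤ (η * x - 1) ^ 2 + η * x := by positivity
    have : η * x ^ 2 + 1 / η - x = ((η * x - 1) ^ 2 + η * x) / η := by field_simp; ring
    have h2 : 0 ≤ ((η * x - 1) ^ 2 + η * x) / η := by positivity
    linarith
  rw [ENNReal.tendsto_nhds_zero]
  intro e he
  have he3 : 0 < e / 3 := ENNReal.div_pos he.ne' (by norm_num)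
  obtain ⟨κ, hκ0, hκ⟩ : ∃ κ : ℝ, 0 < κ ∧
      ENNReal.ofReal C₀ * ENNReal.ofReal (momentConst p * κ ^ (p / 2)) ≤ e / 3 := by
    have h1 : Tendsto (fun κ : ℝ => momentConst p * κ ^ (p / 2)) (𝓝[>] 0) (𝓝 0) := by
      have h := (Real.continuousAt_rpow_const 0 (p / 2) (Or.inr (by positivity))).tendsto
      rw [Real.zero_rpow (by positivity)] at h
      simpa using (h.mono_left nhdsWithin_le_nhds).const_mul (momentConst p)
    have h2 : Tendsto (fun κ : ℝ => ENNReal.ofReal C₀ *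
        ENNReal.ofReal (momentConst p * κ ^ (p / 2))) (𝓝[>] 0) (𝓝 0) := by
      simpa using ENNReal.Tendsto.const_mul (ENNReal.tendsto_ofReal h1)
        (Or.inr ENNReal.ofReal_ne_top)
    obtain ⟨κ, h, h'⟩ := (((ENNReal.tendsto_nhds_zero.1 h2) _ he3).and self_mem_nhdsWithin).exists
    exact ⟨κ, h', h⟩
  obtain ⟨η, hη0, hη⟩ : ∃ η : ℝ, 0 < η ∧ ENNReal.ofReal C₀ *
      (ENNReal.ofReal η * ENNReal.ofReal (momentConst (2 * p) * C ^ (2 * p / 2))) ≤ e / 3 := by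
    have h1 : Tendsto (fun η : ℝ => ENNReal.ofReal η) (𝓝[>] 0) (𝓝 0) := by
      simpa using (ENNReal.tendsto_ofReal (tendsto_id (x := 𝓝 (0 : ℝ)))).mono_left
        nhdsWithin_le_nhds
    have h2 : Tendsto (fun η : ℝ => ENNReal.ofReal C₀ * (ENNReal.ofReal η *
        ENNReal.ofReal (momentConst (2 * p) * C ^ (2 * p / 2)))) (𝓝[>] 0) (𝓝 0) := by
      simpa using ENNReal.Tendsto.const_mul (ENNReal.Tendsto.mul_const h1
        (Or.inr ENNReal.ofReal_ne_top)) (Or.inr ENNReal.ofReal_ne_top)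
    obtain ⟨η, h, h'⟩ := (((ENNReal.tendsto_nhds_zero.1 h2) _ he3).and self_mem_nhdsWithin).exists
    exact ⟨η, h', h⟩
  set B : ℕ → ℕ → Set Ω := fun k i => {ω | V k i ω ≤ ENNReal.ofReal κ}ᶜ with hB
  have hBm (k i) : MeasurableSet (B k i) := (hset k i κ).compl
  set J : ℕ → Ω → ℝ≥0∞ := fun k ω =>
    ∑ i ∈ I k, ENNReal.ofReal (δ k) * (B k i).indicator (fun _ => 1) ω with hJ
  have hJm (k) : Measurable (J k) := Finset.measurable_fun_sum _ fun i _ =>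
    (measurable_const.indicator (hBm k i)).const_mul _
  -- The indicator of `V > κ` is at most `V/κ`, so the proportion tends to zero almost surely; it is
  -- bounded by `C₀`, hence also in mean.
  have hJ0 : Tendsto (fun k => ∫⁻ ω, ENNReal.ofReal (1 / η) * J k ω ∂μ) atTop (𝓝 0) := by
    have h := tendsto_lintegral_of_dominated_convergence (μ := μ) (F := J) (f := fun _ => 0)
      (fun _ => ENNReal.ofReal C₀) hJm (fun k => Eventually.of_forall fun ω => by
        refine le_trans (Finset.sum_le_sum fun i _ => ?_) (hIe k)
        exact mul_le_of_le_one_right zero_le (indicator_le_self' (fun _ _ => zero_le) _ |>.trans le_rfl))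
      (by simp) (by
        filter_upwards [hsum] with ω hω
        have h1 : Tendsto (fun k => ENNReal.ofReal κ⁻¹ * ∑ i ∈ I k, ENNReal.ofReal (δ k) * V k i ω)
            atTop (𝓝 0) := by
          simpa using ENNReal.Tendsto.const_mul hω (Or.inr ENNReal.ofReal_ne_top)
        refine tendsto_of_tendsto_of_tendsto_of_le_of_le tendsto_const_nhds h1
          (fun _ => zero_le) fun k => ?_
        simp only [hJ, Finset.mul_sum]
        refine Finset.sum_le_sum fun i _ => ?_
        rw [mul_left_comm]
        gcongr
        by_cases hb : ω ∈ B k i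
        · rw [indicator_of_mem hb]
          have hb' : ENNReal.ofReal κ ≤ V k i ω := le_of_not_ge hb
          calc (1 : ℝ≥0∞) = ENNReal.ofReal κ⁻¹ * ENNReal.ofReal κ := by
                rw [← ENNReal.ofReal_mul (by positivity), inv_mul_cancel₀ hκ0.ne',
                  ENNReal.ofReal_one]
            _ ≤ _ := by gcongr
        · rw [indicator_of_notMem hb]; exact zero_le)
    simp only [lintegral_zero] at h
    simp_rw [lintegral_const_mul _ (hJm _)]
    simpa using ENNReal.Tendsto.const_mul h (Or.inr ENNReal.ofReal_ne_top)
  filter_upwards [(ENNReal.tendsto_nhds_zero.1 hJ0) _ he3] with k hk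
  have hbound (i : ℕ) (ω : Ω) : {ω | V k i ω ≤ ENNReal.ofReal C}.indicator
      (fun ω => ENNReal.ofReal (|Y k i ω| ^ p)) ω ≤
      ({ω | V k i ω ≤ ENNReal.ofReal κ}.indicator (fun ω => ENNReal.ofReal (|Y k i ω| ^ p)) ω +
      ENNReal.ofReal η * {ω | V k i ω ≤ ENNReal.ofReal C}.indicator
        (fun ω => ENNReal.ofReal (|Y k i ω| ^ (2 * p))) ω) +
      ENNReal.ofReal (1 / η) * (B k i).indicator (fun _ => 1) ω := by
    by_cases h1 : V k i ω ≤ ENNReal.ofReal C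
    · rw [indicator_of_mem (s := {ω | V k i ω ≤ ENNReal.ofReal C}) h1,
        indicator_of_mem (s := {ω | V k i ω ≤ ENNReal.ofReal C}) h1]
      by_cases h2 : V k i ω ≤ ENNReal.ofReal κ
      · rw [indicator_of_mem (s := {ω | V k i ω ≤ ENNReal.ofReal κ}) h2, add_assoc]
        exact le_self_add
      · rw [indicator_of_mem (s := B k i) h2, mul_one, ← ENNReal.ofReal_mul hη0.le, add_assoc,
          ← ENNReal.ofReal_add (by positivity) (by positivity)]
        refine le_trans (ENNReal.ofReal_le_ofReal ?_) le_add_self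
        refine (hpt _ (by positivity) η hη0).trans (le_of_eq ?_)
        rw [← Real.rpow_natCast, ← Real.rpow_mul (abs_nonneg _)]
        norm_num [mul_comm]
    · rw [indicator_of_notMem (s := {ω | V k i ω ≤ ENNReal.ofReal C}) h1]; exact zero_le
  calc _ ≤ ∫⁻ ω, (∑ i ∈ I k, ENNReal.ofReal (δ k) *
        ({ω | V k i ω ≤ ENNReal.ofReal κ}.indicator (fun ω => ENNReal.ofReal (|Y k i ω| ^ p)) ω +
        ENNReal.ofReal η * {ω | V k i ω ≤ ENNReal.ofReal C}.indicator
          (fun ω => ENNReal.ofReal (|Y k i ω| ^ (2 * p))) ω)) +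
        ENNReal.ofReal (1 / η) * J k ω ∂μ := by
        refine lintegral_mono fun ω => ?_
        simp only [hJ]
        rw [Finset.mul_sum, ← Finset.sum_add_distrib]
        refine Finset.sum_le_sum fun i _ => ?_
        rw [mul_left_comm, ← mul_add]
        gcongr
        exact hbound i ω
    _ = ∑ i ∈ I k, ENNReal.ofReal (δ k) *
        (∫⁻ ω in {ω | V k i ω ≤ ENNReal.ofReal κ}, ENNReal.ofReal (|Y k i ω| ^ p) ∂μ +
        ENNReal.ofReal η * ∫⁻ ω in {ω | V k i ω ≤ ENNReal.ofReal C},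
          ENNReal.ofReal (|Y k i ω| ^ (2 * p)) ∂μ) + ∫⁻ ω, ENNReal.ofReal (1 / η) * J k ω ∂μ := by
        have ha (i) (c q : ℝ) : AEMeasurable ({ω | V k i ω ≤ ENNReal.ofReal c}.indicator
            fun ω => ENNReal.ofReal (|Y k i ω| ^ q)) μ := (hYm k i q).indicator (hset k i c)
        have hb (i) : AEMeasurable (fun ω =>
            {ω | V k i ω ≤ ENNReal.ofReal κ}.indicator (fun ω => ENNReal.ofReal (|Y k i ω| ^ p)) ω +
            ENNReal.ofReal η * {ω | V k i ω ≤ ENNReal.ofReal C}.indicator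
              (fun ω => ENNReal.ofReal (|Y k i ω| ^ (2 * p))) ω) μ :=
          (ha i κ p).add ((ha i C (2 * p)).const_mul _)
        rw [lintegral_add_right _ ((hJm k).const_mul _),
          lintegral_finsetSum' _ fun i _ => (hb i).const_mul _]
        congr 1
        refine Finset.sum_congr rfl fun i _ => ?_
        rw [lintegral_const_mul'' _ (hb i),
          lintegral_add_left' (ha i κ p), lintegral_const_mul'' _ (ha i C (2 * p)),
          lintegral_indicator (hset k i κ), lintegral_indicator (hset k i C)]
    _ ≤ ∑ i ∈ I k, ENNReal.ofReal (δ k) * (ENNReal.ofReal (momentConst p * κ ^ (p / 2)) +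
        ENNReal.ofReal η * ENNReal.ofReal (momentConst (2 * p) * C ^ (2 * p / 2))) + e / 3 := by
        gcongr with i _
        · exact hmom k i κ p hκ0 hp.le
        · exact hmom k i C (2 * p) hC (by positivity)
    _ ≤ e / 3 + e / 3 + e / 3 := by
        rw [← Finset.sum_mul, mul_add]
        gcongr
        · exact (mul_le_mul_left (hIe k) _).trans hκ
        · exact (mul_le_mul_left (hIe k) _).trans hη
    _ = e := ENNReal.add_thirds e

/-- Localization: the random bound on the quadratic errors makes the events `B C` exhaust the space
up to a null set. On `B C` the truncation is void, and Markov's inequality applies to the truncated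
sum. -/
theorem tendsto_measure_power_sum_of_sqNorm {Y : ℕ → ℕ → Ω → ℝ} {V : ℕ → ℕ → Ω → ℝ≥0∞}
    (hY : ∀ k i, AEMeasurable (Y k i) μ) (hV : ∀ k i, Measurable (V k i))
    (hmom : ∀ (k i : ℕ) (c q : ℝ), 0 < c → 0 ≤ q → ∫⁻ ω in {ω | V k i ω ≤ ENNReal.ofReal c},
      ENNReal.ofReal (|Y k i ω| ^ q) ∂μ ≤ ENNReal.ofReal (momentConst q * c ^ (q / 2)))
    {I : ℕ → Finset ℕ} {δ : ℕ → ℝ} (hδ : ∀ k, 0 < δ k) {C₀ : ℝ}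
    (hI : ∀ k, δ k * (I k).card ≤ C₀)
    (hbd : ∀ᵐ ω ∂μ, ∃ C : ℝ, ∀ k, ∀ i ∈ I k, V k i ω ≤ ENNReal.ofReal C)
    (hsum : ∀ᵐ ω ∂μ, Tendsto (fun k => ∑ i ∈ I k, ENNReal.ofReal (δ k) * V k i ω) atTop (𝓝 0))
    {p : ℝ} (hp : 0 < p) (e : ℝ≥0∞) (he : 0 < e) :
    Tendsto (fun k => μ {ω | e ≤ ENNReal.ofReal (δ k * ∑ i ∈ I k, |Y k i ω| ^ p)})
      atTop (𝓝 0) := by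
  set B : ℕ → Set Ω := fun C => {ω | ∀ k, ∀ i ∈ I k, V k i ω ≤ ENNReal.ofReal (C + 1 : ℝ)} with hB
  have hBm (C) : MeasurableSet (B C) := by
    simp only [hB, ofPred_forall]
    exact MeasurableSet.iInter fun k => MeasurableSet.iInter fun i => MeasurableSet.iInter fun _ =>
      measurableSet_le (hV k i) measurable_const
  have hBc : Tendsto (fun C => μ (B C)ᶜ) atTop (𝓝 0) := by
    have h := tendsto_measure_iInter_atTop (μ := μ) (s := fun C => (B C)ᶜ)
      (fun C => (hBm C).compl.nullMeasurableSet)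
      (fun C C' hCC => compl_subset_compl.2 fun ω hω k i hi => (hω k i hi).trans
        (ENNReal.ofReal_le_ofReal (by have : (C : ℝ) ≤ C' := by exact_mod_cast hCC
                                      linarith))) ⟨0, measure_ne_top _ _⟩
    have h0 : μ (⋂ C, (B C)ᶜ) = 0 := by
      refine measure_mono_null (fun ω hω => ?_) hbd
      rintro ⟨C, hC⟩
      refine mem_iInter.1 hω ⌈C⌉₊ fun k i hi => (hC k i hi).trans (ENNReal.ofReal_le_ofReal ?_)
      linarith [Nat.le_ceil C]
    rwa [h0] at h
  rw [ENNReal.tendsto_nhds_zero]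
  intro r hr
  have hr2 : 0 < r / 2 := ENNReal.half_pos hr.ne'
  obtain ⟨C, hC⟩ := ((ENNReal.tendsto_nhds_zero.1 hBc) _ hr2).exists
  set S : ℕ → Ω → ℝ≥0∞ := fun k ω => ∑ i ∈ I k, ENNReal.ofReal (δ k) *
    {ω | V k i ω ≤ ENNReal.ofReal (C + 1 : ℝ)}.indicator
      (fun ω => ENNReal.ofReal (|Y k i ω| ^ p)) ω with hS
  have hSm (k) : AEMeasurable (S k) μ := Finset.aemeasurable_fun_sum _ fun i _ =>
    ((((by fun_prop : Measurable fun x : ℝ => ENNReal.ofReal (|x| ^ p))).comp_aemeasurable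
      (hY k i)).indicator (measurableSet_le (hV k i) measurable_const)).const_mul _
  have hS0 := tendsto_lintegral_truncated_sum hY hV hmom hI hsum hp
    (C := (C : ℝ) + 1) (by positivity)
  have hSe : Tendsto (fun k => μ {ω | e ≤ S k ω}) atTop (𝓝 0) := by
    rcases eq_or_ne e ∞ with rfl | he'
    · refine tendsto_of_tendsto_of_tendsto_of_le_of_le tendsto_const_nhds hS0
        (fun _ => zero_le) fun k => ?_
      have := mul_meas_ge_le_lintegral₀ (hSm k) 1
      rw [one_mul] at this
      exact (measure_mono fun ω (hω : ∞ ≤ S k ω) => (le_top.trans hω : (1 : ℝ≥0∞) ≤ S k ω)).trans this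
    · have h : Tendsto (fun k => (∫⁻ ω, S k ω ∂μ) / e) atTop (𝓝 0) := by
        simpa using ENNReal.Tendsto.div_const hS0 (Or.inr he.ne')
      exact tendsto_of_tendsto_of_tendsto_of_le_of_le tendsto_const_nhds h (fun _ => zero_le)
        fun k => meas_ge_le_lintegral_div (hSm k) he.ne' he'
  filter_upwards [(ENNReal.tendsto_nhds_zero.1 hSe) _ hr2] with k hk
  calc _ ≤ μ ((B C)ᶜ ∪ {ω | e ≤ S k ω}) := by
        refine measure_mono fun ω hω => ?_
        by_cases hb : ω ∈ B C
        · refine Or.inr ?_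
          show e ≤ S k ω
          refine le_trans (show e ≤ ENNReal.ofReal (δ k * ∑ i ∈ I k, |Y k i ω| ^ p) from hω)
            (le_of_eq ?_)
          rw [Finset.mul_sum, ENNReal.ofReal_sum_of_nonneg
            fun i _ => mul_nonneg (hδ k).le (by positivity)]
          refine Finset.sum_congr rfl fun i hi => ?_
          rw [indicator_of_mem (s := {ω | V k i ω ≤ ENNReal.ofReal (C + 1 : ℝ)}) (hb k i hi),
            ENNReal.ofReal_mul (hδ k).le]
        · exact Or.inl hb
    _ ≤ r / 2 + r / 2 := (measure_union_le _ _).trans (add_le_add hC hk)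
    _ = r := ENNReal.add_halves r

end

end BSS

namespace BSS

/-! ### Approximation of the increments -/

theorem mul_card_Icc_le {δ t : ℝ} (hδ : 0 < δ) (hδ1 : δ ≤ 1) (ht : 0 ≤ t) (m : ℕ) :
    δ * (Finset.Icc m ⌊t / δ⌋₊).card ≤ t + 1 := by
  have h1 : ((Finset.Icc m ⌊t / δ⌋₊).card : ℝ) ≤ ⌊t / δ⌋₊ + 1 := by
    rw [Nat.card_Icc]
    exact_mod_cast Nat.sub_le _ _
  have h2 := Nat.floor_le (div_nonneg ht hδ.le)
  rw [le_div_iff₀ hδ] at h2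
  nlinarith

theorem kern_of_nonpos (g : ℝ → ℝ) {d u : ℝ} (hd : 0 ≤ d) (hu : u ≤ 0) : kern g d u = 0 := by
  have h (x : ℝ) (hx : x ≤ 0) : weight g x = 0 := indicator_of_notMem (by simpa using hx) _
  rw [kern, h u hu, h (u - d) (by linarith), h (u - 2 * d) (by linarith)]
  ring

theorem sqNorm_indicator_add_compl (f : ℝ → ℝ) {A : Set ℝ} (hA : MeasurableSet A) :
    sqNorm (A.indicator f) + sqNorm (Aᶜ.indicator f) = sqNorm f := by
  have h (B : Set ℝ) (hB : MeasurableSet B) :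
      sqNorm (B.indicator f) = ∫⁻ s in B, ENNReal.ofReal (f s ^ 2) := by
    rw [← lintegral_indicator hB]
    refine lintegral_congr fun s => ?_
    by_cases hs : s ∈ B <;> simp [hs]
  rw [h A hA, h _ hA.compl, lintegral_add_compl _ hA]
  rfl

/-- The kernel vanishes for `s ≥ t`, so only times in `(t - ε, t)` matter. There the factor is at
most `D`, and the kernel divided by `τ` has unit norm. -/
theorem sqNorm_fluctuation_le {g f : ℝ → ℝ} {τ d t ε D : ℝ} (hd : 0 ≤ d) (hε : 0 ≤ ε)
    (hD : ∀ r ∈ Icc (t - ε) t, ∀ r' ∈ Icc (t - ε) t, |f r - f r'| ≤ D) (hτ : 0 < τ)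
    (hfin : sqNorm (kern g d) ≠ ∞) (hτ2 : τ ^ 2 = (sqNorm (kern g d)).toReal) :
    sqNorm (fun s => τ⁻¹ * (Ioi (t - ε)).indicator
      (fun s => kern g d (t - s) * (f s - f (t - ε))) s) ≤ ENNReal.ofReal (D ^ 2) := by
  have hD0 : 0 ≤ D := (abs_nonneg _).trans (hD t ⟨by linarith, le_rfl⟩ t ⟨by linarith, le_rfl⟩)
  calc _ ≤ sqNorm (fun s => (τ⁻¹ * D) * kern g d (t - s)) := by
        refine sqNorm_mono fun s => ?_
        by_cases hs : s ∈ Ioi (t - ε)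
        · rw [indicator_of_mem hs]
          rcases le_or_gt s t with hst | hst
          · rw [abs_mul, abs_mul, abs_mul, abs_mul, abs_of_nonneg hD0, mul_assoc, mul_comm D]
            have := hD s ⟨(mem_Ioi.1 hs).le, hst⟩ (t - ε) ⟨le_rfl, by linarith⟩
            gcongr
          · rw [kern_of_nonpos g hd (by linarith : t - s ≤ 0)]
            simp
        · rw [indicator_of_notMem hs, mul_zero, abs_zero]
          exact abs_nonneg _
    _ = ENNReal.ofReal (D ^ 2) := by
        rw [sqNorm_const_mul, sqNorm_sub_left, ← ENNReal.ofReal_toReal hfin, ← hτ2,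
          ← ENNReal.ofReal_mul (sq_nonneg _)]
        congr 1
        field_simp

/-- The error has three ranges. On `(t - ε, t]` only the fluctuation of `f` remains; between `-(a +
2)` and `t - ε`, `f` is bounded and the kernel tail is small; before `-(a + 2)` the kernel is at
most `d²` times the unit-step kernel at time zero. The constants come from applying `‖x + y‖² ≤
2‖x‖² + 2‖y‖²` twice. -/
theorem sqNorm_remainder_le {g f : ℝ → ℝ} (hg : ContDiffOn ℝ 2 g (Ioi 0)) (hf : Measurable f)
    {a : ℝ} (ha : 0 < a) (hanti : AntitoneOn (fun x => |iteratedDeriv 2 g x|) (Ioi a))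
    {τ d t ε η K : ℝ} (hd : 0 < d) (ht : 2 * d ≤ t) (hε : 0 ≤ ε) (hη : 0 ≤ η) (hτ : 0 < τ)
    (hK : ∀ s ∈ Icc (-(a + 2)) t, |f s| ≤ K)
    (htail : sqNorm ((Ici ε).indicator (kern g d)) ≤ ENNReal.ofReal (η * τ ^ 2))
    (hd4 : d ^ 4 ≤ η * τ ^ 2) (hQ : sqNorm (fun s => kern g 1 (0 - s) * f s) ≠ ∞) :
    sqNorm (fun s => τ⁻¹ * (kern g d (t - s) * f s) +
      (-1) * (τ⁻¹ * f (t - ε) * (Ioi (t - ε)).indicator (fun s => kern g d (t - s) * 1) s)) ≤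
    2 * sqNorm (fun s => τ⁻¹ * (Ioi (t - ε)).indicator
      (fun s => kern g d (t - s) * (f s - f (t - ε))) s) +
    ENNReal.ofReal (4 * (K ^ 2 + (sqNorm fun s => kern g 1 (0 - s) * f s).toReal) * η) := by
  set Q := (sqNorm fun s => kern g 1 (0 - s) * f s).toReal with hQdef
  have hK0 : 0 ≤ K := (abs_nonneg _).trans (hK t ⟨by linarith, le_rfl⟩)
  have hkm : Measurable (kern g d) := measurable_kern hg.continuousOn d
  have hks : Measurable fun s => kern g d (t - s) := hkm.comp (measurable_const.sub measurable_id)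
  set A : ℝ → ℝ := fun s => τ⁻¹ * (Ioi (t - ε)).indicator
      (fun s => kern g d (t - s) * (f s - f (t - ε))) s with hA
  have hAm : Measurable A :=
    ((hks.mul (hf.sub measurable_const)).indicator measurableSet_Ioi).const_mul _
  set B : ℝ → ℝ := fun s => (τ⁻¹ * K) * |(Ici ε).indicator (kern g d) (t - s)| with hB
  have hBm : Measurable B := by
    have : Measurable fun s => (Ici ε).indicator (kern g d) (t - s) :=
      (hkm.indicator measurableSet_Ici).comp (measurable_const.sub measurable_id)
    exact (this.abs).const_mul _
  set C : ℝ → ℝ := fun s => (τ⁻¹ * d ^ 2) * |kern g 1 (0 - s) * f s| with hC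
  have habs (h : ℝ → ℝ) : sqNorm (fun s => |h s|) = sqNorm h :=
    le_antisymm (sqNorm_mono fun s => (abs_abs _).le) (sqNorm_mono fun s => (abs_abs _).ge)
  have hBle : sqNorm B ≤ ENNReal.ofReal (K ^ 2 * η) := by
    rw [hB, sqNorm_const_mul, habs,
      sqNorm_sub_left (fun u => (Ici ε).indicator (kern g d) u) t]
    refine (mul_le_mul_right htail _).trans ?_
    rw [← ENNReal.ofReal_mul (sq_nonneg _)]
    refine ENNReal.ofReal_le_ofReal (le_of_eq ?_)
    field_simp
  have hCle : sqNorm C ≤ ENNReal.ofReal (Q * η) := by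
    rw [hC, sqNorm_const_mul, habs, ← ENNReal.ofReal_toReal hQ, ← hQdef,
      ← ENNReal.ofReal_mul (sq_nonneg _)]
    refine ENNReal.ofReal_le_ofReal ?_
    rw [mul_comm]
    refine mul_le_mul_of_nonneg_left ?_ ENNReal.toReal_nonneg
    calc (τ⁻¹ * d ^ 2) ^ 2 = (τ ^ 2)⁻¹ * d ^ 4 := by rw [mul_pow, inv_pow]; ring
      _ ≤ (τ ^ 2)⁻¹ * (η * τ ^ 2) := by gcongr
      _ = η := by field_simp
  set R : ℝ → ℝ := fun s => τ⁻¹ * (Iic (t - ε)).indicator (fun s => kern g d (t - s) * f s) s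
    with hR
  have hRle : sqNorm R ≤ 2 * sqNorm B + 2 * sqNorm C := by
    refine le_trans (sqNorm_mono fun s => ?_) (sqNorm_add_le hBm)
    have hB0 : 0 ≤ B s := by positivity
    have hC0 : 0 ≤ C s := by positivity
    rw [abs_of_nonneg (add_nonneg hB0 hC0)]
    by_cases hs : s ∈ Iic (t - ε)
    · have hs' : s ≤ t - ε := hs
      simp only [hR, indicator_of_mem hs, abs_mul, abs_inv, abs_of_pos hτ]
      rcases le_or_gt (-(a + 2)) s with h | h
      · refine le_trans ?_ (le_add_of_nonneg_right hC0)
        simp only [hB]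
        rw [indicator_of_mem (mem_Ici.2 (by linarith : ε ≤ t - s)), mul_assoc, mul_comm K]
        have := hK s ⟨h, by linarith⟩
        gcongr
      · refine le_trans ?_ (le_add_of_nonneg_left hB0)
        simp only [hC]
        rw [abs_mul, mul_assoc, ← mul_assoc (d ^ 2)]
        have := abs_kern_le_kern_one hg ha hanti hd ht h
        gcongr
    · simp only [hR, indicator_of_notMem hs, mul_zero, abs_zero]
      positivity
  have hsplit : (fun s => τ⁻¹ * (kern g d (t - s) * f s) +
      (-1) * (τ⁻¹ * f (t - ε) * (Ioi (t - ε)).indicator (fun s => kern g d (t - s) * 1) s)) =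
      fun s => A s + R s := by
    ext s
    simp only [hA, hR]
    by_cases hs : s ∈ Ioi (t - ε)
    · have hs' : s ∉ Iic (t - ε) := by simpa using hs
      rw [indicator_of_mem hs, indicator_of_mem hs, indicator_of_notMem hs']
      ring
    · have hs' : s ∈ Iic (t - ε) := by simpa using hs
      rw [indicator_of_notMem hs, indicator_of_notMem hs, indicator_of_mem hs']
      ring
  rw [hsplit]
  refine (sqNorm_add_le hAm).trans ?_
  gcongr
  calc 2 * sqNorm R ≤ 2 * (2 * ENNReal.ofReal (K ^ 2 * η) + 2 * ENNReal.ofReal (Q * η)) := by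
        gcongr
        exact hRle.trans (by gcongr)
    _ = ENNReal.ofReal (4 * (K ^ 2 + Q) * η) := by
        have hQ0 : 0 ≤ Q := ENNReal.toReal_nonneg
        rw [← mul_add, ← ENNReal.ofReal_add (by positivity) (by positivity), ← mul_assoc,
          show (2 * 2 : ℝ≥0∞) = ENNReal.ofReal 4 by norm_num,
          ← ENNReal.ofReal_mul (by norm_num)]
        congr 1
        ring

/-- Pathwise control of the quadratic error of the approximation. -/
theorem remainder_bounds {g f : ℝ → ℝ} (hg : ContDiffOn ℝ 2 g (Ioi 0))
    (hg2 : MemLp g 2 (volume.restrict (Ioi 0))) (hf : IsCadlagFun f)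
    {a : ℝ} (ha : 0 < a) (hanti : AntitoneOn (fun x => |iteratedDeriv 2 g x|) (Ioi a))
    (hQ : sqNorm (fun s => kern g 1 (0 - s) * f s) ≠ ∞) {v : ℕ} (hv : 0 < v)
    {δ ε η τ : ℕ → ℝ} (hδ : ∀ k, 0 < δ k) (hδ0 : Tendsto δ atTop (𝓝 0)) (hδ1 : ∀ k, δ k ≤ 1)
    (hε : ∀ k, 0 ≤ ε k) (hε1 : ∀ k, ε k ≤ 1) (hε0 : Tendsto ε atTop (𝓝 0))
    (hη : ∀ k, 0 ≤ η k) (hη1 : ∀ k, η k ≤ 1) (hη0 : Tendsto η atTop (𝓝 0))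
    (hτ : ∀ k, 0 < τ k) (hτ2 : ∀ k, τ k ^ 2 = (sqNorm (kern g (v * δ k))).toReal)
    (htail : ∀ k, sqNorm ((Ici (ε k)).indicator (kern g (v * δ k))) ≤
      ENNReal.ofReal (η k * τ k ^ 2))
    (hd4 : ∀ k, (v * δ k) ^ 4 ≤ η k * τ k ^ 2) {t : ℝ} (ht : 0 < t)
    {V : ℕ → ℕ → ℝ≥0∞}
    (hV : ∀ k i, V k i = sqNorm (fun s => (τ k)⁻¹ * (kern g (v * δ k) (i * δ k - s) * f s) +
      (-1) * ((τ k)⁻¹ * f (i * δ k - ε k) * (Ioi (i * δ k - ε k)).indicator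
        (fun s => kern g (v * δ k) (i * δ k - s) * 1) s))) :
    (∃ C : ℝ, ∀ k, ∀ i ∈ Finset.Icc (v * 2) ⌊t / δ k⌋₊, V k i ≤ ENNReal.ofReal C) ∧
    Tendsto (fun k => ∑ i ∈ Finset.Icc (v * 2) ⌊t / δ k⌋₊, ENNReal.ofReal (δ k) * V k i)
      atTop (𝓝 0) := by
  obtain ⟨K, hK0, hK⟩ := hf.exists_bound (-(a + 2)) t
  have hv' : (1 : ℝ) ≤ v := by exact_mod_cast hv
  set Q := (sqNorm fun s => kern g 1 (0 - s) * f s).toReal with hQdef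
  have hQ0 : 0 ≤ Q := ENNReal.toReal_nonneg
  set P : ℕ → ℕ → ℝ≥0∞ := fun k i => sqNorm (fun s => (τ k)⁻¹ * (Ioi (i * δ k - ε k)).indicator
      (fun s => kern g (v * δ k) (i * δ k - s) * (f s - f (i * δ k - ε k))) s) with hP
  have hdpos (k) : 0 < v * δ k := mul_pos (by linarith) (hδ k)
  have hPle (k i : ℕ) (D : ℝ) (hD : ∀ r ∈ Icc (i * δ k - ε k) (i * δ k),
      ∀ r' ∈ Icc (i * δ k - ε k) (i * δ k), |f r - f r'| ≤ D) : P k i ≤ ENNReal.ofReal (D ^ 2) :=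
    sqNorm_fluctuation_le (hdpos k).le (hε k) hD (hτ k)
      (sqNorm_kern_ne_top hg.continuousOn hg2 _) (hτ2 k)
  have hosc (k i : ℕ) (hit : i * δ k ≤ t) : ∀ r ∈ Icc (i * δ k - ε k) (i * δ k),
      ∀ r' ∈ Icc (i * δ k - ε k) (i * δ k), |f r - f r'| ≤ 2 * K := by
    intro r hr r' hr'
    have h0 : 0 ≤ (i : ℝ) * δ k := mul_nonneg (by positivity) (hδ k).le
    have h1 := hK r ⟨by linarith [hr.1, hε1 k], by linarith [hr.2]⟩
    have h2 := hK r' ⟨by linarith [hr'.1, hε1 k], by linarith [hr'.2]⟩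
    linarith [abs_sub (f r) (f r')]
  have hmem {k i : ℕ} (hi : i ∈ Finset.Icc (v * 2) ⌊t / δ k⌋₊) :
      0 < i ∧ i * δ k ≤ t ∧ 2 * (v * δ k) ≤ i * δ k := by
    rw [Finset.mem_Icc] at hi
    refine ⟨by omega, ?_, ?_⟩
    · rw [← le_div_iff₀ (hδ k)]
      exact (Nat.le_floor_iff (div_nonneg ht.le (hδ k).le)).1 hi.2
    · rw [← mul_assoc]
      refine mul_le_mul_of_nonneg_right ?_ (hδ k).le
      have : ((v * 2 : ℕ) : ℝ) ≤ i := by exact_mod_cast hi.1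
      push_cast at this
      linarith
  have hVle {k i : ℕ} (hi : i ∈ Finset.Icc (v * 2) ⌊t / δ k⌋₊) :
      V k i ≤ 2 * P k i + ENNReal.ofReal (4 * (K ^ 2 + Q) * η k) := by
    obtain ⟨h0, h1, h2⟩ := hmem hi
    rw [hV]
    exact sqNorm_remainder_le hg hf.measurable ha hanti (hdpos k) h2 (hε k) (hη k) (hτ k)
      (fun s hs => hK s ⟨hs.1, hs.2.trans h1⟩) (htail k) (hd4 k) hQ
  have hPK {k i : ℕ} (hit : i * δ k ≤ t) : P k i ≤ ENNReal.ofReal ((2 * K) ^ 2) :=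
    hPle k i _ (hosc k i hit)
  constructor
  · refine ⟨2 * (2 * K) ^ 2 + 4 * (K ^ 2 + Q), fun k i hi => (hVle hi).trans ?_⟩
    rw [ENNReal.ofReal_add (by positivity) (by positivity),
      ENNReal.ofReal_mul (by norm_num : (0 : ℝ) ≤ 2), ENNReal.ofReal_ofNat]
    refine add_le_add (mul_le_mul_right (hPK (hmem hi).2.1) _) (ENNReal.ofReal_le_ofReal ?_)
    exact mul_le_of_le_one_right (by positivity) (hη1 k)
  -- Since `P ≤ min(D, 2K)² ≤ (2K + 1) D`, dividing by `2K + 1` gives a bound linear in the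
  -- oscillation. The guard discards times beyond `t`, where `K` is no bound.
  · set w : ℕ → ℕ → ℝ := fun k i => if (i : ℝ) * δ k ≤ t then (P k i).toReal / (2 * K + 1) else 0
      with hw
    have hwosc := hf.tendsto_oscillation ht hδ hδ0 hε0 (w := w)
      (fun k i => by simp only [hw]; split_ifs <;> positivity) (by
        intro k i D hi hit hD
        have hD0 : 0 ≤ D := (abs_nonneg _).trans
          (hD _ ⟨by linarith [hε k], le_rfl⟩ _ ⟨by linarith [hε k], le_rfl⟩)
        simp only [hw, if_pos hit]
        rw [div_le_iff₀ (by positivity)]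
        have h := hPle k i (min D (2 * K)) fun r hr r' hr' =>
          le_min (hD r hr r' hr') (hosc k i hit r hr r' hr')
        have h1 := ENNReal.toReal_mono ENNReal.ofReal_ne_top h
        rw [ENNReal.toReal_ofReal (sq_nonneg _)] at h1
        have hm0 : 0 ≤ min D (2 * K) := le_min hD0 (by positivity)
        nlinarith [min_le_left D (2 * K), min_le_right D (2 * K)])
    have hlim : Tendsto (fun k => 2 * (2 * K + 1) * (δ k * ∑ i ∈ Finset.Icc 1 ⌊t / δ k⌋₊, w k i) +
        (t + 1) * (4 * (K ^ 2 + Q) * η k)) atTop (𝓝 0) := by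
      simpa using (hwosc.const_mul (2 * (2 * K + 1))).add
        ((hη0.const_mul (4 * (K ^ 2 + Q))).const_mul (t + 1))
    have hlim' := ENNReal.tendsto_ofReal hlim
    rw [ENNReal.ofReal_zero] at hlim'
    refine tendsto_of_tendsto_of_tendsto_of_le_of_le tendsto_const_nhds hlim'
      (fun _ => zero_le) fun k => ?_
    have hw0 (i) : 0 ≤ w k i := by simp only [hw]; split_ifs <;> positivity
    calc ∑ i ∈ Finset.Icc (v * 2) ⌊t / δ k⌋₊, ENNReal.ofReal (δ k) * V k i
        ≤ ∑ i ∈ Finset.Icc (v * 2) ⌊t / δ k⌋₊, ENNReal.ofReal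
            (δ k * (2 * (2 * K + 1) * w k i + 4 * (K ^ 2 + Q) * η k)) := by
          refine Finset.sum_le_sum fun i hi => ?_
          rw [ENNReal.ofReal_mul (hδ k).le]
          refine mul_le_mul_right ((hVle hi).trans ?_) _
          have hk := hη k
          have hwi := hw0 i
          rw [ENNReal.ofReal_add (by positivity) (by positivity)]
          refine add_le_add (le_of_eq ?_) le_rfl
          have hit := (hmem hi).2.1
          rw [mul_assoc, ENNReal.ofReal_mul (by norm_num : (0 : ℝ) ≤ 2), ENNReal.ofReal_ofNat]
          simp only [hw, if_pos hit]
          rw [mul_div_cancel₀ _ (by positivity : 2 * K + 1 ≠ 0),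
            ENNReal.ofReal_toReal (ne_top_of_le_ne_top ENNReal.ofReal_ne_top (hPK hit))]
      _ = ENNReal.ofReal (2 * (2 * K + 1) * (δ k * ∑ i ∈ Finset.Icc (v * 2) ⌊t / δ k⌋₊, w k i) +
          δ k * (Finset.Icc (v * 2) ⌊t / δ k⌋₊).card * (4 * (K ^ 2 + Q) * η k)) := by
          rw [← ENNReal.ofReal_sum_of_nonneg fun i _ => mul_nonneg (hδ k).le (by
            have := hw0 i; have := hη k; positivity)]
          congr 1
          simp only [mul_add, Finset.sum_add_distrib, Finset.sum_const, nsmul_eq_mul,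
            Finset.mul_sum]
          congr 1
          · refine Finset.sum_congr rfl fun i _ => by ring
          · ring
      _ ≤ _ := by
          refine ENNReal.ofReal_le_ofReal ?_
          have hsub : ∑ i ∈ Finset.Icc (v * 2) ⌊t / δ k⌋₊, w k i ≤
              ∑ i ∈ Finset.Icc 1 ⌊t / δ k⌋₊, w k i :=
            Finset.sum_le_sum_of_subset_of_nonneg
              (Finset.Icc_subset_Icc_left (by omega)) fun i _ _ => hw0 i
          have hcard := mul_card_Icc_le (hδ k) (hδ1 k) ht.le (v * 2)
          have hk := hη k
          have hk' := (hδ k).le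
          gcongr

end BSS

namespace BSS

/-! ### Gaussian approximation of the normalized increments -/

section

variable {Ω : Type*} {mΩ : MeasurableSpace Ω} {μ : Measure Ω} [IsProbabilityMeasure μ]
  {ℱ : Filtration ℝ mΩ} {W : Set ℝ → Ω → ℝ}

theorem sqNorm_normalized_kern {g : ℝ → ℝ} {τ d t ε : ℝ} :
    sqNorm (fun s => τ⁻¹ * (Ioi (t - ε)).indicator (fun s => kern g d (t - s) * 1) s) =
      ENNReal.ofReal (τ⁻¹ ^ 2) * sqNorm ((Ici ε)ᶜ.indicator (kern g d)) := by
  rw [sqNorm_const_mul, ← sqNorm_sub_left ((Ici ε)ᶜ.indicator (kern g d)) t]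
  congr 2
  ext s
  have : s ∈ Ioi (t - ε) ↔ t - s ∈ (Ici ε)ᶜ := by
    simp only [mem_Ioi, mem_compl_iff, mem_Ici, not_le]
    constructor <;> intro h <;> linarith
  by_cases hs : s ∈ Ioi (t - ε)
  · rw [indicator_of_mem hs, indicator_of_mem (this.1 hs), mul_one]
  · rw [indicator_of_notMem hs, indicator_of_notMem fun h => hs (this.2 h)]

/-- Along a good sequence of mesh sizes, the normalized increments of `X` are approximated by
`σ` times a Gaussian array whose power sums obey the law of large numbers. -/
theorem exists_gaussian_approximation (hW : IsWhiteNoise μ ℱ W) {g : ℝ → ℝ} {σ X G : ℝ → Ω → ℝ}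
    (hX : IsBSS μ ℱ W g σ X) (hG : IsGaussianCore μ ℱ W g G) (hg : ContDiffOn ℝ 2 g (Ioi 0))
    (hg2 : MemLp g 2 (volume.restrict (Ioi 0))) {a : ℝ} (ha : 0 < a)
    (hanti : AntitoneOn (fun x => |iteratedDeriv 2 g x|) (Ioi a))
    (hσa : Adapted ℱ σ) (hσc : IsCadlag σ)
    (hQ : ∀ᵐ ω ∂μ, sqNorm (fun s => kern g 1 (0 - s) * σ s ω) ≠ ∞) {v : ℕ} (hv : 0 < v)
    {δ ε η τ : ℕ → ℝ} (hδ : ∀ k, 0 < δ k) (hδ0 : Tendsto δ atTop (𝓝 0)) (hδ1 : ∀ k, δ k ≤ 1)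
    (hε : ∀ k, 0 ≤ ε k) (hε1 : ∀ k, ε k ≤ 1) (hε0 : Tendsto ε atTop (𝓝 0))
    (hη : ∀ k, 0 ≤ η k) (hη1 : ∀ k, η k ≤ 1) (hη0 : Tendsto η atTop (𝓝 0))
    (hτ : ∀ k, 0 < τ k) (hτ2 : ∀ k, τ k ^ 2 = (sqNorm (kern g (v * δ k))).toReal)
    (htail : ∀ k, sqNorm ((Ici (ε k)).indicator (kern g (v * δ k))) ≤
      ENNReal.ofReal (η k * τ k ^ 2))
    (hd4 : ∀ k, (v * δ k) ^ 4 ≤ η k * τ k ^ 2) {p : ℝ} (hp : 0 < p) :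
    ∃ Z : ℕ → ℕ → Ω → ℝ,
      (∀ t : ℝ, 0 ≤ t → ∀ e : ℝ≥0∞, 0 < e → Tendsto (fun k => μ {ω | e ≤ ENNReal.ofReal |δ k *
        ∑ i ∈ Finset.Icc (v * 2) ⌊t / δ k⌋₊, |Z k i ω| ^ p - absMoment p * t|}) atTop (𝓝 0)) ∧
      ∀ t : ℝ, 0 < t → ∀ e : ℝ≥0∞, 0 < e → Tendsto (fun k => μ {ω | e ≤ ENNReal.ofReal (δ k *
        ∑ i ∈ Finset.Icc (v * 2) ⌊t / δ k⌋₊,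
          |(τ k)⁻¹ * increment X 2 v (δ k) i ω - σ (i * δ k - ε k) ω * Z k i ω| ^ p)})
        atTop (𝓝 0) := by
  have hgc := hg.continuousOn
  have hσm : Measurable (Function.uncurry σ) :=
    hσc.measurable_uncurry fun s => (hσa s).mono (ℱ.le s) le_rfl
  have hone : Measurable (Function.uncurry fun (_ : ℝ) (_ : Ω) => (1 : ℝ)) := measurable_const
  have hGi (k i) := IsBSS.isItoIntegral_increment hW hG hgc hone v (δ k) i
  have hXi (k i) := hX.isItoIntegral_increment hW hgc hσm v (δ k) i
  have hGm (k i : ℕ) : Measurable (Function.uncurry fun (s : ℝ) (_ : Ω) =>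
      kern g (v * δ k) (i * δ k - s) * 1) := measurable_weight_mul (measurable_kern hgc _) hone _
  have hXm (k i : ℕ) : Measurable (Function.uncurry fun (s : ℝ) (ω : Ω) =>
      kern g (v * δ k) (i * δ k - s) * σ s ω) := measurable_weight_mul (measurable_kern hgc _) hσm _
  -- `Z₀` integrates the kernel over `(iδ - ε, iδ]` only. The lagged value of `σ` is measurable at
  -- the left end of this window, so it may multiply inside or outside the integral.
  choose Z₀ hZm hZi hZξ using fun k i : ℕ =>
    (hGi k i).exists_restrict_Ioi hW (hGm k i) (i * δ k - ε k)
  have hRm (k i : ℕ) : Measurable (Function.uncurry fun (s : ℝ) (_ : Ω) =>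
      (Ioi (i * δ k - ε k)).indicator (fun s => kern g (v * δ k) (i * δ k - s) * 1) s) :=
    measurable_uncurry_indicator_Ioi (hGm k i) _
  have hdpos (k) : 0 < v * δ k := mul_pos (by exact_mod_cast hv) (hδ k)
  have hfin (d) : sqNorm (kern g d) ≠ ∞ := sqNorm_kern_ne_top hgc hg2 d
  -- The variance of the Gaussian variable does not depend on `i`, by translation; the tail bound
  -- places it in `[1 - η k, 1]`.
  set ρ : ℕ → NNReal := fun k =>
    (ENNReal.ofReal ((τ k)⁻¹ ^ 2) * sqNorm ((Ici (ε k))ᶜ.indicator (kern g (v * δ k)))).toNNReal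
    with hρ
  set φ : ℕ → ℕ → ℝ → ℝ := fun k i s => (τ k)⁻¹ * (Ioi (i * δ k - ε k)).indicator
    (fun s => kern g (v * δ k) (i * δ k - s) * 1) s with hφ
  have hφm (k i) : Measurable (φ k i) :=
    ((((measurable_kern hgc _).comp (measurable_const.sub measurable_id)).mul
      measurable_const).indicator measurableSet_Ioi).const_mul _
  have hφn (k i) : sqNorm (φ k i) = ENNReal.ofReal ((τ k)⁻¹ ^ 2) *
      sqNorm ((Ici (ε k))ᶜ.indicator (kern g (v * δ k))) := sqNorm_normalized_kern
  have hφfin (k i) : sqNorm (φ k i) ≠ ∞ := by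
    rw [hφn]
    exact ENNReal.mul_ne_top ENNReal.ofReal_ne_top
      (ne_top_of_le_ne_top (hfin _) (sqNorm_indicator_le _ _))
  have hZ (k i) : IsItoIntegral μ ℱ W (fun s _ => φ k i s) (fun ω => (τ k)⁻¹ * Z₀ k i ω) :=
    (hZi k i).const_mul hW (hRm k i) _
  refine ⟨fun k i ω => (τ k)⁻¹ * Z₀ k i ω, fun t ht e he => ?_, fun t ht e he => ?_⟩
  · have hρ1 : Tendsto ρ atTop (𝓝 1) := by
      have hval (k) : 1 - η k ≤ (ρ k : ℝ) ∧ (ρ k : ℝ) ≤ 1 := by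
        have h := sqNorm_indicator_add_compl (kern g (v * δ k)) (measurableSet_Ici (a := ε k))
        have hf1 := ne_top_of_le_ne_top (hfin (v * δ k))
          (sqNorm_indicator_le (Ici (ε k)) (kern g (v * δ k)))
        have hf2 := ne_top_of_le_ne_top (hfin (v * δ k))
          (sqNorm_indicator_le (Ici (ε k))ᶜ (kern g (v * δ k)))
        have h1 := congrArg ENNReal.toReal h
        rw [ENNReal.toReal_add hf1 hf2, ← hτ2] at h1
        have h2 := ENNReal.toReal_mono ENNReal.ofReal_ne_top (htail k)
        have hηk := hη k
        rw [ENNReal.toReal_ofReal (by positivity)] at h2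
        have h3 : 0 ≤ (sqNorm ((Ici (ε k)).indicator (kern g (v * δ k)))).toReal :=
          ENNReal.toReal_nonneg
        have h4 : (ρ k : ℝ) = (τ k ^ 2)⁻¹ *
            (sqNorm ((Ici (ε k))ᶜ.indicator (kern g (v * δ k)))).toReal := by
          simp only [hρ]
          rw [ENNReal.coe_toNNReal_eq_toReal, ENNReal.toReal_mul,
            ENNReal.toReal_ofReal (sq_nonneg _), inv_pow]
        have h5 : 0 < τ k ^ 2 := pow_pos (hτ k) 2
        rw [h4, inv_mul_eq_div, le_div_iff₀ h5, div_le_one h5]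
        constructor <;> linarith
      have hlow : Tendsto (fun k => 1 - η k) atTop (𝓝 1) := by simpa using hη0.const_sub 1
      rw [← NNReal.tendsto_coe]
      exact tendsto_of_tendsto_of_tendsto_of_le_of_le hlow tendsto_const_nhds
        (fun k => (hval k).1) fun k => (hval k).2
    refine tendsto_gaussian_power_sum hρ1 (fun k i => (hZ k i).aemeasurable hW) (fun k i => ?_)
      hδ hδ0 hε hε0 (fun k i j hij => ?_) hp _ ht e he
    · rw [(hZ k i).map_eq_gaussianReal hW (hφm k i) (hφfin k i), hφn]
    · refine (hZ k i).indepFun hW (hφm k i) (hφm k j) (hZ k j) (hφfin k i) (hφfin k j) fun s => ?_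
      -- Kernel `i` vanishes from time `iδ` on, while kernel `j` is cut off up to time `jδ - ε ≥
      -- iδ`.
      rcases le_or_gt (i * δ k) s with h | h
      · have : φ k i s = 0 := by
          simp [hφ, indicator, kern_of_nonpos g (hdpos k).le (by linarith : i * δ k - s ≤ 0)]
        rw [this, zero_mul]
      · have : φ k j s = 0 := by
          simp only [hφ]
          rw [indicator_of_notMem (by rw [mem_Ioi]; linarith), mul_zero]
        rw [this, mul_zero]
  -- The approximation error is itself a stochastic integral, with integrand `H`; its moments are
  -- controlled through the pathwise squared norm.
  · set H : ℕ → ℕ → ℝ → Ω → ℝ := fun k i s ω =>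
      (τ k)⁻¹ * (kern g (v * δ k) (i * δ k - s) * σ s ω) + (-1) * ((τ k)⁻¹ *
        σ (i * δ k - ε k) ω * (Ioi (i * δ k - ε k)).indicator
          (fun s => kern g (v * δ k) (i * δ k - s) * 1) s) with hH
    have hξm (k i : ℕ) : Measurable[ℱ (i * δ k - ε k)] fun ω =>
        (τ k)⁻¹ * σ (i * δ k - ε k) ω := (hσa _).const_mul _
    have hUm (k i : ℕ) : Measurable (Function.uncurry fun (s : ℝ) (ω : Ω) => (τ k)⁻¹ *
        σ (i * δ k - ε k) ω * (Ioi (i * δ k - ε k)).indicator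
          (fun s => kern g (v * δ k) (i * δ k - s) * 1) s) :=
      (((hξm k i).mono (ℱ.le _) le_rfl).comp measurable_snd).mul (hRm k i)
    have hHm (k i) : Measurable (Function.uncurry (H k i)) :=
      measurable_uncurry_add (H := fun s ω => (τ k)⁻¹ * (kern g (v * δ k) (i * δ k - s) * σ s ω))
        (measurable_uncurry_const_mul (hXm k i) _) (measurable_uncurry_const_mul (hUm k i) _)
    have hY (k i) : IsItoIntegral μ ℱ W (H k i) (fun ω => (τ k)⁻¹ * increment X 2 v (δ k) i ω +
        (-1) * ((τ k)⁻¹ * σ (i * δ k - ε k) ω * Z₀ k i ω)) :=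
      IsItoIntegral.add hW
        (H := fun s ω => (τ k)⁻¹ * (kern g (v * δ k) (i * δ k - s) * σ s ω))
        (measurable_uncurry_const_mul (hXm k i) _) (measurable_uncurry_const_mul (hUm k i) _)
        ((hXi k i).const_mul hW (hXm k i) _)
        ((hZξ k i _ (hξm k i)).const_mul hW (hUm k i) _)
    have hVm (k i) : Measurable fun ω => sqNorm fun s => H k i s ω := measurable_sqNorm (hHm k i)
    have hb : ∀ᵐ ω ∂μ, _ := hQ.mono fun ω hω =>
      remainder_bounds hg hg2 (hσc.isCadlagFun ω) ha hanti hω hv hδ hδ0 hδ1 hε hε1 hε0 hη hη1 hη0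
        hτ hτ2 htail hd4 ht (V := fun k i => sqNorm fun s => H k i s ω) fun k i => rfl
    have h := tendsto_measure_power_sum_of_sqNorm (fun k i => (hY k i).aemeasurable hW) hVm
      (fun k i c q hc hq => (hY k i).lintegral_rpow_le hW (hHm k i) hc hq
        (measurableSet_le (hVm k i) measurable_const) fun ω hω => hω)
      (I := fun k => Finset.Icc (v * 2) ⌊t / δ k⌋₊) hδ
      (fun k => mul_card_Icc_le (hδ k) (hδ1 k) ht.le (v * 2))
      (hb.mono fun ω h => h.1) (hb.mono fun ω h => h.2) hp e he
    refine h.congr fun k => ?_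
    have (ω : Ω) (i : ℕ) : (τ k)⁻¹ * increment X 2 v (δ k) i ω +
        (-1) * ((τ k)⁻¹ * σ (i * δ k - ε k) ω * Z₀ k i ω) =
        (τ k)⁻¹ * increment X 2 v (δ k) i ω - σ (i * δ k - ε k) ω * ((τ k)⁻¹ * Z₀ k i ω) :=
      by ring
    simp only [this]

end

end BSS

namespace BSS

/-! ### Limits of power variations -/

/-- The sums for `f Z` are Riemann sums of `|f|^p` with weights `|Z|^p`. The perturbation inequality
transfers their limit to `A`. -/
theorem IsCadlagFun.tendsto_power_sum {f : ℝ → ℝ} (hf : IsCadlagFun f) {t c p : ℝ} (ht : 0 < t)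
    (hc : 0 ≤ c) (hp : 0 < p) {δ ε : ℕ → ℝ} (hδ : ∀ k, 0 < δ k) (hε : ∀ k, 0 ≤ ε k)
    (hε0 : Tendsto ε atTop (𝓝 0)) {m : ℕ} (hm : 0 < m) {A Z : ℕ → ℕ → ℝ}
    (h1 : ∀ M : ℕ, 0 < M → ∀ j ≤ M, Tendsto (fun k => δ k *
      ∑ i ∈ Finset.Icc m ⌊t * j / M / δ k⌋₊, |Z k i| ^ p) atTop (𝓝 (c * (t * j / M))))
    (h2 : Tendsto (fun k => δ k * ∑ i ∈ Finset.Icc m ⌊t / δ k⌋₊,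
      |A k i - f (i * δ k - ε k) * Z k i| ^ p) atTop (𝓝 0)) :
    Tendsto (fun k => δ k * ∑ i ∈ Finset.Icc m ⌊t / δ k⌋₊, |A k i| ^ p) atTop
      (𝓝 (c * ∫ s in (0 : ℝ)..t, |f s| ^ p)) := by
  have hfp : IsCadlagFun fun s => |f s| ^ p :=
    hf.comp_continuous (h := fun x => |x| ^ p) (continuous_abs.rpow_const fun _ => Or.inr hp.le)
  set S : ℕ → ℝ := fun k => δ k * ∑ i ∈ Finset.Icc m ⌊t / δ k⌋₊,
    |f (i * δ k - ε k) * Z k i| ^ p with hS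
  set l := c * ∫ s in (0 : ℝ)..t, |f s| ^ p with hl
  have hSl : Tendsto S atTop (𝓝 l) := by
    have h := hfp.tendsto_riemann ht hc hδ hε hε0 (z := fun k i => if m ≤ i then |Z k i| ^ p else 0)
      (fun k i => by split_ifs <;> positivity) (fun k => if_neg (by omega))
      (by simpa only [sum_range_ite] using h1)
    refine h.congr fun k => ?_
    simp only [mul_ite, mul_zero, sum_range_ite, hS]
    congr 1
    refine Finset.sum_congr rfl fun i _ => ?_
    rw [abs_mul, Real.mul_rpow (abs_nonneg _) (abs_nonneg _)]
  have hS0 (k) : 0 ≤ S k := mul_nonneg (hδ k).le (Finset.sum_nonneg fun i _ => by positivity)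
  have hl0 : 0 ≤ l := ge_of_tendsto' hSl hS0
  have hdiff : Tendsto (fun k => δ k * ∑ i ∈ Finset.Icc m ⌊t / δ k⌋₊, |A k i| ^ p - S k)
      atTop (𝓝 0) := by
    rw [Metric.tendsto_nhds]
    intro e he
    -- This `κ` makes the multiplicative error at most `e/2` in the limit, because the sums tend to
    -- `l`.
    obtain ⟨C, hC0, hC⟩ := exists_abs_rpow_sub_le hp (κ := e / (2 * (l + 1))) (by positivity)
    have hlim : Tendsto (fun k => e / (2 * (l + 1)) * S k + C * (δ k *
        ∑ i ∈ Finset.Icc m ⌊t / δ k⌋₊, |A k i - f (i * δ k - ε k) * Z k i| ^ p)) atTop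
        (𝓝 (e / (2 * (l + 1)) * l + C * 0)) := (hSl.const_mul _).add (h2.const_mul C)
    have hlt : e / (2 * (l + 1)) * l + C * 0 < e := by
      rw [mul_zero, add_zero, div_mul_eq_mul_div, div_lt_iff₀ (by positivity)]
      nlinarith
    filter_upwards [hlim.eventually_lt_const hlt] with k hk
    rw [Real.dist_eq, sub_zero]
    refine lt_of_le_of_lt ?_ hk
    simp only [hS]
    rw [← mul_sub, ← Finset.sum_sub_distrib, abs_mul, abs_of_pos (hδ k)]
    calc _ ≤ δ k * ∑ i ∈ Finset.Icc m ⌊t / δ k⌋₊, (e / (2 * (l + 1)) *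
          |f (i * δ k - ε k) * Z k i| ^ p + C * |A k i - f (i * δ k - ε k) * Z k i| ^ p) :=
          mul_le_mul_of_nonneg_left ((Finset.abs_sum_le_sum_abs _ _).trans
            (Finset.sum_le_sum fun i _ => hC _ _)) (hδ k).le
      _ = _ := by
          rw [Finset.sum_add_distrib, ← Finset.mul_sum, ← Finset.mul_sum]
          ring
  simpa using hdiff.add hSl

/-- By right-continuity a nonzero value persists on an interval to its right; the half-open range
leaves room for that interval before `t`. -/
theorem intervalIntegral_abs_rpow_pos {f : ℝ → ℝ} (hf : IsCadlagFun f) {p t : ℝ} (hp : 0 < p)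
    (h : ∃ s ∈ Ico 0 t, f s ≠ 0) : 0 < ∫ s in (0 : ℝ)..t, |f s| ^ p := by
  obtain ⟨s, hs, hfs⟩ := h
  have hfp : IsCadlagFun fun s => |f s| ^ p :=
    hf.comp_continuous (h := fun x => |x| ^ p) (continuous_abs.rpow_const fun _ => Or.inr hp.le)
  have hne : ∀ᶠ x in 𝓝[≥] s, f x ≠ 0 := (hf s).1.eventually_ne hfs
  obtain ⟨u, hu, hsu⟩ := (mem_nhdsGE_iff_exists_Ico_subset).1 hne
  have hu' : s < u := hu
  set r := min u t with hr
  have hsr : s < r := lt_min hu' hs.2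
  have h1 : 0 < ∫ x in s..r, |f x| ^ p := by
    refine intervalIntegral.intervalIntegral_pos_of_pos_on (hfp.intervalIntegrable _ _)
      (fun x hx => ?_) hsr
    have : f x ≠ 0 := hsu ⟨hx.1.le, hx.2.trans_le (min_le_left _ _)⟩
    positivity
  refine h1.trans_le (intervalIntegral.integral_mono_interval hs.1 hsr.le (min_le_right _ _)
    (Eventually.of_forall fun x => by simp only [Pi.zero_apply]; positivity)
    (hfp.intervalIntegrable _ _))

theorem exists_subseq_ae_tendsto_zero_of_countable {Ω : Type*} {mΩ : MeasurableSpace Ω}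
    {μ : Measure Ω} {ι : Type*} [Countable ι] [Nonempty ι] {F : ι → ℕ → Ω → ℝ≥0∞}
    (h : ∀ (j : ι) (e : ℝ≥0∞), 0 < e → Tendsto (fun n => μ {ω | e ≤ F j n ω}) atTop (𝓝 0)) :
    ∃ φ : ℕ → ℕ, StrictMono φ ∧ ∀ᵐ ω ∂μ, ∀ j, Tendsto (fun k => F j (φ k) ω) atTop (𝓝 0) := by
  obtain ⟨u, hu⟩ := exists_surjective_nat ι
  obtain ⟨φ, hφ, hae⟩ := exists_subseq_ae_tendsto_zero (μ := μ) (F := fun j => F (u j))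
    fun j e he => h (u j) e he
  refine ⟨φ, hφ, hae.mono fun ω hω j => ?_⟩
  obtain ⟨i, rfl⟩ := hu j
  exact hω i

/-- For all small mesh sizes the kernel of the increments is concentrated near the origin. -/
theorem eventually_kern_concentrated {g : ℝ → ℝ} (hg : ContDiffOn ℝ 2 g (Ioi 0)) {a : ℝ}
    (ha : 0 < a) (hanti : AntitoneOn (fun x => |iteratedDeriv 2 g x|) (Ioi a))
    (hL : ∀ ε : ℝ, 0 < ε → MemLp (iteratedDeriv 2 g) 2 (volume.restrict (Ioi ε)))
    {T : ℝ → ℝ} (hT : ∀ᶠ d in 𝓝[>] 0, 0 < T d)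
    (hT4 : Tendsto (fun d => d ^ 4 / T d) (𝓝[>] 0) (𝓝 0)) {ε η : ℝ} (hε : 0 < ε) (hη : 0 < η) :
    ∀ᶠ d in 𝓝[>] 0, 0 < T d ∧ sqNorm ((Ici ε).indicator (kern g d)) ≤ ENNReal.ofReal (η * T d) ∧
      d ^ 4 ≤ η * T d := by
  obtain ⟨C, d₀, hd₀, hC⟩ := exists_sqNorm_tail_le hg ha hanti hL (half_pos hε)
  have hsmall : ∀ᶠ d in 𝓝[>] (0 : ℝ), d < d₀ := nhdsWithin_le_nhds (Iio_mem_nhds hd₀)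
  -- The factor `|C| + 1` yields both the tail bound and the bound on `d⁴` from one limit.
  have h4 : Tendsto (fun d => (|C| + 1) * (d ^ 4 / T d)) (𝓝[>] 0) (𝓝 0) := by
    simpa using hT4.const_mul (|C| + 1)
  filter_upwards [hT, hsmall, h4.eventually_lt_const hη, self_mem_nhdsWithin] with d h1 h2 h3 h0
  have h0' : 0 < d := h0
  have h5 : (|C| + 1) * d ^ 4 ≤ η * T d := by
    rw [mul_div_assoc', div_lt_iff₀ h1] at h3
    exact h3.le
  have h6 : 0 ≤ |C| * d ^ 4 := by positivity
  have h7 : 0 ≤ d ^ 4 := by positivity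
  refine ⟨h1, ?_, by linarith⟩
  calc sqNorm ((Ici ε).indicator (kern g d)) ≤ sqNorm ((Ioi (ε / 2)).indicator (kern g d)) := by
        refine sqNorm_mono fun s => ?_
        by_cases hs : s ∈ Ici ε
        · have : s ∈ Ioi (ε / 2) := by
            have : ε ≤ s := hs
            rw [mem_Ioi]
            linarith
          rw [indicator_of_mem hs, indicator_of_mem this]
        · rw [indicator_of_notMem hs, abs_zero]
          exact abs_nonneg _
    _ ≤ ENNReal.ofReal (d ^ 4 * C) := hC d h0' h2
    _ ≤ ENNReal.ofReal (η * T d) := by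
        refine ENNReal.ofReal_le_ofReal ?_
        have := mul_le_mul_of_nonneg_left (le_abs_self C) h7
        linarith

theorem sqNorm_weight_mul_eq (g f : ℝ → ℝ) (t : ℝ) :
    sqNorm (fun s => weight g (t - s) * f s) =
      ∫⁻ s in Iio t, ENNReal.ofReal (g (t - s) ^ 2 * f s ^ 2) := by
  rw [← lintegral_indicator measurableSet_Iio]
  refine lintegral_congr fun s => ?_
  change ENNReal.ofReal ((weight g (t - s) * f s) ^ 2) = _
  rw [← indicator_Iio_eq_weight]
  by_cases hs : s ∈ Iio t
  · rw [indicator_of_mem hs, indicator_of_mem hs, mul_pow]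
  · rw [indicator_of_notMem hs, indicator_of_notMem hs]
    simp

/-- The unit-step kernel at time zero combines the weights at times 0, -1 and -2, so finiteness of
the integrals at these times suffices. -/
theorem sqNorm_kern_one_mul_ne_top {g f : ℝ → ℝ} (hg : ContinuousOn g (Ioi 0)) (hf : Measurable f)
    (h : ∀ t ∈ ({0, -1, -2} : Set ℝ),
      ∫⁻ s in Iio t, ENNReal.ofReal (g (t - s) ^ 2 * f s ^ 2) < ∞) :
    sqNorm (fun s => kern g 1 (0 - s) * f s) ≠ ∞ := by
  have hm (t : ℝ) : Measurable fun s => weight g (t - s) * f s :=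
    ((measurable_weight hg).comp (measurable_const.sub measurable_id)).mul hf
  have h' (t : ℝ) (ht : t ∈ ({0, -1, -2} : Set ℝ)) :
      sqNorm (fun s => weight g (t - s) * f s) ≠ ∞ := by
    rw [sqNorm_weight_mul_eq]
    exact (h t ht).ne
  have e : (fun s => kern g 1 (0 - s) * f s) = fun s => (weight g (0 - s) * f s +
      (-2) * (weight g (-1 - s) * f s)) + weight g (-2 - s) * f s := by
    ext s
    rw [kern, show (0 : ℝ) - s - 1 = -1 - s by ring, show (0 : ℝ) - s - 2 * 1 = -2 - s by ring]
    ring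
  rw [e]
  exact sqNorm_ne_top_add ((hm 0).add ((hm (-1)).const_mul _))
    (sqNorm_ne_top_add (hm 0) (h' 0 (by simp)) (sqNorm_ne_top_const_mul (h' (-1) (by simp)) _))
    (h' (-2) (by simp))

theorem powerVariation_normalized {Ω : Type*} (X : ℝ → Ω → ℝ) {p τ : ℝ} (hτ : 0 < τ) (v : ℕ) (δ t : ℝ)
    (ω : Ω) : δ * ∑ i ∈ Finset.Icc (v * 2) ⌊t / δ⌋₊, |τ⁻¹ * increment X 2 v δ i ω| ^ p =
      δ * (τ ^ p)⁻¹ * powerVariation X p 2 v δ t ω := by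
  rw [powerVariation, mul_assoc]
  congr 1
  rw [Finset.mul_sum]
  refine Finset.sum_congr rfl fun i _ => ?_
  rw [abs_mul, Real.mul_rpow (abs_nonneg _) (abs_nonneg _), abs_of_pos (inv_pos.2 hτ),
    Real.inv_rpow hτ.le]

theorem monotone_powerVariation {Ω : Type*} (X : ℝ → Ω → ℝ) (p : ℝ) (k v : ℕ) {δ : ℝ} (hδ : 0 < δ) (ω : Ω) :
    Monotone fun t => powerVariation X p k v δ t ω := fun t t' htt => by
  simp only [powerVariation]
  refine Finset.sum_le_sum_of_subset_of_nonneg (Finset.Icc_subset_Icc_right (Nat.floor_mono ?_))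
    fun i _ _ => by positivity
  gcongr

end BSS

namespace BSS

/-! ### Convergence of the change-of-frequency statistic -/

section

variable {Ω : Type*} {mΩ : MeasurableSpace Ω} {μ : Measure Ω} [IsProbabilityMeasure μ]
  {ℱ : Filtration ℝ mΩ} {W : Set ℝ → Ω → ℝ}

/-- Uniform almost sure convergence of the normalized power variations along a good sequence of
mesh sizes, up to a further subsequence. -/
theorem exists_subseq_tendsto_powerVariation (hW : IsWhiteNoise μ ℱ W) {g : ℝ → ℝ}
    {σ X G : ℝ → Ω → ℝ} (hX : IsBSS μ ℱ W g σ X) (hG : IsGaussianCore μ ℱ W g G)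
    (hg : ContDiffOn ℝ 2 g (Ioi 0)) (hg2 : MemLp g 2 (volume.restrict (Ioi 0))) {a : ℝ}
    (ha : 0 < a) (hanti : AntitoneOn (fun x => |iteratedDeriv 2 g x|) (Ioi a))
    (hL : ∀ ε : ℝ, 0 < ε → MemLp (iteratedDeriv 2 g) 2 (volume.restrict (Ioi ε)))
    (hσa : Adapted ℱ σ) (hσc : IsCadlag σ)
    (hQ : ∀ᵐ ω ∂μ, sqNorm (fun s => kern g 1 (0 - s) * σ s ω) ≠ ∞) {S : ℝ → ℝ}
    (hS : ∀ d, S d = (sqNorm (kern g d)).toReal) (hS0 : ∀ᶠ d in 𝓝[>] 0, 0 < S d)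
    (hS4 : Tendsto (fun d => d ^ 4 / S d) (𝓝[>] 0) (𝓝 0)) {δ : ℕ → ℝ} (hδ : ∀ k, 0 < δ k)
    (hδ0 : Tendsto δ atTop (𝓝 0)) {p T : ℝ} (hp : 0 < p) (hT : 0 < T) :
    ∃ φ : ℕ → ℕ, StrictMono φ ∧ (∀ (k : ℕ) (b : Fin 2), 0 < S ((b + 1 : ℕ) * δ (φ k))) ∧
      ∀ᵐ ω ∂μ, ∀ b : Fin 2, Tendsto (fun x : ℕ × ℝ =>
      δ (φ x.1) * (√(S ((b + 1 : ℕ) * δ (φ x.1))) ^ p)⁻¹ *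
        powerVariation X p 2 (b + 1) (δ (φ x.1)) x.2 ω -
      absMoment p * ∫ s in (0 : ℝ)..x.2, |σ s ω| ^ p) (atTop ×ˢ 𝓟 (Icc 0 T)) (𝓝 0) := by
  have hδ' : Tendsto δ atTop (𝓝[>] 0) :=
    tendsto_nhdsWithin_iff.2 ⟨hδ0, Eventually.of_forall hδ⟩
  have hη (k : ℕ) : 0 < 1 / ((k : ℝ) + 1) := by positivity
  -- For fixed `k` all sufficiently fine meshes give concentration at scale `1/(k+1)`, for both
  -- frequencies. Extracting one mesh for each `k` provides lags and tolerances tending to zero.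
  have hgood : ∀ k : ℕ, ∀ᶠ n in atTop, δ n ≤ 1 ∧ ∀ b : Fin 2,
      0 < S ((b + 1 : ℕ) * δ n) ∧
      sqNorm ((Ici (1 / ((k : ℝ) + 1))).indicator (kern g ((b + 1 : ℕ) * δ n))) ≤
        ENNReal.ofReal (1 / ((k : ℝ) + 1) * S ((b + 1 : ℕ) * δ n)) ∧
      ((b + 1 : ℕ) * δ n) ^ 4 ≤ 1 / ((k : ℝ) + 1) * S ((b + 1 : ℕ) * δ n) := by
    intro k
    refine (hδ0.eventually_le_const one_pos).and (eventually_all.2 fun b => ?_)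
    have hbδ : Tendsto (fun n => ((b + 1 : ℕ) : ℝ) * δ n) atTop (𝓝[>] 0) := by
      refine tendsto_nhdsWithin_iff.2 ⟨by simpa using hδ0.const_mul ((b + 1 : ℕ) : ℝ),
        Eventually.of_forall fun n => mul_pos (by positivity) (hδ n)⟩
    exact hbδ.eventually (eventually_kern_concentrated hg ha hanti hL hS0 hS4 (hη k) (hη k))
  obtain ⟨φ, hφ, hgφ⟩ := extraction_forall_of_eventually hgood
  have hη0 : Tendsto (fun k : ℕ => 1 / ((k : ℝ) + 1)) atTop (𝓝 0) :=
    tendsto_one_div_add_atTop_nhds_zero_nat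
  have hη1 (k : ℕ) : 1 / ((k : ℝ) + 1) ≤ 1 := by
    rw [div_le_one (by positivity)]
    linarith [(Nat.cast_nonneg k : (0 : ℝ) ≤ k)]
  have hτ2 (b : Fin 2) (k : ℕ) : √(S ((b + 1 : ℕ) * δ (φ k))) ^ 2 = S ((b + 1 : ℕ) * δ (φ k)) :=
    Real.sq_sqrt ((hgφ k).2 b).1.le
  have hτ0 (b : Fin 2) (k : ℕ) : 0 < √(S ((b + 1 : ℕ) * δ (φ k))) :=
    Real.sqrt_pos.2 ((hgφ k).2 b).1
  choose Z hZ hY using fun b : Fin 2 => exists_gaussian_approximation hW hX hG hg hg2 ha hanti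
    hσa hσc hQ (v := b + 1) (by omega) (δ := δ ∘ φ) (ε := fun k => 1 / ((k : ℝ) + 1))
    (η := fun k => 1 / ((k : ℝ) + 1)) (τ := fun k => √(S ((b + 1 : ℕ) * δ (φ k))))
    (fun k => hδ _) (hδ0.comp hφ.tendsto_atTop) (fun k => (hgφ k).1) (fun k => (hη k).le) hη1 hη0
    (fun k => (hη k).le) hη1 hη0 (hτ0 b) (fun k => (hτ2 b k).trans (hS _))
    (fun k => by rw [hτ2]; exact ((hgφ k).2 b).2.1) (fun k => by rw [hτ2]; exact ((hgφ k).2 b).2.2)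
    hp
  -- Nonnegative rational multiples of `T` are countably many and contain every uniform grid of `[0,
  -- Tq]`, so one subsequence serves all grids used below.
  set F : Fin 2 × (NNRat ⊕ {q : NNRat // 0 < q}) → ℕ → Ω → ℝ≥0∞ := fun x k ω => match x.2 with
    | Sum.inl q => ENNReal.ofReal |δ (φ k) * ∑ i ∈ Finset.Icc ((x.1 + 1 : ℕ) * 2)
        ⌊T * q / δ (φ k)⌋₊, |Z x.1 k i ω| ^ p - absMoment p * (T * q)|
    | Sum.inr q => ENNReal.ofReal (δ (φ k) * ∑ i ∈ Finset.Icc ((x.1 + 1 : ℕ) * 2)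
        ⌊T * (q : NNRat) / δ (φ k)⌋₊, |(√(S ((x.1 + 1 : ℕ) * δ (φ k))))⁻¹ *
          increment X 2 (x.1 + 1) (δ (φ k)) i ω -
          σ (i * δ (φ k) - 1 / ((k : ℝ) + 1)) ω * Z x.1 k i ω| ^ p) with hF
  obtain ⟨ψ, hψ, hae⟩ := exists_subseq_ae_tendsto_zero_of_countable (μ := μ) (F := F) (by
    rintro ⟨b, q | q⟩ e he
    · exact hZ b (T * q) (by positivity) e he
    · have hq : (0 : ℝ) < (q : NNRat) := by exact_mod_cast q.2
      exact hY b (T * (q : NNRat)) (by positivity) e he)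
  refine ⟨φ ∘ ψ, hφ.comp hψ, fun k b => ((hgφ (ψ k)).2 b).1, ?_⟩
  filter_upwards [hae] with ω hω b
  have hf := hσc.isCadlagFun ω
  have hδψ : ∀ k, 0 < δ (φ (ψ k)) := fun k => hδ _
  have hZω (q : NNRat) : Tendsto (fun k => δ (φ (ψ k)) * ∑ i ∈ Finset.Icc ((b + 1 : ℕ) * 2)
      ⌊T * q / δ (φ (ψ k))⌋₊, |Z b (ψ k) i ω| ^ p) atTop (𝓝 (absMoment p * (T * q))) := by
    have h := hω (b, Sum.inl q)
    simp only [hF] at h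
    have h' := (ENNReal.tendsto_toReal ENNReal.zero_ne_top).comp h
    simp only [Function.comp_def, ENNReal.toReal_ofReal (abs_nonneg _), ENNReal.toReal_zero] at h'
    exact tendsto_sub_nhds_zero_iff.1 ((tendsto_zero_iff_abs_tendsto_zero _).2 h')
  have hYω (q : NNRat) (hq : 0 < q) : Tendsto (fun k => δ (φ (ψ k)) *
      ∑ i ∈ Finset.Icc ((b + 1 : ℕ) * 2) ⌊T * q / δ (φ (ψ k))⌋₊,
        |(√(S ((b + 1 : ℕ) * δ (φ (ψ k)))))⁻¹ * increment X 2 (b + 1) (δ (φ (ψ k))) i ω -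
          σ (i * δ (φ (ψ k)) - 1 / ((ψ k : ℝ) + 1)) ω * Z b (ψ k) i ω| ^ p) atTop (𝓝 0) := by
    have h := hω (b, Sum.inr ⟨q, hq⟩)
    simp only [hF] at h
    have h' := (ENNReal.tendsto_toReal ENNReal.zero_ne_top).comp h
    refine Tendsto.congr (fun k => ?_) h'
    exact ENNReal.toReal_ofReal (mul_nonneg (hδψ k).le (Finset.sum_nonneg fun i _ => by positivity))
  have hpow (q : NNRat) (hq : 0 < q) := hf.tendsto_power_sum (t := T * q) (c := absMoment p)
    (p := p) (δ := fun k => δ (φ (ψ k))) (ε := fun k => 1 / ((ψ k : ℝ) + 1)) (m := (b + 1 : ℕ) * 2)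
    (A := fun k i => (√(S ((b + 1 : ℕ) * δ (φ (ψ k)))))⁻¹ *
      increment X 2 (b + 1) (δ (φ (ψ k))) i ω) (Z := fun k i => Z b (ψ k) i ω)
    (mul_pos hT (by exact_mod_cast hq)) (absMoment_pos hp).le hp hδψ (fun k => (hη _).le)
    (hη0.comp hψ.tendsto_atTop) (by omega) (fun M hM j _ => by
      have h := hZω (q * j / M)
      have e : T * ((q * j / M : NNRat) : ℝ) = T * q * j / M := by push_cast; ring
      rw [e] at h
      exact h) (hYω q hq)
  have hfp : IsCadlagFun fun s => |σ s ω| ^ p :=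
    hf.comp_continuous (h := fun x => |x| ^ p) (continuous_abs.rpow_const fun _ => Or.inr hp.le)
  refine tendsto_uniform_of_monotone hT (F := fun k t => δ (φ (ψ k)) *
      (√(S ((b + 1 : ℕ) * δ (φ (ψ k)))) ^ p)⁻¹ *
        powerVariation X p 2 (b + 1) (δ (φ (ψ k))) t ω)
    (I := fun t => absMoment p * ∫ s in (0 : ℝ)..t, |σ s ω| ^ p)
    (Eventually.of_forall fun k => ?_) ?_ fun M hM j hj => ?_
  · exact (monotone_powerVariation X p 2 (b + 1) (hδψ k) ω).const_mul
      (mul_nonneg (hδψ k).le (by positivity))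
  · exact (continuous_const.mul (intervalIntegral.continuous_primitive
      (fun x y => hfp.intervalIntegrable x y) 0)).continuousOn
  -- At time zero the power variation is an empty sum, since its index starts at a positive integer.
  · rcases Nat.eq_zero_or_pos j with rfl | hj0
    · have h0 : T * ((0 : ℕ) : ℝ) / M = 0 := by simp
      simp only [h0, intervalIntegral.integral_same, mul_zero]
      refine tendsto_const_nhds.congr fun k => ?_
      have : Finset.Icc (((b : ℕ) + 1) * 2) ⌊(0 : ℝ) / δ (φ (ψ k))⌋₊ = ∅ := by
        rw [Finset.Icc_eq_empty]
        simp
      rw [powerVariation, this, Finset.sum_empty, mul_zero]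
    · have hq : (0 : NNRat) < (j : NNRat) / M := by positivity
      have h := hpow _ hq
      have e : T * (((j : NNRat) / M : NNRat) : ℝ) = T * j / M := by push_cast; ring
      rw [e] at h
      refine h.congr fun k => ?_
      exact powerVariation_normalized X (hτ0 b (ψ k)) (b + 1) _ _ ω

/-- Time enters only through the integer `⌊t / δ⌋₊`, so the supremum over an uncountable set of
times is one over a countable set of indices. -/
theorem aemeasurable_iSup_floor {y : ℕ → Ω → ℝ} (hy : ∀ m, AEMeasurable (y m) μ) (K : Set ℝ)
    (δ c : ℝ) : AEMeasurable (fun ω => ⨆ t ∈ K, ENNReal.ofReal |y ⌊t / δ⌋₊ ω - c|) μ := by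
  have h : (fun ω => ⨆ t ∈ K, ENNReal.ofReal |y ⌊t / δ⌋₊ ω - c|) =
      fun ω => ⨆ m ∈ (fun t => ⌊t / δ⌋₊) '' K, ENNReal.ofReal |y m ω - c| := by
    ext ω
    rw [iSup_image]
  rw [h]
  refine AEMeasurable.biSup _ (to_countable _) fun m _ => ?_
  exact (by fun_prop : Measurable fun x : ℝ => ENNReal.ofReal |x - c|).comp_aemeasurable (hy m)

theorem tendsto_iSup_of_tendsto_prod {Y : ℕ → ℝ → ℝ} {c : ℝ} {K : Set ℝ}
    (h : Tendsto (fun x : ℕ × ℝ => Y x.1 x.2) (atTop ×ˢ 𝓟 K) (𝓝 c)) :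
    Tendsto (fun k => ⨆ t ∈ K, ENNReal.ofReal |Y k t - c|) atTop (𝓝 0) := by
  rw [ENNReal.tendsto_nhds_zero]
  intro e he
  have h' : Tendsto (fun x : ℕ × ℝ => ENNReal.ofReal |Y x.1 x.2 - c|) (atTop ×ˢ 𝓟 K) (𝓝 0) := by
    have := ENNReal.tendsto_ofReal (tendsto_sub_nhds_zero_iff.2 h).abs
    simpa using this
  have h2 := eventually_prod_principal_iff.1 ((ENNReal.tendsto_nhds_zero.1 h') e he)
  filter_upwards [h2] with k hk
  exact iSup₂_le hk

/-- Subsequence criterion for convergence in probability uniformly in time. -/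
theorem tendstoUCP_of_subseq {Y : ℕ → ℝ → Ω → ℝ} {c : ℝ} {K : Set ℝ}
    (hm : ∀ n, AEMeasurable (fun ω => ⨆ t ∈ K, ENNReal.ofReal |Y n t ω - c|) μ)
    (h : ∀ ns : ℕ → ℕ, Tendsto ns atTop atTop → ∃ ms : ℕ → ℕ, ∀ᵐ ω ∂μ,
      Tendsto (fun x : ℕ × ℝ => Y (ns (ms x.1)) x.2 ω) (atTop ×ˢ 𝓟 K) (𝓝 c)) :
    TendstoUCP μ K Y fun _ _ => c := by
  intro ε hε
  refine tendsto_of_subseq_tendsto fun ns hns => ?_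
  obtain ⟨ms, hms⟩ := h ns hns
  refine ⟨ms, tendsto_measure_ge_of_ae_tendsto_zero (fun k => hm _) ?_ ε hε⟩
  exact hms.mono fun ω hω => tendsto_iSup_of_tendsto_prod (Y := fun k t => Y (ns (ms k)) t ω) hω

/-- The deterministic ratio argument. -/
theorem tendsto_ratio {V₁ V₂ : ℕ → ℝ → ℝ} {A₁ A₂ : ℕ → ℝ} {I : ℝ → ℝ} {K : Set ℝ} {m r : ℝ}
    (hm : 0 < m) (hI : ∀ t ∈ K, m ≤ I t) (hA₁ : ∀ k, A₁ k ≠ 0) (hA₂ : ∀ k, A₂ k ≠ 0)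
    (hA : Tendsto (fun k => A₁ k / A₂ k) atTop (𝓝 r))
    (h₁ : Tendsto (fun x : ℕ × ℝ => A₁ x.1 * V₁ x.1 x.2 - I x.2) (atTop ×ˢ 𝓟 K) (𝓝 0))
    (h₂ : Tendsto (fun x : ℕ × ℝ => A₂ x.1 * V₂ x.1 x.2 - I x.2) (atTop ×ˢ 𝓟 K) (𝓝 0)) :
    Tendsto (fun x : ℕ × ℝ => V₂ x.1 x.2 / V₁ x.1 x.2) (atTop ×ˢ 𝓟 K) (𝓝 r) := by
  have hev : ∀ᶠ x : ℕ × ℝ in atTop ×ˢ 𝓟 K, x.2 ∈ K :=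
    tendsto_snd.eventually (mem_principal_self K)
  have hone {A : ℕ → ℝ} {V : ℕ → ℝ → ℝ}
      (h : Tendsto (fun x : ℕ × ℝ => A x.1 * V x.1 x.2 - I x.2) (atTop ×ˢ 𝓟 K) (𝓝 0)) :
      Tendsto (fun x : ℕ × ℝ => A x.1 * V x.1 x.2 / I x.2) (atTop ×ˢ 𝓟 K) (𝓝 1) := by
    have h' : Tendsto (fun x : ℕ × ℝ => |A x.1 * V x.1 x.2 - I x.2| / m) (atTop ×ˢ 𝓟 K) (𝓝 0) := by
      simpa using h.abs.div_const m
    rw [← tendsto_sub_nhds_zero_iff, tendsto_zero_iff_abs_tendsto_zero]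
    refine tendsto_of_tendsto_of_tendsto_of_le_of_le' tendsto_const_nhds h'
      (Eventually.of_forall fun _ => abs_nonneg _) ?_
    filter_upwards [hev] with x hx
    have hIx := hI _ hx
    have hpos : 0 < I x.2 := hm.trans_le hIx
    rw [Function.comp_apply, div_sub_one hpos.ne', abs_div, abs_of_pos hpos]
    gcongr
  have h := ((hone h₂).div (hone h₁) one_ne_zero).mul (hA.comp tendsto_fst)
  rw [div_one, one_mul] at h
  refine h.congr' ?_
  filter_upwards [hev] with x hx
  have hpos : I x.2 ≠ 0 := (hm.trans_le (hI _ hx)).ne'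
  have h1 := hA₁ x.1
  have h2 := hA₂ x.1
  simp only [Function.comp_apply, Pi.div_apply]
  rcases eq_or_ne (V₁ x.1 x.2) 0 with h0 | h0
  -- Where `V₁` vanishes, both sides are zero by the convention for division by zero.
  · simp [h0]
  · field_simp

theorem hFun_two_rpow {p : ℝ} (hp : 0 < p) (α : ℝ) :
    hFun p ((2 : ℝ) ^ ((2 * α + 1) * p / 2)) = α := by
  rw [hFun, Real.logb_rpow (by norm_num) (by norm_num)]
  field_simp
  ring

theorem continuousAt_hFun {p x : ℝ} (hx : x ≠ 0) : ContinuousAt (hFun p) x := by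
  unfold hFun Real.logb
  exact ((((Real.continuousAt_log hx).div_const _).div_const _).sub continuousAt_const)

theorem measurable_hFun (p : ℝ) : Measurable (hFun p) := by
  unfold hFun Real.logb
  fun_prop

end

end BSS

/-! ### Convergence along subsequences and the main theorem -/

namespace BSS

/-- Almost sure uniform convergence of the change-of-frequency statistic along a subsequence. -/
theorem exists_subseq_tendsto_COF {Ω : Type*} {mΩ : MeasurableSpace Ω} {μ : Measure Ω}
    [IsProbabilityMeasure μ] {ℱ : Filtration ℝ mΩ} {W : Set ℝ → Ω → ℝ} (hW : IsWhiteNoise μ ℱ W)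
    {α : ℝ} (hα : α < 1 / 2) {g : ℝ → ℝ} (hg2 : MemLp g 2 (volume.restrict (Ioi 0)))
    {σ : ℝ → Ω → ℝ} (hσa : Adapted ℱ σ) (hσc : IsCadlag σ)
    (hfin : ∀ t : ℝ, ∀ᵐ ω ∂μ, ∫⁻ s in Iio t, ENNReal.ofReal (g (t - s) ^ 2 * σ s ω ^ 2) < ∞)
    {X G : ℝ → Ω → ℝ} (hX : IsBSS μ ℱ W g σ X) (hG : IsGaussianCore μ ℱ W g G)
    (hA1 : AssumptionA1 μ 2 α g σ) (hA2 : AssumptionA2 2 α (variogram μ G)) {δ : ℕ → ℝ}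
    (hδ : ∀ k, 0 < δ k) (hδ0 : Tendsto δ atTop (𝓝 0)) {t₀ T : ℝ} (ht₀ : 0 < t₀) (hT : t₀ ≤ T)
    (hne : ∀ᵐ ω ∂μ, ∃ s ∈ Ico 0 t₀, σ s ω ≠ 0) {p : ℝ} (hp : 0 < p) :
    ∃ φ : ℕ → ℕ, ∀ᵐ ω ∂μ, Tendsto (fun x : ℕ × ℝ => COF X p (δ (φ x.1)) x.2 ω)
      (atTop ×ˢ 𝓟 (Icc t₀ T)) (𝓝 ((2 : ℝ) ^ ((2 * α + 1) * p / 2))) := by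
  have hg : ContDiffOn ℝ 2 g (Ioi 0) := by exact_mod_cast hA1.g_smooth
  have hgc := hg.continuousOn
  have hσm (ω : Ω) : Measurable fun s => σ s ω := (hσc.isCadlagFun ω).measurable
  obtain ⟨a, ha, hanti⟩ := hA1.deriv_antitone
  obtain ⟨-, L, -, hL, -, hR, -⟩ := hA2
  set S : ℝ → ℝ := fun d => (sqNorm (kern g d)).toReal with hS
  have hvar (t) : variogram μ G t = (diffSq g t).toReal := hG.variogram_eq hW hgc hg2 t
  obtain ⟨hS0, hS4, hS2⟩ := tauSq_asymptotics (T := S) hL hα hR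
    (fun x => by rw [hvar]; exact ENNReal.toReal_nonneg)
    fun d => by rw [hvar, hvar]; exact sqNorm_kern_toReal hgc hg2 d
  have hQ : ∀ᵐ ω ∂μ, sqNorm (fun s => kern g 1 (0 - s) * σ s ω) ≠ ∞ := by
    filter_upwards [hfin 0, hfin (-1), hfin (-2)] with ω h0 h1 h2
    refine sqNorm_kern_one_mul_ne_top hgc (hσm ω) fun t ht => ?_
    rcases ht with rfl | rfl | rfl
    exacts [h0, h1, h2]
  obtain ⟨φ, hφ, hpos, hae⟩ := exists_subseq_tendsto_powerVariation hW hX hG hg hg2 ha hanti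
    hA1.deriv_memLp hσa hσc hQ (fun d => rfl) hS0 hS4 hδ hδ0 hp (ht₀.trans_le hT)
  refine ⟨φ, ?_⟩
  have hδφ : Tendsto (fun k => δ (φ k)) atTop (𝓝[>] 0) := tendsto_nhdsWithin_iff.2
    ⟨hδ0.comp hφ.tendsto_atTop, Eventually.of_forall fun k => hδ _⟩
  -- The mesh cancels in the quotient of normalizations, leaving the `p`-th power of τ(2δ)/τ(δ).
  have hA : Tendsto (fun k => (δ (φ k) * (√(S ((0 + 1 : ℕ) * δ (φ k))) ^ p)⁻¹) /
      (δ (φ k) * (√(S ((1 + 1 : ℕ) * δ (φ k))) ^ p)⁻¹)) atTop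
      (𝓝 ((2 : ℝ) ^ ((2 * α + 1) * p / 2))) := by
    have h := ((hS2.comp hδφ).sqrt).rpow_const (p := p) (Or.inr hp.le)
    have e : √((2 : ℝ) ^ (2 * α + 1)) ^ p = (2 : ℝ) ^ ((2 * α + 1) * p / 2) := by
      rw [Real.sqrt_eq_rpow, ← Real.rpow_mul (by positivity), ← Real.rpow_mul (by norm_num)]
      congr 1
      ring
    rw [e] at h
    refine h.congr fun k => ?_
    have h0 : 0 < S (δ (φ k)) := by simpa using hpos k 0
    have h1 : 0 < S (2 * δ (φ k)) := by simpa using hpos k 1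
    have hd := hδ (φ k)
    simp only [Function.comp_apply, zero_add, Nat.cast_one, one_mul, one_add_one_eq_two,
      Nat.cast_ofNat]
    rw [Real.sqrt_div h1.le, Real.div_rpow (Real.sqrt_nonneg _) (Real.sqrt_nonneg _)]
    have h2 : 0 < √(S (δ (φ k))) ^ p := by positivity
    have h3 : 0 < √(S (2 * δ (φ k))) ^ p := by positivity
    field_simp
  filter_upwards [hae, hne] with ω hω hneω
  have hsub : (atTop ×ˢ 𝓟 (Icc t₀ T) : Filter (ℕ × ℝ)) ≤ atTop ×ˢ 𝓟 (Icc 0 T) :=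
    prod_mono le_rfl (principal_mono.2 (Icc_subset_Icc_left ht₀.le))
  have hf := hσc.isCadlagFun ω
  have hfp : IsCadlagFun fun s => |σ s ω| ^ p :=
    hf.comp_continuous (h := fun x => |x| ^ p) (continuous_abs.rpow_const fun _ => Or.inr hp.le)
  -- The lower bound is random, which is harmless because the ratio argument is applied for each `ω`
  -- separately.
  have hI0 : 0 < absMoment p * ∫ s in (0 : ℝ)..t₀, |σ s ω| ^ p :=
    mul_pos (absMoment_pos hp) (intervalIntegral_abs_rpow_pos hf hp hneω)
  have hne0 (k : ℕ) (b : Fin 2) :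
      δ (φ k) * (√(S ((b + 1 : ℕ) * δ (φ k))) ^ p)⁻¹ ≠ 0 := by
    have h1 := Real.rpow_pos_of_pos (Real.sqrt_pos.2 (hpos k b)) p
    have := hδ (φ k)
    positivity
  refine tendsto_ratio (V₁ := fun k t => powerVariation X p 2 1 (δ (φ k)) t ω)
    (V₂ := fun k t => powerVariation X p 2 2 (δ (φ k)) t ω)
    (A₁ := fun k => δ (φ k) * (√(S ((0 + 1 : ℕ) * δ (φ k))) ^ p)⁻¹)
    (A₂ := fun k => δ (φ k) * (√(S ((1 + 1 : ℕ) * δ (φ k))) ^ p)⁻¹)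
    (I := fun t => absMoment p * ∫ s in (0 : ℝ)..t, |σ s ω| ^ p) hI0 (fun t ht => ?_)
    (fun k => hne0 k 0) (fun k => hne0 k 1) hA ((hω 0).mono_left hsub) ((hω 1).mono_left hsub)
  refine mul_le_mul_of_nonneg_left ?_ (absMoment_pos hp).le
  exact intervalIntegral.integral_mono_interval le_rfl ht₀.le ht.1
    (Eventually.of_forall fun x => by simp only [Pi.zero_apply]; positivity)
    (hfp.intervalIntegrable _ _)

theorem aemeasurable_increment {Ω : Type*} {mΩ : MeasurableSpace Ω} {μ : Measure Ω}
    {X : ℝ → Ω → ℝ} (hX : ∀ t, AEMeasurable (X t) μ) (k v : ℕ) (δ : ℝ) (i : ℕ) :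
    AEMeasurable (increment X k v δ i) μ :=
  Finset.aemeasurable_fun_sum _ fun _ _ => (hX _).const_mul _

end BSS

theorem mainTheorem5 {Ω : Type*} {mΩ : MeasurableSpace Ω} (μ : Measure Ω) [IsProbabilityMeasure μ]
    (ℱ : Filtration ℝ mΩ) (W : Set ℝ → Ω → ℝ) (hW : BSS.IsWhiteNoise μ ℱ W)
    (α : ℝ) (hα : α ∈ Ioo (-(1 / 2) : ℝ) 0 ∪ Ioo (0 : ℝ) (1 / 2))
    (g : ℝ → ℝ) (hg : MemLp g 2 (volume.restrict (Ioi 0)))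
    (σ : ℝ → Ω → ℝ) (hσ_adapted : Adapted ℱ σ) (hσ_cadlag : BSS.IsCadlag σ)
    (hfin : ∀ t : ℝ, ∀ᵐ ω ∂μ,
      ∫⁻ s in Iio t, ENNReal.ofReal (g (t - s) ^ 2 * σ s ω ^ 2) < ∞)
    (X : ℝ → Ω → ℝ) (hX : BSS.IsBSS μ ℱ W g σ X)
    (G : ℝ → Ω → ℝ) (hG : BSS.IsGaussianCore μ ℱ W g G)
    (hA1 : BSS.AssumptionA1 μ 2 α g σ)
    (hA2 : BSS.AssumptionA2 2 α (BSS.variogram μ G))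
    (Δ : ℕ → ℝ) (hΔ_pos : ∀ n, 0 < Δ n) (hΔ : Tendsto Δ atTop (𝓝 0))
    (t₀ T : ℝ) (ht₀ : 0 < t₀) (hT : t₀ ≤ T)
    (hσ_ne : ∀ᵐ ω ∂μ, ∃ s ∈ Ico 0 t₀, σ s ω ≠ 0)
    (p : ℝ) (hp : 0 < p) :
    BSS.TendstoUCP μ (Icc t₀ T) (fun n t ω => BSS.COF X p (Δ n) t ω)
      (fun _ _ => (2 : ℝ) ^ ((2 * α + 1) * p / 2)) ∧
    BSS.TendstoUCP μ (Icc t₀ T) (fun n t ω => BSS.hFun p (BSS.COF X p (Δ n) t ω))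
      (fun _ _ => α) := by
  have hα' : α < 1 / 2 := by
    rcases hα with h | h
    · linarith [h.2]
    · exact h.2
  have hXm (t : ℝ) : AEMeasurable (X t) μ := (hX t).aemeasurable hW
  have hsub (ns : ℕ → ℕ) (hns : Tendsto ns atTop atTop) :=
    BSS.exists_subseq_tendsto_COF hW hα' hg hσ_adapted hσ_cadlag hfin hX hG hA1 hA2
      (δ := fun k => Δ (ns k)) (fun k => hΔ_pos _) (hΔ.comp hns) ht₀ hT hσ_ne hp
  -- The statistic with the number of observations as its argument; evaluating at `m = ⌊t / Δ n⌋₊`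
  -- recovers `COF`, which gives measurability of the suprema over time.
  set y : ℕ → ℕ → Ω → ℝ := fun n m ω =>
    (∑ i ∈ Finset.Icc (2 * 2) m, |BSS.increment X 2 2 (Δ n) i ω| ^ p) /
      ∑ i ∈ Finset.Icc (1 * 2) m, |BSS.increment X 2 1 (Δ n) i ω| ^ p with hy
  have hym (n m) : AEMeasurable (y n m) μ := by
    have h (v l : ℕ) : AEMeasurable
        (fun ω => ∑ i ∈ Finset.Icc l m, |BSS.increment X 2 v (Δ n) i ω| ^ p) μ :=
      Finset.aemeasurable_fun_sum _ fun i _ =>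
        (by fun_prop : Measurable fun x : ℝ => |x| ^ p).comp_aemeasurable
          (BSS.aemeasurable_increment hXm 2 v (Δ n) i)
    exact (h 2 _).div (h 1 _)
  have hlim : (2 : ℝ) ^ ((2 * α + 1) * p / 2) ≠ 0 := by positivity
  constructor
  · exact BSS.tendstoUCP_of_subseq (fun n => BSS.aemeasurable_iSup_floor (hym n) _ (Δ n) _) hsub
  · refine BSS.tendstoUCP_of_subseq (fun n => BSS.aemeasurable_iSup_floor
      (fun m => (BSS.measurable_hFun p).comp_aemeasurable (hym n m)) _ (Δ n) _) fun ns hns => ?_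
    obtain ⟨ms, hms⟩ := hsub ns hns
    refine ⟨ms, hms.mono fun ω hω => ?_⟩
    -- The limit is a nonzero constant in `t`, so continuity of `hFun` at one point transfers the
    -- uniform convergence.
    have h := (BSS.continuousAt_hFun (p := p) hlim).tendsto.comp hω
    rwa [BSS.hFun_two_rpow hp] at h
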